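/- **Setting.** Let $G=(V,E)$ be a finite simple undirected graph with edge weights $w:E\to\mathbb{R}_{\ge 0}$, let $T\subseteq V$ be a nonempty set of $k$ terminals lying in one connected component of $G$, and let $\widehat X\subseteq E$ be an arbitrary set of predicted edges. A *Steiner tree* is a set $X\subseteq E$ such that all terminals lie in the same connected component of $(V,X)$; $w(X)=\sum_{e\in X}w(e)$. For edge weights $w$, let $\mathbf{c}(\{t_1,t_2\})$ be the length, with respect to $w$, of a shortest path in $G$ between the terminals $t_1,t_2$; these are the edge costs of the metric closure $(T,\binom T2)$. *Refined Steiner algorithm* with parameter $\alpha\ge 1$: let $w_\alpha(e)=w(e)/\alpha$ for $e\in\widehat X$ and $w_\alpha(e)=w(e)$ otherwise; compute a minimum spanning tree $\mathrm{MST}_\alpha$ of the metric closure of $T$ with respect to $w_\alpha$; for each edge $\{t_1,t_2\}$ of $\mathrm{MST}_\alpha$ choose a cheapest $t_1$–$t_2$ path in $G$ with respect to $w_\alpha$; output the union of the edge sets of these paths. (Ties are broken arbitrarily.) *Search for the best $\alpha$*, for $\varepsilon>0$: run the refined Steiner algorithm with $\alpha=(1+\varepsilon)^i$ for $i=0,1,\dots,\lceil\log_{1+\varepsilon}\varepsilon^{-1}\rceil$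 and output a solution of minimum weight $w$ among those found. **Theorem.** 1. (Running time.) The search can be implemented in near-linear time for every constant $\varepsilon>0$: there are a program of a real random access machine (unit-cost memory access, arithmetic and comparisons on reals, increments, decrements and comparisons on natural numbers) and a $d\in\mathbb{N}$ such that for every $\varepsilon>0$ there is a constant $C$ such that, given $\varepsilon$ and any instance $(G,w,T,\widehat X)$ with $n$ vertices and a list of its $m$ edges, the program halts after at most $C\,(n+m)\log^d(n+m+2)$ steps with a valid output of the search. 2. (Quality.) For every $\varepsilon>0$ and every instance, every output $X$ of the search is a Steiner tree, and for every Steiner tree $X'\subseteq E$, every minimum spanning tree $\mathrm{MST}$ of the metric closure of $T$ with respect to $w$, every set $S$ of $\min\{k-1,|\widehat X\setminus X'|\}$ edges of highest cost $\mathbf{c}$ contained in $\mathrm{MST}$, and every real $\alpha\ge1$, $$w(X)\le(1+\varepsilon)\left(\Big(1+\frac1\alpha\Big)w(X')+\Big(1-\frac1\alpha\Big)\eta^-+\min\Big\{\eta^+,\ (\alpha-1)\sum_{e\in S}\mathbf{c}(e)\Big\}\right),$$ where $\eta^+=w(\widehat X\setminus X')$ and $\eta^-=w(X'\setminus\widehat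 X)$. That is, $w(X)$ is at most $1+\varepsilon$ times the infimum over $\alpha\ge1$ of the expression in the large parentheses. -/

import Mathlib

namespace SteinerPred

/-! ### Steiner trees, metric closures and spanning trees -/

/-- An instance of the Steiner Tree problem with predictions, on the vertex set `V`: a graph, a
nonempty set of terminals that lie in one connected component (so that a Steiner tree exists),
nonnegative edge weights (only the values of `weight` on edges matter), and an arbitrary set `pred`
of predicted edges. -/
structure Instance (V : Type*) where
  graph : SimpleGraph V
  terminals : Finset V
  weight : Sym2 V → ℝ
  pred : Finset (Sym2 V)
  terminals_nonempty : terminals.Nonempty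
  terminals_reachable : ∀ s ∈ terminals, ∀ t ∈ terminals, graph.Reachable s t
  weight_nonneg : ∀ e ∈ graph.edgeSet, 0 ≤ weight e
  pred_subset : (pred : Set (Sym2 V)) ⊆ graph.edgeSet

/-- `w(X)`, the total weight of a set of edges. -/
def totalWeight {V : Type*} (w : Sym2 V → ℝ) (X : Finset (Sym2 V)) : ℝ := ∑ e ∈ X, w e

/-- `X` is a set of edges of the graph such that all terminals belong to the same connected
component of `(V, X)`. -/
def Instance.IsSteinerTree {V : Type*} (I : Instance V) (X : Finset (Sym2 V)) : Prop :=
  (X : Set (Sym2 V)) ⊆ I.graph.edgeSet ∧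
    ∀ s ∈ I.terminals, ∀ t ∈ I.terminals,
      (SimpleGraph.fromEdgeSet (X : Set (Sym2 V))).Reachable s t

/-- The length of a walk with respect to the edge weights `w`. -/
def walkWeight {V : Type*} {G : SimpleGraph V} (w : Sym2 V → ℝ) {s t : V} (p : G.Walk s t) : ℝ :=
  (p.edges.map w).sum

/-- `p` is a cheapest path between its endpoints with respect to `w`. -/
def IsCheapestPath {V : Type*} {G : SimpleGraph V} (w : Sym2 V → ℝ) {s t : V}
    (p : G.Walk s t) : Prop :=
  p.IsPath ∧ ∀ q : G.Walk s t, q.IsPath → walkWeight w p ≤ walkWeight w q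

/-- The length of a shortest path from `s` to `t`. In a finite graph there are finitely many paths,
so the infimum is a minimum whenever `t` can be reached from `s`. -/
noncomputable def pathDist {V : Type*} (G : SimpleGraph V) (w : Sym2 V → ℝ) (s t : V) : ℝ :=
  ⨅ p : G.Path s t, walkWeight w (p : G.Walk s t)

theorem pathDist_comm {V : Type*} (G : SimpleGraph V) (w : Sym2 V → ℝ) (s t : V) :
    pathDist G w s t = pathDist G w t s := by
  refine Equiv.iInf_congr
    (⟨fun p => p.reverse, fun p => p.reverse, fun p => ?_, fun p => ?_⟩ :
      G.Path s t ≃ G.Path t s) fun p => ?_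
  · exact Subtype.ext (SimpleGraph.Walk.reverse_reverse _)
  · exact Subtype.ext (SimpleGraph.Walk.reverse_reverse _)
  · simp [walkWeight, SimpleGraph.Path.reverse, List.sum_reverse]

/-- The cost of the connections of the metric closure of the terminals, i.e. of the complete graph
on the terminals, with respect to the edge weights `w`. -/
noncomputable def Instance.closureCost {V : Type*} (I : Instance V) (w : Sym2 V → ℝ) :
    Sym2 I.terminals → ℝ :=
  Sym2.lift ⟨fun s t => pathDist I.graph w s t, fun s t => pathDist_comm I.graph w s t⟩

/-- `M` is the edge set of a spanning tree of the complete graph on `U`. -/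
def IsSpanningTree {U : Type*} (M : Finset (Sym2 U)) : Prop :=
  (∀ e ∈ M, ¬ e.IsDiag) ∧ (SimpleGraph.fromEdgeSet (M : Set (Sym2 U))).IsTree

/-- `M` is a minimum spanning tree of the complete graph on `U` with edge costs `c`. -/
def IsMinSpanningTree {U : Type*} (c : Sym2 U → ℝ) (M : Finset (Sym2 U)) : Prop :=
  IsSpanningTree M ∧ ∀ M' : Finset (Sym2 U), IsSpanningTree M' → ∑ e ∈ M, c e ≤ ∑ e ∈ M', c e

/-- `S` is a set of `k` edges with the highest cost contained in `M`. -/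
def IsTopEdges {U : Type*} (c : Sym2 U → ℝ) (M : Finset (Sym2 U)) (k : ℕ)
    (S : Finset (Sym2 U)) : Prop :=
  S ⊆ M ∧ S.card = k ∧ ∀ e ∈ S, ∀ e' ∈ M, e' ∉ S → c e' ≤ c e

/-! ### The two algorithms -/

/-- The weights `w_α`: the weights of the predicted edges are divided by `α`. -/
noncomputable def Instance.scaledWeight {V : Type*} [DecidableEq V] (I : Instance V) (α : ℝ) :
    Sym2 V → ℝ :=
  fun e => if e ∈ I.pred then I.weight e / α else I.weight e

/-- `X` is a possible output of the refined Steiner algorithm with parameter `α`: the union of the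
edge sets of the paths `p e`, for `e` in some minimum spanning tree `M` of the metric closure of
the terminals with respect to `w_α`, where `p e` is some cheapest path with respect to `w_α` between
the two ends of `e`. (Ties are broken arbitrarily.) -/
def Instance.IsRefinedOutput {V : Type*} [DecidableEq V] (I : Instance V) (α : ℝ)
    (X : Finset (Sym2 V)) : Prop :=
  ∃ M : Finset (Sym2 I.terminals), IsMinSpanningTree (I.closureCost (I.scaledWeight α)) M ∧
    ∃ p : Sym2 I.terminals → Finset (Sym2 V),
      (∀ e ∈ M, ∃ (s t : I.terminals) (q : I.graph.Walk s t),
        e = s(s, t) ∧ IsCheapestPath (I.scaledWeight α) q ∧ p e = q.edges.toFinset) ∧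
      X = M.biUnion p

/-- The last index `⌈log_{1+ε} ε⁻¹⌉` of the search for `α`. The logarithm is larger than `-1`, so
that the ceiling is a natural number, for every `ε > 0`. -/
noncomputable def lastIndex (ε : ℝ) : ℕ := ⌈Real.logb (1 + ε) ε⁻¹⌉₊

/-- `X` is a possible output of the search for the best `α`: run the refined Steiner algorithm with
`α = (1 + ε) ^ i` for `i = 0, …, ⌈log_{1+ε} ε⁻¹⌉` and return a solution of minimum weight among
the solutions found. -/
def Instance.IsSearchOutput {V : Type*} [DecidableEq V] (I : Instance V) (ε : ℝ)
    (X : Finset (Sym2 V)) : Prop :=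
  ∃ Y : ℕ → Finset (Sym2 V),
    (∀ i ≤ lastIndex ε, I.IsRefinedOutput ((1 + ε) ^ i) (Y i)) ∧
    ∃ j ≤ lastIndex ε, X = Y j ∧
      ∀ i ≤ lastIndex ε, totalWeight I.weight (Y j) ≤ totalWeight I.weight (Y i)

/-- The upper bound
`(1 + 1/α) w(X') + (1 - 1/α) η⁻ + min {η⁺, (α - 1) ∑_{e ∈ S} c(e)}`,
where `(η⁺, η⁻)` is the error of the prediction with respect to `X'` and `c` is the cost in the
metric closure with respect to the unscaled weights. -/
noncomputable def Instance.refinedBound {V : Type*} [DecidableEq V] (I : Instance V)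
    (X' : Finset (Sym2 V)) (S : Finset (Sym2 I.terminals)) (α : ℝ) : ℝ :=
  (1 + 1 / α) * totalWeight I.weight X' +
    (1 - 1 / α) * totalWeight I.weight (X' \ I.pred) +
    min (totalWeight I.weight (I.pred \ X')) ((α - 1) * ∑ e ∈ S, I.closureCost I.weight e)

/-! ### Programs of a real random access machine

The machine has a memory of arrays of natural numbers and of arrays of real numbers, unbounded in
length; a program names finitely many of them. Indirect addressing is by natural numbers. The only
arithmetic on natural numbers is `+ 1` and `- 1`, so that in `t` steps no entry grows by more than a
constant times `t`. Real numbers have the four arithmetic operations and comparisons, and cannot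
be converted to natural numbers. -/

/-- The memory: `nat a i` and `real a i` are the `i`-th entries of the arrays with name `a`. -/
structure Memory where
  nat : ℕ → ℕ → ℕ
  real : ℕ → ℕ → ℝ

/-- Expressions for natural numbers. -/
inductive NatExp where
  | const (k : ℕ)
  | get (a : ℕ) (i : NatExp)
  | succ (x : NatExp)
  | pred (x : NatExp)

/-- Expressions for real numbers. -/
inductive RealExp where
  | const (k : ℕ)
  | get (a : ℕ) (i : NatExp)
  | add (x y : RealExp)
  | sub (x y : RealExp)
  | mul (x y : RealExp)
  | div (x y : RealExp)

/-- Tests. -/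
inductive Test where
  | natEq (x y : NatExp)
  | natLe (x y : NatExp)
  | realLe (x y : RealExp)
  | not (b : Test)
  | and (b b' : Test)

/-- Programs. -/
inductive Cmd where
  | skip
  | setNat (a : ℕ) (i x : NatExp)
  | setReal (a : ℕ) (i : NatExp) (x : RealExp)
  | seq (P Q : Cmd)
  | ite (b : Test) (P Q : Cmd)
  | loop (b : Test) (P : Cmd)

def NatExp.eval (μ : Memory) : NatExp → ℕ
  | .const k => k
  | .get a i => μ.nat a (i.eval μ)
  | .succ x => x.eval μ + 1
  | .pred x => x.eval μ - 1

noncomputable def RealExp.eval (μ : Memory) : RealExp → ℝ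
  | .const k => k
  | .get a i => μ.real a (i.eval μ)
  | .add x y => x.eval μ + y.eval μ
  | .sub x y => x.eval μ - y.eval μ
  | .mul x y => x.eval μ * y.eval μ
  | .div x y => x.eval μ / y.eval μ

def Test.Holds (μ : Memory) : Test → Prop
  | .natEq x y => x.eval μ = y.eval μ
  | .natLe x y => x.eval μ ≤ y.eval μ
  | .realLe x y => x.eval μ ≤ y.eval μ
  | .not b => ¬ b.Holds μ
  | .and b b' => b.Holds μ ∧ b'.Holds μ

def Memory.setNat (μ : Memory) (a i x : ℕ) : Memory :=
  { μ with nat := Function.update μ.nat a (Function.update (μ.nat a) i x) }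

noncomputable def Memory.setReal (μ : Memory) (a i : ℕ) (x : ℝ) : Memory :=
  { μ with real := Function.update μ.real a (Function.update (μ.real a) i x) }

/-- `Exec P μ μ' t`: started in memory `μ`, the program `P` halts after `t` steps in memory `μ'`.
A step is an assignment or a test; the expressions in it are a fixed part of the program, so that
it stands for a number of machine operations that is bounded by a constant of the program. -/
inductive Exec : Cmd → Memory → Memory → ℕ → Prop
  | skip (μ : Memory) : Exec .skip μ μ 0
  | setNat (a : ℕ) (i x : NatExp) (μ : Memory) :
      Exec (.setNat a i x) μ (μ.setNat a (i.eval μ) (x.eval μ)) 1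
  | setReal (a : ℕ) (i : NatExp) (x : RealExp) (μ : Memory) :
      Exec (.setReal a i x) μ (μ.setReal a (i.eval μ) (x.eval μ)) 1
  | seq {P Q : Cmd} {μ μ' μ'' : Memory} {t t' : ℕ} :
      Exec P μ μ' t → Exec Q μ' μ'' t' → Exec (.seq P Q) μ μ'' (t + t')
  | ite_true {b : Test} {P Q : Cmd} {μ μ' : Memory} {t : ℕ} :
      b.Holds μ → Exec P μ μ' t → Exec (.ite b P Q) μ μ' (t + 1)
  | ite_false {b : Test} {P Q : Cmd} {μ μ' : Memory} {t : ℕ} :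
      ¬ b.Holds μ → Exec Q μ μ' t → Exec (.ite b P Q) μ μ' (t + 1)
  | loop_true {b : Test} {P : Cmd} {μ μ' μ'' : Memory} {t t' : ℕ} :
      b.Holds μ → Exec P μ μ' t → Exec (.loop b P) μ' μ'' t' →
        Exec (.loop b P) μ μ'' (t + t' + 1)
  | loop_false {b : Test} {P : Cmd} {μ : Memory} :
      ¬ b.Holds μ → Exec (.loop b P) μ μ 1

/-! ### Input and output of programs -/

/-- The edge with number `j` in a list of edges that are given by their two ends. -/
def edgeAt {V : Type*} {m : ℕ} (ends : Fin m → V × V) (j : Fin m) : Sym2 V :=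
  s((ends j).1, (ends j).2)

/-- `ends` lists every edge of `G` exactly once, in any order and orientation. -/
def IsEdgeList {V : Type*} (G : SimpleGraph V) {m : ℕ} (ends : Fin m → V × V) : Prop :=
  Function.Injective (edgeAt ends) ∧ Set.range (edgeAt ends) = G.edgeSet

/-- The input: `n` and `m` in array `0`, the first and the second ends of the edges in arrays `1`
and `2`, the indicator of the terminals in array `3`, the indicator of the predicted edges in array
`4`; the weights of the edges in the real array `0`, and `ε` in the real array `1`. All other
entries are zero. -/
noncomputable def inputMemory {n m : ℕ} (I : Instance (Fin n)) (ends : Fin m → Fin n × Fin n)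
    (ε : ℝ) : Memory where
  nat a i :=
    match a with
    | 0 => if i = 0 then n else if i = 1 then m else 0
    | 1 => if h : i < m then ((ends ⟨i, h⟩).1 : ℕ) else 0
    | 2 => if h : i < m then ((ends ⟨i, h⟩).2 : ℕ) else 0
    | 3 => if h : i < n then (if (⟨i, h⟩ : Fin n) ∈ I.terminals then 1 else 0) else 0
    | 4 => if h : i < m then (if edgeAt ends ⟨i, h⟩ ∈ I.pred then 1 else 0) else 0
    | _ => 0
  real a i :=
    match a with
    | 0 => if h : i < m then I.weight (edgeAt ends ⟨i, h⟩) else 0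
    | 1 => if i = 0 then ε else 0
    | _ => 0

/-- The output: the set of the edges whose entry in array `5` is nonzero. -/
def outputEdges {n m : ℕ} (ends : Fin m → Fin n × Fin n) (μ : Memory) : Finset (Sym2 (Fin n)) :=
  (Finset.univ.filter fun j : Fin m => μ.nat 5 j ≠ 0).image (edgeAt ends)

end SteinerPred

namespace SteinerPred

/-! ### Exchange between spanning trees -/

section SpanningTree

variable {U : Type*}

/-! Quality for a fixed α. Let a and b = η⁻ be the weights of X' inside and outside the prediction.
Doubling X' and short-cutting the resulting tour (`exists_tour`, `exists_connections_of_walk`) gives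
w_α(X) ≤ 2 w_α(X'), hence w(X) ≤ 2b + 2a/α + (1 - 1/α) w(X ∩ pred). The correctly predicted edges of
X weigh at most a; let z be the weight of the wrong ones, X ∩ (pred \ X'). What remains is (1 - 1/α)
z. It is at most η⁺, and it equals (α - 1) times the scaled weight of the wrong edges. Each wrong
edge lies on the path of some edge of MST_α, so few tree edges carry all of them. A Hall matching
between spanning trees (`IsMinSpanningTree.exists_exchange`) sends these tree edges injectively to
edges of MST that cost no less, and no set of that size in MST costs more than S
(`scaledWeight_wrong_le`, `Instance.IsRefinedOutput.totalWeight_le`).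

Searching powers of 1 + ε loses only a factor 1 + ε. The error terms decrease when α is rounded down
to a power β, and a/β is at most (1 + ε) a/α if β is close to α, or at most ε a if β is the last
power (`Instance.refinedBound_le_of_le`).

Running time. The number of rounds depends on ε only, so one run must take near-linear time,
although the metric closure may be quadratically large. Mehlhorn's construction avoids the closure.
A shortest path forest grown from all terminals assigns each vertex v a root and a distance d(v). An
edge uv between two trees of the forest stands for a connection of their roots of length d(u) +
w(uv) + d(v), and these connections suffice for a minimum spanning tree: every edge of a shortest
path between terminals stands for a connection no longer than that path. Instead of contracting the
trees, a second search runs Prim's algorithm on the whole graph with cost -1 on forest edges; its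
tree edges outside the forest are the wanted connections (`TwoSearches.exists_minSpanningTree`). The
union of their paths is found by marking ancestors in the forest.

Dijkstra and Prim are one best-first search, with new key flag * key(tail) + cost for flag 1 or 0.
An abstract invariant (`SearchProblem.Invariant`) separates the graph theory from the machine
program, whose priority queue is a tournament tree with logarithmic updates. -/

theorem IsSpanningTree.edgeSet_eq {M : Finset (Sym2 U)} (h : IsSpanningTree M) :
    (SimpleGraph.fromEdgeSet (M : Set (Sym2 U))).edgeSet = M := by
  rw [SimpleGraph.edgeSet_fromEdgeSet]
  ext e
  simp only [Set.mem_sdiff, Finset.mem_coe, and_iff_left_iff_imp]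
  exact h.1 e

theorem card_le_of_connected [Fintype U] {M : Finset (Sym2 U)}
    (h : (SimpleGraph.fromEdgeSet (M : Set (Sym2 U))).Connected) :
    Fintype.card U ≤ M.card + 1 := by
  have h1 := h.card_vert_le_card_edgeSet_add_one
  rw [Nat.card_eq_fintype_card] at h1
  refine h1.trans (Nat.add_le_add_right ?_ 1)
  rw [SimpleGraph.edgeSet_fromEdgeSet, ← Set.ncard_coe_finset M]
  exact Set.ncard_le_ncard Set.sdiff_subset M.finite_toSet

theorem IsSpanningTree.card_add_one [Fintype U] {M : Finset (Sym2 U)} (h : IsSpanningTree M) :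
    M.card + 1 = Fintype.card U := by
  have := (SimpleGraph.isTree_iff_connected_and_card.1 h.2).2
  rw [h.edgeSet_eq, Nat.card_eq_fintype_card] at this
  simpa using this

theorem isSpanningTree_of_card [Fintype U] {M : Finset (Sym2 U)} (hd : ∀ e ∈ M, ¬ e.IsDiag)
    (hc : (SimpleGraph.fromEdgeSet (M : Set (Sym2 U))).Connected)
    (hcard : M.card + 1 ≤ Fintype.card U) : IsSpanningTree M := by
  refine ⟨hd, SimpleGraph.isTree_iff_connected_and_card.2 ⟨hc, ?_⟩⟩
  have : (SimpleGraph.fromEdgeSet (M : Set (Sym2 U))).edgeSet = M := by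
    rw [SimpleGraph.edgeSet_fromEdgeSet]
    ext e
    simp only [Set.mem_sdiff, Finset.mem_coe, and_iff_left_iff_imp]
    exact hd e
  rw [this, Nat.card_eq_fintype_card]
  have := card_le_of_connected hc
  simp; omega

theorem exists_spanningTree_subset [Fintype U] {M : Finset (Sym2 U)}
    (hc : (SimpleGraph.fromEdgeSet (M : Set (Sym2 U))).Connected) :
    ∃ M' ⊆ M, IsSpanningTree M' := by
  classical
  obtain ⟨T, hT, hT'⟩ := hc.exists_isTree_le
  have hsub : T.edgeSet ⊆ M := fun e he => by
    have := SimpleGraph.edgeSet_mono hT he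
    rw [SimpleGraph.edgeSet_fromEdgeSet] at this
    exact this.1
  refine ⟨M.filter (· ∈ T.edgeSet), Finset.filter_subset _ _, ?_, ?_⟩
  · intro e he
    exact T.not_isDiag_of_mem_edgeSet (Finset.mem_filter.1 he).2
  · have : ((M.filter (· ∈ T.edgeSet) : Finset _) : Set (Sym2 U)) = T.edgeSet := by
      ext e
      simpa using fun h => hsub h
    rwa [this, SimpleGraph.fromEdgeSet_edgeSet]

/-- If every adjacency of a connected graph is a reachability of `H`, then `H` is connected. -/
theorem connected_of_adj_reachable {G H : SimpleGraph U} (hG : G.Connected)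
    (h : ∀ x y, G.Adj x y → H.Reachable x y) : H.Connected := by
  have hne := hG.nonempty
  refine { preconnected := fun x y => ?_, nonempty := hne }
  obtain ⟨p⟩ := hG.preconnected x y
  induction p with
  | nil => rfl
  | cons hxy _ ih => exact (h _ _ hxy).trans ih

/-- An edge of a spanning tree is the only connection between its two sides. -/
theorem IsSpanningTree.not_reachable [Fintype U] [DecidableEq U] {M : Finset (Sym2 U)}
    (h : IsSpanningTree M) {x y : U} (hxy : s(x, y) ∈ M) :
    ¬ (SimpleGraph.fromEdgeSet ((M.erase s(x, y) : Finset _) : Set (Sym2 U))).Reachable x y := by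
  intro hr
  -- A second connection of the ends would leave the graph connected with one edge fewer than
  -- connectivity requires.
  have hc := connected_of_adj_reachable (H := SimpleGraph.fromEdgeSet
    ((M.erase s(x, y) : Finset _) : Set (Sym2 U))) h.2.connected (fun a b hab => by
      rw [SimpleGraph.fromEdgeSet_adj] at hab
      by_cases he : s(a, b) = s(x, y)
      · rcases Sym2.eq_iff.1 he with ⟨rfl, rfl⟩ | ⟨rfl, rfl⟩
        · exact hr
        · exact hr.symm
      · refine SimpleGraph.Adj.reachable ?_
        rw [SimpleGraph.fromEdgeSet_adj]
        exact ⟨by rw [Finset.coe_erase]; exact ⟨hab.1, he⟩, hab.2⟩)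
  have h1 := card_le_of_connected hc
  have h2 := h.card_add_one
  have h3 := Finset.card_erase_of_mem hxy
  have h4 := Finset.card_pos.2 ⟨_, hxy⟩
  omega

/-- In a spanning tree, two vertices that are not separated by any edge of `F` are connected
without `F`. -/
theorem IsSpanningTree.reachable_sdiff [Fintype U] [DecidableEq U] {M : Finset (Sym2 U)}
    (h : IsSpanningTree M) (F : Finset (Sym2 U)) {x y : U}
    (hF : ∀ f ∈ F, (SimpleGraph.fromEdgeSet ((M.erase f : Finset _) : Set (Sym2 U))).Reachable x y) :
    (SimpleGraph.fromEdgeSet ((M \ F : Finset _) : Set (Sym2 U))).Reachable x y := by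
  obtain ⟨p, hp⟩ := h.2.connected.exists_isPath x y
  have key : ∀ e ∈ p.edges, e ∈ (SimpleGraph.fromEdgeSet ((M \ F : Finset _) : Set (Sym2 U))).edgeSet := by
    intro e he
    have heM := p.edges_subset_edgeSet he
    rw [h.edgeSet_eq] at heM
    rw [SimpleGraph.edgeSet_fromEdgeSet]
    refine ⟨?_, h.1 e heM⟩
    simp only [Finset.coe_sdiff, Set.mem_sdiff, Finset.mem_coe]
    refine ⟨heM, fun hef => ?_⟩
    -- A path that avoids `e` is also a path of the tree, hence equal to `p`, so `p` cannot use `e`.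
    obtain ⟨q, hq⟩ := (hF e hef).exists_isPath
    have hle : SimpleGraph.fromEdgeSet ((M.erase e : Finset _) : Set (Sym2 U)) ≤
        SimpleGraph.fromEdgeSet (M : Set (Sym2 U)) :=
      SimpleGraph.fromEdgeSet_mono (by simp)
    have hpq : p = q.mapLe hle :=
      congrArg Subtype.val ((h.2.isAcyclic.subsingleton_path x y).elim ⟨p, hp⟩ ⟨_, hq.mapLe hle⟩)
    rw [hpq, SimpleGraph.Walk.edges_mapLe_eq_edges] at he
    have := q.edges_subset_edgeSet he
    rw [SimpleGraph.edgeSet_fromEdgeSet] at this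
    simpa using this.1
  exact ⟨p.transfer _ key⟩

/-- The edges of one spanning tree can be matched injectively to edges of another one that
reconnect the two sides. -/
theorem IsSpanningTree.exists_exchange [Fintype U] [DecidableEq U] {M M' : Finset (Sym2 U)}
    (h : IsSpanningTree M) (h' : IsSpanningTree M') :
    ∃ σ : M → Sym2 U, Function.Injective σ ∧ ∀ f : M, σ f ∈ M' ∧ ∀ x y, σ f = s(x, y) →
      ¬ (SimpleGraph.fromEdgeSet ((M.erase f : Finset _) : Set (Sym2 U))).Reachable x y := by
  classical
  let N : M → Finset (Sym2 U) := fun f => M'.filter fun e => ∀ x y, e = s(x, y) →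
      ¬ (SimpleGraph.fromEdgeSet ((M.erase f : Finset _) : Set (Sym2 U))).Reachable x y
  -- Hall's condition: replacing `F` in `M` by all of its neighbours in `M'` keeps the graph
  -- connected, because an edge of `M'` outside the neighbourhood is separated by no edge of `F`.
  -- Counting edges then gives `F.card ≤ (F.biUnion N).card`.
  obtain ⟨σ, hσ, hσ'⟩ := (Finset.all_card_le_biUnion_card_iff_exists_injective N).1 (by
    intro F
    let F' : Finset (Sym2 U) := F.map (Function.Embedding.subtype _)
    have hF'M : F' ⊆ M := by
      intro e he
      obtain ⟨a, -, rfl⟩ := Finset.mem_map.1 he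
      exact a.2
    have hconn : (SimpleGraph.fromEdgeSet (((M \ F') ∪ F.biUnion N : Finset _) :
        Set (Sym2 U))).Connected := by
      refine connected_of_adj_reachable h'.2.connected fun x y hxy => ?_
      rw [SimpleGraph.fromEdgeSet_adj] at hxy
      by_cases hN : s(x, y) ∈ F.biUnion N
      · refine SimpleGraph.Adj.reachable ?_
        rw [SimpleGraph.fromEdgeSet_adj]
        exact ⟨by simpa using Or.inr (by simpa using hN), hxy.2⟩
      · refine (h.reachable_sdiff F' fun f hf => ?_).mono
          (SimpleGraph.fromEdgeSet_mono (by simp))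
        obtain ⟨a, ha, rfl⟩ := Finset.mem_map.1 hf
        by_contra hcon
        refine hN (Finset.mem_biUnion.2 ⟨a, ha, Finset.mem_filter.2 ⟨hxy.1, fun x' y' he => ?_⟩⟩)
        rcases Sym2.eq_iff.1 he with ⟨rfl, rfl⟩ | ⟨rfl, rfl⟩
        · exact hcon
        · exact fun hr => hcon hr.symm
    have h1 := card_le_of_connected hconn
    have h2 := h.card_add_one
    have h3 := Finset.card_union_le (M \ F') (F.biUnion N)
    have h4 := Finset.card_sdiff_add_card_eq_card hF'M
    have h5 : F'.card = F.card := Finset.card_map _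
    omega)
  refine ⟨σ, hσ, fun f => ?_⟩
  exact Finset.mem_filter.1 (hσ' f)

/-- Without an edge of a spanning tree, every vertex is connected to one of its ends. -/
theorem IsSpanningTree.reachable_or_reachable [DecidableEq U] {M : Finset (Sym2 U)}
    (h : IsSpanningTree M) (a b z : U) :
    (SimpleGraph.fromEdgeSet ((M.erase s(a, b) : Finset _) : Set (Sym2 U))).Reachable z a ∨
      (SimpleGraph.fromEdgeSet ((M.erase s(a, b) : Finset _) : Set (Sym2 U))).Reachable z b := by
  obtain ⟨p⟩ := h.2.connected.preconnected z a
  generalize hw : a = w at p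
  induction p with
  | nil => subst hw; exact Or.inl .rfl
  | @cons u v w huv p ih =>
    subst hw
    rw [SimpleGraph.fromEdgeSet_adj] at huv
    by_cases he : s(u, v) = s(a, b)
    · rcases Sym2.eq_iff.1 he with ⟨rfl, rfl⟩ | ⟨rfl, rfl⟩
      · exact Or.inl .rfl
      · exact Or.inr .rfl
    · have hadj : (SimpleGraph.fromEdgeSet
          ((M.erase s(a, b) : Finset _) : Set (Sym2 U))).Adj u v := by
        rw [SimpleGraph.fromEdgeSet_adj]
        exact ⟨by rw [Finset.coe_erase]; exact ⟨huv.1, he⟩, huv.2⟩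
      exact (ih rfl).imp hadj.reachable.trans hadj.reachable.trans

/-- Exchanging an edge of a spanning tree for one that reconnects the two sides. -/
theorem IsSpanningTree.connected_insert_erase [DecidableEq U] {M : Finset (Sym2 U)}
    (h : IsSpanningTree M) {f : Sym2 U} {x y : U} (hxy : x ≠ y)
    (hn : ¬ (SimpleGraph.fromEdgeSet ((M.erase f : Finset _) : Set (Sym2 U))).Reachable x y) :
    (SimpleGraph.fromEdgeSet
      ((insert s(x, y) (M.erase f) : Finset _) : Set (Sym2 U))).Connected := by
  induction f with | _ a b
  have hle : SimpleGraph.fromEdgeSet ((M.erase s(a, b) : Finset _) : Set (Sym2 U)) ≤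
      SimpleGraph.fromEdgeSet ((insert s(x, y) (M.erase s(a, b)) : Finset _) : Set (Sym2 U)) :=
    SimpleGraph.fromEdgeSet_mono (by simp)
  have hadj : (SimpleGraph.fromEdgeSet
      ((insert s(x, y) (M.erase s(a, b)) : Finset _) : Set (Sym2 U))).Reachable x y := by
    refine SimpleGraph.Adj.reachable ?_
    rw [SimpleGraph.fromEdgeSet_adj]
    exact ⟨by simp, hxy⟩
  have hab : (SimpleGraph.fromEdgeSet
      ((insert s(x, y) (M.erase s(a, b)) : Finset _) : Set (Sym2 U))).Reachable a b := by
    -- `x` and `y` lie on different sides of the removed edge, so the new edge joins the side of `a`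
    -- to the side of `b`.
    rcases h.reachable_or_reachable a b x with hx | hx <;>
      rcases h.reachable_or_reachable a b y with hy | hy
    · exact absurd (hx.trans hy.symm) hn
    · exact ((hx.mono hle).symm.trans hadj).trans (hy.mono hle)
    · exact (((hx.mono hle).symm.trans hadj).trans (hy.mono hle)).symm
    · exact absurd (hx.trans hy.symm) hn
  refine connected_of_adj_reachable h.2.connected fun u v huv => ?_
  rw [SimpleGraph.fromEdgeSet_adj] at huv
  by_cases he : s(u, v) = s(a, b)
  · rcases Sym2.eq_iff.1 he with ⟨rfl, rfl⟩ | ⟨rfl, rfl⟩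
    · exact hab
    · exact hab.symm
  · refine SimpleGraph.Reachable.mono hle (SimpleGraph.Adj.reachable ?_)
    rw [SimpleGraph.fromEdgeSet_adj]
    exact ⟨by rw [Finset.coe_erase]; exact ⟨huv.1, he⟩, huv.2⟩

/-- Swapping `f` for the edge matched to it by `IsSpanningTree.exists_exchange` yields another
spanning tree, so minimality of `M` compares the two costs edge by edge rather than only in total.
-/
theorem IsMinSpanningTree.exists_exchange [Fintype U] [DecidableEq U] {c : Sym2 U → ℝ}
    {M M' : Finset (Sym2 U)} (h : IsMinSpanningTree c M) (h' : IsSpanningTree M') :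
    ∃ σ : M → Sym2 U, Function.Injective σ ∧ ∀ f : M, σ f ∈ M' ∧ c f ≤ c (σ f) := by
  obtain ⟨σ, hσ, hσ'⟩ := h.1.exists_exchange h'
  refine ⟨σ, hσ, fun f => ⟨(hσ' f).1, ?_⟩⟩
  obtain ⟨f, hf⟩ := f
  -- An edge that reconnects the two sides cannot already be present; freshness is needed to split
  -- the sum over the inserted edge.
  by_cases hmem : σ ⟨f, hf⟩ ∈ M.erase f
  · exfalso
    obtain ⟨e, he⟩ : ∃ e, σ ⟨f, hf⟩ = e := ⟨_, rfl⟩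
    rw [he] at hmem
    induction e with | _ x y
    refine (hσ' ⟨f, hf⟩).2 x y he (SimpleGraph.Adj.reachable ?_)
    rw [SimpleGraph.fromEdgeSet_adj]
    refine ⟨hmem, fun hxy => ?_⟩
    exact h.1.1 _ (Finset.mem_of_mem_erase hmem) (by simpa using hxy)
  have hd : ¬ (σ ⟨f, hf⟩).IsDiag := h'.1 _ (hσ' ⟨f, hf⟩).1
  have hcard := h.1.card_add_one
  have htree : IsSpanningTree (insert (σ ⟨f, hf⟩) (M.erase f)) := by
    refine isSpanningTree_of_card ?_ ?_ ?_
    · intro e he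
      rcases Finset.mem_insert.1 he with rfl | he
      · exact hd
      · exact h.1.1 _ (Finset.mem_of_mem_erase he)
    · obtain ⟨e, he⟩ : ∃ e, σ ⟨f, hf⟩ = e := ⟨_, rfl⟩
      rw [he] at hd ⊢
      induction e with | _ x y
      exact h.1.connected_insert_erase (fun hxy => hd (by simpa using hxy))
        ((hσ' ⟨f, hf⟩).2 x y he)
    · have := Finset.card_insert_le (σ ⟨f, hf⟩) (M.erase f)
      have h3 := Finset.card_erase_of_mem hf
      have h4 := Finset.card_pos.2 ⟨_, hf⟩
      omega
  have := h.2 _ htree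
  rw [Finset.sum_insert hmem, ← Finset.add_sum_erase _ _ hf] at this
  linarith

/-- A spanning tree in which any two vertices are connected by edges that cost at most as much as
their direct connection is a minimum spanning tree. -/
theorem isMinSpanningTree_of_bottleneck [Fintype U] [DecidableEq U] {c : Sym2 U → ℝ}
    {M : Finset (Sym2 U)} (h : IsSpanningTree M)
    (hb : ∀ x y, x ≠ y →
      (SimpleGraph.fromEdgeSet {e | e ∈ M ∧ c e ≤ c s(x, y)}).Reachable x y) :
    IsMinSpanningTree c M := by
  refine ⟨h, fun M' h' => ?_⟩
  obtain ⟨σ, hσ, hσ'⟩ := h.exists_exchange h'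
  -- If `f` cost more than its partner `s(x, y)`, the cheap connection of `x` and `y` would avoid
  -- `f`, so the partner would not reconnect the two sides.
  have key : ∀ f : M, c f ≤ c (σ f) := by
    rintro ⟨f, hf⟩
    by_contra hlt
    push Not at hlt
    obtain ⟨e, he⟩ : ∃ e, σ ⟨f, hf⟩ = e := ⟨_, rfl⟩
    have h1 := (hσ' ⟨f, hf⟩).1
    rw [he] at h1 hlt
    induction e with | _ x y
    have hxy : x ≠ y := fun hxy => h'.1 _ h1 (by simpa using hxy)
    refine (hσ' ⟨f, hf⟩).2 x y he ((hb x y hxy).mono (SimpleGraph.fromEdgeSet_mono ?_))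
    rintro e ⟨he1, he2⟩
    simp only [Finset.coe_erase, Set.mem_sdiff, Finset.mem_coe, Set.mem_singleton_iff]
    refine ⟨he1, ?_⟩
    rintro rfl
    exact absurd he2 (not_le.2 hlt)
  -- Both trees have the same number of edges, so the injective matching exhausts `M'`.
  have hM' : M' = Finset.univ.map ⟨σ, hσ⟩ := by
    symm
    refine Finset.eq_of_subset_of_card_le ?_ ?_
    · intro e he
      obtain ⟨f, -, rfl⟩ := Finset.mem_map.1 he
      exact (hσ' f).1
    · have h1 := h.card_add_one
      have h2 := h'.card_add_one
      simp
      omega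
  rw [hM', Finset.sum_map, ← Finset.sum_coe_sort M c]
  exact Finset.sum_le_sum fun f _ => key f

end SpanningTree

/-! ### Shortest paths -/

section ShortestPath

variable {V : Type*} {G : SimpleGraph V} {w : Sym2 V → ℝ}

theorem walkWeight_cons {u v t : V} (h : G.Adj u v) (p : G.Walk v t) :
    walkWeight w (.cons h p) = w s(u, v) + walkWeight w p := by
  simp [walkWeight]

theorem walkWeight_append {u v t : V} (p : G.Walk u v) (q : G.Walk v t) :
    walkWeight w (p.append q) = walkWeight w p + walkWeight w q := by
  simp [walkWeight, SimpleGraph.Walk.edges_append]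

theorem walkWeight_reverse {u v : V} (p : G.Walk u v) :
    walkWeight w p.reverse = walkWeight w p := by
  simp [walkWeight, List.sum_reverse]

theorem walkWeight_nonneg (hw : ∀ e ∈ G.edgeSet, 0 ≤ w e) {s t : V} (p : G.Walk s t) :
    0 ≤ walkWeight w p := by
  refine List.sum_nonneg fun x hx => ?_
  obtain ⟨e, he, rfl⟩ := List.mem_map.1 hx
  exact hw e (p.edges_subset_edgeSet he)

theorem IsPath.walkWeight_eq [DecidableEq V] {s t : V} {p : G.Walk s t} (hp : p.IsPath) :
    walkWeight w p = totalWeight w p.edges.toFinset := by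
  rw [walkWeight, totalWeight, List.sum_toFinset _ hp.isTrail.edges_nodup]

/-- A walk pays for repeated edges again, and with nonnegative weights this never helps. Removing
detours is handled through edge sets for the same reason. -/
theorem totalWeight_edges_le [DecidableEq V] (hw : ∀ e ∈ G.edgeSet, 0 ≤ w e) {s t : V}
    (p : G.Walk s t) : totalWeight w p.edges.toFinset ≤ walkWeight w p := by
  induction p with
  | nil => simp [walkWeight, totalWeight]
  | @cons u v _ h p ih =>
    rw [walkWeight_cons, SimpleGraph.Walk.edges_cons, List.toFinset_cons]
    have h0 := hw s(u, v) h
    by_cases hmem : s(u, v) ∈ p.edges.toFinset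
    · rw [Finset.insert_eq_of_mem hmem]; linarith
    · rw [totalWeight, Finset.sum_insert hmem]
      exact add_le_add_right ih _

theorem totalWeight_mono (hw : ∀ e ∈ G.edgeSet, 0 ≤ w e) {X Y : Finset (Sym2 V)} (h : X ⊆ Y)
    (hY : (Y : Set (Sym2 V)) ⊆ G.edgeSet) : totalWeight w X ≤ totalWeight w Y :=
  Finset.sum_le_sum_of_subset_of_nonneg h fun e he _ => hw e (hY he)

theorem walkWeight_bypass_le [DecidableEq V] (hw : ∀ e ∈ G.edgeSet, 0 ≤ w e) {s t : V}
    (p : G.Walk s t) : walkWeight w p.bypass ≤ walkWeight w p := by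
  rw [IsPath.walkWeight_eq p.bypass_isPath]
  refine le_trans (totalWeight_mono hw ?_ ?_) (totalWeight_edges_le hw p)
  · intro e he
    rw [List.mem_toFinset] at he ⊢
    exact p.edges_bypass_subset_edges he
  · intro e he
    exact p.edges_subset_edgeSet (List.mem_toFinset.1 he)

theorem bddBelow_walkWeight (hw : ∀ e ∈ G.edgeSet, 0 ≤ w e) (s t : V) :
    BddBelow (Set.range fun p : G.Path s t => walkWeight w (p : G.Walk s t)) :=
  ⟨0, by rintro _ ⟨p, rfl⟩; exact walkWeight_nonneg hw _⟩

/-- `pathDist` is an infimum over paths only; nonnegative weights bound it below and let every walk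
be shortened to a path. -/
theorem pathDist_le_walkWeight (hw : ∀ e ∈ G.edgeSet, 0 ≤ w e) {s t : V} (p : G.Walk s t) :
    pathDist G w s t ≤ walkWeight w p := by
  classical
  exact (ciInf_le (bddBelow_walkWeight hw s t) ⟨p.bypass, p.bypass_isPath⟩).trans
    (walkWeight_bypass_le hw p)

theorem IsCheapestPath.walkWeight_eq (hw : ∀ e ∈ G.edgeSet, 0 ≤ w e) {s t : V} {p : G.Walk s t}
    (h : IsCheapestPath w p) : walkWeight w p = pathDist G w s t := by
  have : Nonempty (G.Path s t) := ⟨⟨p, h.1⟩⟩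
  exact le_antisymm (le_ciInf fun q => h.2 q q.2) (pathDist_le_walkWeight hw p)

theorem pathDist_nonneg (hw : ∀ e ∈ G.edgeSet, 0 ≤ w e) (s t : V) : 0 ≤ pathDist G w s t :=
  Real.iInf_nonneg fun _ => walkWeight_nonneg hw _

theorem exists_walkWeight_eq_pathDist [Finite V] {s t : V} (h : G.Reachable s t) :
    ∃ p : G.Walk s t, p.IsPath ∧ walkWeight w p = pathDist G w s t := by
  classical
  have := Fintype.ofFinite V
  obtain ⟨p, hp⟩ := h.exists_isPath
  have : Nonempty (G.Path s t) := ⟨⟨p, hp⟩⟩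
  have : DecidableRel G.Adj := Classical.decRel _
  obtain ⟨q, hq⟩ := exists_eq_ciInf_of_finite
    (f := fun p : G.Path s t => walkWeight w (p : G.Walk s t))
  exact ⟨q, q.2, hq⟩

theorem pathDist_le_of_le [Finite V] {w' : Sym2 V → ℝ} (hw : ∀ e ∈ G.edgeSet, 0 ≤ w e)
    (hww' : ∀ e ∈ G.edgeSet, w e ≤ w' e) {s t : V} (h : G.Reachable s t) :
    pathDist G w s t ≤ pathDist G w' s t := by
  obtain ⟨p, -, hp'⟩ := exists_walkWeight_eq_pathDist (w := w') h
  rw [← hp']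
  refine (pathDist_le_walkWeight hw p).trans (List.sum_le_sum fun e he => ?_)
  exact hww' e (p.edges_subset_edgeSet he)

theorem pathDist_le_add [Finite V] (hw : ∀ e ∈ G.edgeSet, 0 ≤ w e) {s u v : V}
    (h : G.Reachable s u) (huv : G.Adj u v) :
    pathDist G w s v ≤ pathDist G w s u + w s(u, v) := by
  obtain ⟨p, -, hp'⟩ := exists_walkWeight_eq_pathDist (w := w) h
  rw [← hp']
  refine (pathDist_le_walkWeight hw (p.append (.cons huv .nil))).trans_eq ?_
  rw [walkWeight_append, walkWeight_cons]
  simp [walkWeight]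

theorem pathDist_self (hw : ∀ e ∈ G.edgeSet, 0 ≤ w e) (s : V) : pathDist G w s s = 0 :=
  le_antisymm (pathDist_le_walkWeight hw (.nil : G.Walk s s)) (pathDist_nonneg hw s s)

end ShortestPath

/-! ### The metric closure of the terminals -/

section Closure

variable {V : Type*} {I : Instance V} {w : Sym2 V → ℝ}

theorem Instance.closureCost_mk (w : Sym2 V → ℝ) (s t : I.terminals) :
    I.closureCost w s(s, t) = pathDist I.graph w s t := rfl

theorem Instance.closureCost_nonneg (hw : ∀ e ∈ I.graph.edgeSet, 0 ≤ w e)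
    (e : Sym2 I.terminals) : 0 ≤ I.closureCost w e := by
  induction e with | _ s t
  exact pathDist_nonneg hw _ _

theorem Instance.reachable (s t : I.terminals) : I.graph.Reachable (s : V) t :=
  I.terminals_reachable s s.2 t t.2

/-- A closed walk that visits everything that is connected to its base by the edges in `X`, and
that costs at most twice as much as `X`. -/
theorem exists_tour {G : SimpleGraph V} (hw : ∀ e ∈ G.edgeSet, 0 ≤ w e) {X : Finset (Sym2 V)}
    (hX : (X : Set (Sym2 V)) ⊆ G.edgeSet) (a : V) :
    ∃ p : G.Walk a a, walkWeight w p ≤ 2 * totalWeight w X ∧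
      ∀ v, (SimpleGraph.fromEdgeSet (X : Set (Sym2 V))).Reachable a v → v ∈ p.support := by
  classical
  -- Induction on the number of edges of `X` not yet in `Y`, the set of edges already paid for. A
  -- new edge at the tour is added as a detour there and back, which costs twice its weight.
  suffices H : ∀ (k : ℕ) (Y : Finset (Sym2 V)), Y ⊆ X → (X \ Y).card = k →
      (∃ p : G.Walk a a, walkWeight w p ≤ 2 * totalWeight w Y ∧
        ∀ x y, s(x, y) ∈ Y → x ∈ p.support) →
      ∃ p : G.Walk a a, walkWeight w p ≤ 2 * totalWeight w X ∧
        ∀ v, (SimpleGraph.fromEdgeSet (X : Set (Sym2 V))).Reachable a v → v ∈ p.support from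
    H _ ∅ (by simp) rfl ⟨.nil, by simp [walkWeight, totalWeight], by simp⟩
  intro k
  induction k with
  | zero =>
    rintro Y hYX hk ⟨p, hp, hp'⟩
    obtain rfl : Y = X := hYX.antisymm (Finset.sdiff_eq_empty_iff_subset.1 (Finset.card_eq_zero.1 hk))
    refine ⟨p, hp, fun v ⟨q⟩ => ?_⟩
    by_contra hv
    obtain ⟨d, -, hd1, hd2⟩ := q.exists_boundary_dart {x | x ∈ p.support} p.start_mem_support hv
    have := ((SimpleGraph.fromEdgeSet_adj _).1 d.adj).1
    rw [Sym2.eq_swap] at this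
    exact hd2 (hp' _ _ this)
  | succ k ih =>
    rintro Y hYX hk ⟨p, hp, hp'⟩
    by_cases hex : ∃ x y, s(x, y) ∈ X \ Y ∧ x ∈ p.support
    · obtain ⟨x, y, hxy, hx⟩ := hex
      obtain ⟨hxyX, hxyY⟩ := Finset.mem_sdiff.1 hxy
      have hadj : G.Adj x y := hX hxyX
      refine ih (insert s(x, y) Y) (Finset.insert_subset hxyX hYX) ?_ ⟨(p.takeUntil x hx).append
        (.cons hadj (.cons hadj.symm (p.dropUntil x hx))), ?_, ?_⟩
      · rw [Finset.sdiff_insert, Finset.card_erase_of_mem hxy, hk]; rfl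
      · have h1 : walkWeight w p =
            walkWeight w (p.takeUntil x hx) + walkWeight w (p.dropUntil x hx) := by
          rw [← walkWeight_append, p.take_spec]
        rw [walkWeight_append, walkWeight_cons, walkWeight_cons, totalWeight,
          Finset.sum_insert hxyY, Sym2.eq_swap (a := y)]
        rw [totalWeight] at hp
        linarith
      · have hsub : ∀ z ∈ p.support, z ∈ ((p.takeUntil x hx).append
            (.cons hadj (.cons hadj.symm (p.dropUntil x hx)))).support := by
          intro z hz
          rw [← p.take_spec hx, SimpleGraph.Walk.mem_support_append_iff] at hz
          simp only [SimpleGraph.Walk.mem_support_append_iff, SimpleGraph.Walk.support_cons,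
            List.mem_cons]
          tauto
        intro a b hab
        rcases Finset.mem_insert.1 hab with hab | hab
        · rcases Sym2.eq_iff.1 hab with ⟨rfl, rfl⟩ | ⟨rfl, rfl⟩
          · exact hsub _ hx
          · simp
        · exact hsub _ (hp' a b hab)
    -- No remaining edge of `X` touches the tour, so the tour already covers the whole component of
    -- `a`.
    · push Not at hex
      refine ⟨p, hp.trans ?_, fun v ⟨q⟩ => ?_⟩
      · have := totalWeight_mono hw hYX hX
        linarith
      · by_contra hv
        obtain ⟨d, -, hd1, hd2⟩ := q.exists_boundary_dart {x | x ∈ p.support}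
          p.start_mem_support hv
        have hd := ((SimpleGraph.fromEdgeSet_adj _).1 d.adj).1
        by_cases hY : s(d.fst, d.snd) ∈ Y
        · rw [Sym2.eq_swap] at hY
          exact hd2 (hp' _ _ hY)
        · exact hex d.fst d.snd (Finset.mem_sdiff.2 ⟨hd, hY⟩) hd1

/-- Short-cutting a walk to the terminals on it. -/
theorem exists_connections_of_walk [Finite V] (hw : ∀ e ∈ I.graph.edgeSet, 0 ≤ w e) {v b : V}
    (p : I.graph.Walk v b) (l : I.terminals) (hl : I.graph.Reachable (l : V) v) :
    ∃ M : Finset (Sym2 I.terminals),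
      ∑ e ∈ M, I.closureCost w e ≤ pathDist I.graph w l v + walkWeight w p ∧
      ∀ t : I.terminals, (t : V) ∈ p.support →
        (SimpleGraph.fromEdgeSet (M : Set (Sym2 I.terminals))).Reachable l t := by
  classical
  have hadj : ∀ (M : Finset (Sym2 I.terminals)) (x y : I.terminals), s(x, y) ∈ M →
      (SimpleGraph.fromEdgeSet (M : Set (Sym2 I.terminals))).Reachable x y := by
    intro M x y h
    by_cases hxy : x = y
    · rw [hxy]
    · exact SimpleGraph.Adj.reachable ((SimpleGraph.fromEdgeSet_adj _).2 ⟨h, hxy⟩)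
  -- `l` is the last terminal met. The distance from `l` to the current vertex is the debt: an edge
  -- increases it by at most its weight, and at a terminal it is settled by one connection and
  -- starts again from zero.
  induction p generalizing l with
  | @nil u =>
    by_cases hv : u ∈ I.terminals
    · refine ⟨{s(l, ⟨u, hv⟩)}, ?_, fun t ht => hadj _ _ _ ?_⟩
      · simp [walkWeight, Instance.closureCost_mk]
      · obtain rfl : t = ⟨u, hv⟩ := Subtype.ext (by simpa using ht)
        simp
    · refine ⟨∅, ?_, fun t ht => ?_⟩
      · simp [walkWeight, pathDist_nonneg hw]
      · exact absurd t.2 ((by simpa using ht : (t : V) = u) ▸ hv)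
  | @cons u v b h p ih =>
    rw [walkWeight_cons]
    by_cases hv : u ∈ I.terminals
    · obtain ⟨M, hM, hM'⟩ := ih ⟨u, hv⟩ h.reachable
      have hle : SimpleGraph.fromEdgeSet (M : Set (Sym2 I.terminals)) ≤
          SimpleGraph.fromEdgeSet
            ((insert s(l, ⟨u, hv⟩) M : Finset _) : Set (Sym2 I.terminals)) :=
        SimpleGraph.fromEdgeSet_mono (by simp)
      have hlu := hadj (insert s(l, ⟨u, hv⟩) M) l ⟨u, hv⟩ (by simp)
      refine ⟨insert s(l, ⟨u, hv⟩) M, ?_, fun t ht => ?_⟩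
      · have h1 := pathDist_le_walkWeight (w := w) hw (.cons h .nil : I.graph.Walk u v)
        rw [walkWeight_cons] at h1
        have h2 : ∑ e ∈ insert s(l, (⟨u, hv⟩ : I.terminals)) M, I.closureCost w e ≤
            I.closureCost w s(l, ⟨u, hv⟩) + ∑ e ∈ M, I.closureCost w e := by
          by_cases hmem : s(l, (⟨u, hv⟩ : I.terminals)) ∈ M
          · rw [Finset.insert_eq_of_mem hmem]
            linarith [I.closureCost_nonneg hw s(l, (⟨u, hv⟩ : I.terminals))]
          · rw [Finset.sum_insert hmem]
        rw [Instance.closureCost_mk] at h2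
        simp only [walkWeight, SimpleGraph.Walk.edges_nil, List.map_nil, List.sum_nil] at h1 hM ⊢
        linarith
      · rw [SimpleGraph.Walk.support_cons, List.mem_cons] at ht
        rcases ht with ht | ht
        · obtain rfl : t = ⟨u, hv⟩ := Subtype.ext ht
          exact hlu
        · exact hlu.trans ((hM' t ht).mono hle)
    · obtain ⟨M, hM, hM'⟩ := ih l (hl.trans h.reachable)
      refine ⟨M, ?_, fun t ht => ?_⟩
      · have := pathDist_le_add hw hl h
        linarith
      · rw [SimpleGraph.Walk.support_cons, List.mem_cons] at ht
        rcases ht with ht | ht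
        · exact absurd t.2 (ht ▸ hv)
        · exact hM' t ht

/-- This is the double-tree argument: the tour that uses every edge of `X` at most twice visits all
terminals, and short-cutting it connects them in the closure without extra cost. -/
theorem exists_spanningTree_le_two_mul [Finite V] (hw : ∀ e ∈ I.graph.edgeSet, 0 ≤ w e)
    {X : Finset (Sym2 V)} (hX : I.IsSteinerTree X) :
    ∃ M : Finset (Sym2 I.terminals), IsSpanningTree M ∧
      ∑ e ∈ M, I.closureCost w e ≤ 2 * totalWeight w X := by
  obtain ⟨a, ha⟩ := I.terminals_nonempty
  obtain ⟨p, hp, hp'⟩ := exists_tour hw hX.1 a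
  obtain ⟨M, hM, hM'⟩ := exists_connections_of_walk hw p ⟨a, ha⟩ .rfl
  have hconn : (SimpleGraph.fromEdgeSet (M : Set (Sym2 I.terminals))).Connected := by
    have hr : ∀ t, (SimpleGraph.fromEdgeSet (M : Set (Sym2 I.terminals))).Reachable ⟨a, ha⟩ t :=
      fun t => hM' t (hp' t (hX.2 a ha t t.2))
    exact { preconnected := fun x y => (hr x).symm.trans (hr y), nonempty := ⟨⟨a, ha⟩⟩ }
  obtain ⟨M', hM'M, hT⟩ := exists_spanningTree_subset hconn
  refine ⟨M', hT, ?_⟩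
  have h1 := Finset.sum_le_sum_of_subset_of_nonneg hM'M
    fun e _ _ => I.closureCost_nonneg hw e
  rw [pathDist_self hw] at hM
  linarith

theorem IsMinSpanningTree.sum_le_two_mul [Finite V] (hw : ∀ e ∈ I.graph.edgeSet, 0 ≤ w e)
    {M : Finset (Sym2 I.terminals)} (hM : IsMinSpanningTree (I.closureCost w) M)
    {X : Finset (Sym2 V)} (hX : I.IsSteinerTree X) :
    ∑ e ∈ M, I.closureCost w e ≤ 2 * totalWeight w X := by
  obtain ⟨M', hT, hM'⟩ := exists_spanningTree_le_two_mul hw hX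
  exact (hM.2 M' hT).trans hM'

end Closure

/-! ### The quality of the refined Steiner algorithm -/

section Quality

variable {V : Type*} [DecidableEq V] {I : Instance V} {α : ℝ} {X X' : Finset (Sym2 V)}

theorem Instance.scaledWeight_nonneg (I : Instance V) (hα : 1 ≤ α) :
    ∀ e ∈ I.graph.edgeSet, 0 ≤ I.scaledWeight α e := by
  intro e he
  have := I.weight_nonneg e he
  unfold scaledWeight
  split_ifs <;> positivity

theorem Instance.scaledWeight_le (I : Instance V) (hα : 1 ≤ α) :
    ∀ e ∈ I.graph.edgeSet, I.scaledWeight α e ≤ I.weight e := by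
  intro e he
  unfold scaledWeight
  split_ifs
  · exact div_le_self (I.weight_nonneg e he) hα
  · exact le_rfl

theorem Instance.totalWeight_scaledWeight (I : Instance V) (α : ℝ) (X : Finset (Sym2 V)) :
    totalWeight (I.scaledWeight α) X =
      totalWeight I.weight (X \ I.pred) + totalWeight I.weight (X ∩ I.pred) / α := by
  unfold totalWeight
  rw [← Finset.sum_inter_add_sum_sdiff X I.pred, add_comm, Finset.sum_div]
  congr 1
  · refine Finset.sum_congr rfl fun e he => ?_
    rw [scaledWeight, if_neg (Finset.mem_sdiff.1 he).2]
  · refine Finset.sum_congr rfl fun e he => ?_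
    rw [scaledWeight, if_pos (Finset.mem_inter.1 he).2]

/-- What the analysis uses of the output of the refined Steiner algorithm. -/
theorem Instance.IsRefinedOutput.exists_paths (hα : 1 ≤ α) (h : I.IsRefinedOutput α X) :
    ∃ M : Finset (Sym2 I.terminals), IsMinSpanningTree (I.closureCost (I.scaledWeight α)) M ∧
      ∃ p : Sym2 I.terminals → Finset (Sym2 V), X = M.biUnion p ∧ ∀ e ∈ M,
        (p e : Set (Sym2 V)) ⊆ I.graph.edgeSet ∧
        totalWeight (I.scaledWeight α) (p e) = I.closureCost (I.scaledWeight α) e ∧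
        ∃ s t : I.terminals, e = s(s, t) ∧
          (SimpleGraph.fromEdgeSet (p e : Set (Sym2 V))).Reachable (s : V) t := by
  obtain ⟨M, hM, p, hp, hX⟩ := h
  refine ⟨M, hM, p, hX, fun e he => ?_⟩
  obtain ⟨s, t, q, hst, hq, hpe⟩ := hp e he
  refine ⟨?_, ?_, s, t, hst, ?_⟩
  · intro e' he'
    rw [hpe] at he'
    exact q.edges_subset_edgeSet (List.mem_toFinset.1 he')
  · rw [hpe, ← IsPath.walkWeight_eq hq.1, hst, closureCost_mk,
      hq.walkWeight_eq (I.scaledWeight_nonneg hα)]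
  · refine ⟨q.transfer _ fun e' he' => ?_⟩
    rw [SimpleGraph.edgeSet_fromEdgeSet, hpe]
    exact ⟨by simpa using he', I.graph.not_isDiag_of_mem_edgeSet (q.edges_subset_edgeSet he')⟩

theorem Instance.IsRefinedOutput.isSteinerTree (hα : 1 ≤ α) (h : I.IsRefinedOutput α X) :
    I.IsSteinerTree X := by
  obtain ⟨M, hM, p, rfl, hp⟩ := h.exists_paths hα
  constructor
  · intro e he
    rw [Finset.mem_coe, Finset.mem_biUnion] at he
    obtain ⟨f, hf, he⟩ := he
    exact (hp f hf).1 he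
  · intro s hs t ht
    obtain ⟨q⟩ := hM.1.2.connected.preconnected ⟨s, hs⟩ ⟨t, ht⟩
    suffices H : ∀ (a b : I.terminals)
        (_ : (SimpleGraph.fromEdgeSet (M : Set (Sym2 I.terminals))).Walk a b),
        (SimpleGraph.fromEdgeSet ((M.biUnion p : Finset _) : Set (Sym2 V))).Reachable (a : V) b from
      H _ _ q
    intro a b q
    induction q with
    | nil => rfl
    | @cons a b _ hab _ ih =>
      refine SimpleGraph.Reachable.trans ?_ ih
      have hf := ((SimpleGraph.fromEdgeSet_adj _).1 hab).1
      have hle : SimpleGraph.fromEdgeSet (p s(a, b) : Set (Sym2 V)) ≤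
          SimpleGraph.fromEdgeSet ((M.biUnion p : Finset _) : Set (Sym2 V)) :=
        SimpleGraph.fromEdgeSet_mono (Finset.coe_subset.2 (Finset.subset_biUnion_of_mem p hf))
      obtain ⟨-, -, a', b', hab', hr⟩ := hp _ hf
      rcases Sym2.eq_iff.1 hab' with ⟨rfl, rfl⟩ | ⟨rfl, rfl⟩
      · exact hr.mono hle
      · exact hr.symm.mono hle

theorem totalWeight_biUnion_le {ι : Type*} {G : SimpleGraph V} {w : Sym2 V → ℝ}
    (hw : ∀ e ∈ G.edgeSet, 0 ≤ w e) (M : Finset ι) (p : ι → Finset (Sym2 V))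
    (hp : ∀ i ∈ M, (p i : Set (Sym2 V)) ⊆ G.edgeSet) :
    totalWeight w (M.biUnion p) ≤ ∑ i ∈ M, totalWeight w (p i) := by
  classical
  induction M using Finset.induction_on with
  | empty => simp [totalWeight]
  | insert i M hi ih =>
    rw [Finset.biUnion_insert, Finset.sum_insert hi]
    have h1 := ih fun j hj => hp j (Finset.mem_insert_of_mem hj)
    have h2 : totalWeight w (p i ∪ M.biUnion p) + totalWeight w (p i ∩ M.biUnion p) =
        totalWeight w (p i) + totalWeight w (M.biUnion p) := Finset.sum_union_inter
    have h3 : 0 ≤ totalWeight w (p i ∩ M.biUnion p) := Finset.sum_nonneg fun e he =>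
      hw e (hp i (Finset.mem_insert_self _ _) (Finset.mem_inter.1 he).1)
    linarith

/-- No set of at most as many edges has a higher total cost than a set of top edges. -/
theorem IsTopEdges.sum_le {U : Type*} {c : Sym2 U → ℝ} (hc : ∀ e, 0 ≤ c e)
    {M S A : Finset (Sym2 U)} {k : ℕ} (hS : IsTopEdges c M k S) (hA : A ⊆ M) (hAk : A.card ≤ k) :
    ∑ e ∈ A, c e ≤ ∑ e ∈ S, c e := by
  classical
  obtain ⟨-, hcard, htop⟩ := hS
  have hAS : (A \ S).card ≤ (S \ A).card := by
    have h1 := Finset.card_sdiff_add_card_inter A S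
    have h2 := Finset.card_sdiff_add_card_inter S A
    rw [Finset.inter_comm] at h2
    omega
  rw [← Finset.sum_inter_add_sum_sdiff A S, ← Finset.sum_inter_add_sum_sdiff S A,
    Finset.inter_comm]
  refine add_le_add_right ?_ _
  -- The largest cost in `A \ S` separates the two sets: every edge of `S \ A` costs at least that
  -- much, and there are at least as many of them.
  rcases (A \ S).eq_empty_or_nonempty with h0 | h0
  · rw [h0, Finset.sum_empty]
    exact Finset.sum_nonneg fun e _ => hc e
  · obtain ⟨x, hx, hmax⟩ := (A \ S).exists_max_image c h0
    calc ∑ e ∈ A \ S, c e ≤ (A \ S).card • c x := Finset.sum_le_card_nsmul _ _ _ hmax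
      _ ≤ (S \ A).card • c x := nsmul_le_nsmul_left (hc x) hAS
      _ ≤ ∑ e ∈ S \ A, c e := Finset.card_nsmul_le_sum _ _ _ fun e he =>
        htop e (Finset.mem_sdiff.1 he).1 x (hA (Finset.mem_sdiff.1 hx).1) (Finset.mem_sdiff.1 hx).2

/-- The cost of the wrongly predicted edges in the output is bounded by the top edges of the
metric closure. -/
theorem scaledWeight_wrong_le [Finite V] (hα : 1 ≤ α) (X' : Finset (Sym2 V))
    {Mα M S : Finset (Sym2 I.terminals)}
    (hMα : IsMinSpanningTree (I.closureCost (I.scaledWeight α)) Mα)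
    {p : Sym2 I.terminals → Finset (Sym2 V)}
    (hp : ∀ e ∈ Mα, (p e : Set (Sym2 V)) ⊆ I.graph.edgeSet ∧
        totalWeight (I.scaledWeight α) (p e) = I.closureCost (I.scaledWeight α) e)
    (hM : IsSpanningTree M)
    (hS : IsTopEdges (I.closureCost I.weight) M
      (min (I.terminals.card - 1) (I.pred \ X').card) S) :
    totalWeight (I.scaledWeight α) (Mα.biUnion p ∩ (I.pred \ X')) ≤
      ∑ e ∈ S, I.closureCost I.weight e := by
  obtain ⟨σ, hσ, hσ'⟩ := hMα.exists_exchange hM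
  have hwα := I.scaledWeight_nonneg hα
  -- Each edge of the output is charged to one tree edge whose path contains it; the value for other
  -- edges is irrelevant.
  have hex : ∀ e : Sym2 V, ∃ f : Sym2 I.terminals, e ∈ Mα.biUnion p → f ∈ Mα ∧ e ∈ p f := by
    intro e
    by_cases he : e ∈ Mα.biUnion p
    · obtain ⟨f, hf⟩ := Finset.mem_biUnion.1 he
      exact ⟨f, fun _ => hf⟩
    · obtain ⟨a, ha⟩ := I.terminals_nonempty
      exact ⟨s(⟨a, ha⟩, ⟨a, ha⟩), fun h => absurd h he⟩
  choose φ hφ using hex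
  set W := Mα.biUnion p ∩ (I.pred \ X') with hW
  -- The tree edges that are charged for some wrong edge. There is at most one per wrong edge, and
  -- at most k - 1 because `Mα` has no more edges.
  let F : Finset Mα := Finset.univ.filter fun f => (f : Sym2 I.terminals) ∈ W.image φ
  have hF1 : F.card ≤ (I.pred \ X').card := by
    calc F.card = (F.map (Function.Embedding.subtype _)).card := (Finset.card_map _).symm
      _ ≤ (W.image φ).card := by
        refine Finset.card_le_card fun f hf => ?_
        obtain ⟨a, ha, rfl⟩ := Finset.mem_map.1 hf
        exact (Finset.mem_filter.1 ha).2
      _ ≤ W.card := Finset.card_image_le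
      _ ≤ _ := Finset.card_le_card Finset.inter_subset_right
  have hF2 : F.card ≤ I.terminals.card - 1 := by
    have h1 := hMα.1.card_add_one
    have h2 : F.card ≤ Fintype.card Mα := Finset.card_le_univ F
    rw [Fintype.card_coe] at h1 h2
    omega
  calc totalWeight (I.scaledWeight α) W
      ≤ totalWeight (I.scaledWeight α) (F.biUnion fun f => p f) := by
        refine totalWeight_mono hwα (fun e he => ?_) (fun e he => ?_)
        · have h1 := hφ e (Finset.mem_inter.1 he).1
          exact Finset.mem_biUnion.2 ⟨⟨φ e, h1.1⟩, Finset.mem_filter.2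
            ⟨Finset.mem_univ _, Finset.mem_image_of_mem φ he⟩, h1.2⟩
        · obtain ⟨f, -, he⟩ := Finset.mem_biUnion.1 he
          exact (hp f f.2).1 he
    _ ≤ ∑ f ∈ F, totalWeight (I.scaledWeight α) (p f) :=
        totalWeight_biUnion_le hwα F (fun f => p f) fun f _ => (hp f f.2).1
    _ = ∑ f ∈ F, I.closureCost (I.scaledWeight α) f :=
        Finset.sum_congr rfl fun f _ => (hp f f.2).2
    -- Minimality holds for scaled costs, so the exchange compares scaled costs; afterwards scaling
    -- only decreases distances.
    _ ≤ ∑ f ∈ F, I.closureCost I.weight (σ f) := by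
        refine Finset.sum_le_sum fun f _ => (hσ' f).2.trans ?_
        generalize σ f = e
        induction e with | _ s t
        exact pathDist_le_of_le hwα (I.scaledWeight_le hα) (I.reachable s t)
    _ = ∑ e ∈ F.map ⟨σ, hσ⟩, I.closureCost I.weight e := by rw [Finset.sum_map]; rfl
    _ ≤ ∑ e ∈ S, I.closureCost I.weight e := by
        refine hS.sum_le (I.closureCost_nonneg I.weight_nonneg) (fun e he => ?_) ?_
        · obtain ⟨f, -, rfl⟩ := Finset.mem_map.1 he
          exact (hσ' f).1
        · rw [Finset.card_map]
          exact le_min hF2 hF1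

/-- The scaled weight misses exactly (1 - 1/α) w(X ∩ pred). Doubling bounds the scaled weight by 2
w_α(X'), correct predictions are charged to X', and wrong ones to η⁺ or to `S`. -/
theorem Instance.IsRefinedOutput.totalWeight_le [Finite V] (hα : 1 ≤ α)
    (h : I.IsRefinedOutput α X) (hX' : I.IsSteinerTree X') {M S : Finset (Sym2 I.terminals)}
    (hM : IsSpanningTree M)
    (hS : IsTopEdges (I.closureCost I.weight) M
      (min (I.terminals.card - 1) (I.pred \ X').card) S) :
    totalWeight I.weight X ≤ I.refinedBound X' S α := by
  obtain ⟨Mα, hMα, p, hX, hp⟩ := h.exists_paths hα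
  have hα0 : 0 < α := by linarith
  have hw := I.weight_nonneg
  have hwα := I.scaledWeight_nonneg hα
  have hpred : ∀ {Y : Finset (Sym2 V)}, Y ⊆ I.pred → (Y : Set (Sym2 V)) ⊆ I.graph.edgeSet :=
    fun h => (Finset.coe_subset.2 h).trans I.pred_subset
  have hsplit : ∀ A B : Finset (Sym2 V), totalWeight I.weight A =
      totalWeight I.weight (A ∩ B) + totalWeight I.weight (A \ B) := fun A B =>
    (Finset.sum_inter_add_sum_sdiff A B _).symm
  have hwrong := scaledWeight_wrong_le (X' := X') hα hMα (fun e he => ⟨(hp e he).1, (hp e he).2.1⟩)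
    hM hS
  rw [← hX] at hwrong
  have hcost : totalWeight (I.scaledWeight α) X ≤ 2 * totalWeight (I.scaledWeight α) X' := by
    refine le_trans ?_ (hMα.sum_le_two_mul hwα hX')
    rw [hX]
    refine (totalWeight_biUnion_le hwα Mα p fun e he => (hp e he).1).trans_eq ?_
    exact Finset.sum_congr rfl fun e he => (hp e he).2.1
  rw [I.totalWeight_scaledWeight, I.totalWeight_scaledWeight] at hcost
  rw [I.totalWeight_scaledWeight] at hwrong
  have hempty : (X ∩ (I.pred \ X')) \ I.pred = ∅ := by
    ext e; simp only [Finset.mem_sdiff, Finset.mem_inter, Finset.notMem_empty]; tauto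
  have hinter : X ∩ (I.pred \ X') ∩ I.pred = X ∩ (I.pred \ X') := by
    ext e; simp only [Finset.mem_sdiff, Finset.mem_inter]; tauto
  rw [hempty, hinter] at hwrong
  have hXX := hsplit X I.pred
  have hX'X' := hsplit X' I.pred
  have hcorrect : totalWeight I.weight (X ∩ I.pred) ≤
      totalWeight I.weight (X' ∩ I.pred) + totalWeight I.weight (X ∩ (I.pred \ X')) := by
    rw [hsplit (X ∩ I.pred) X']
    refine add_le_add (totalWeight_mono hw ?_ (hpred Finset.inter_subset_right)) (le_of_eq ?_)
    · intro e; simp only [Finset.mem_inter]; tauto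
    · congr 1; ext e; simp only [Finset.mem_inter, Finset.mem_sdiff]; tauto
  have heta : totalWeight I.weight (X ∩ (I.pred \ X')) ≤ totalWeight I.weight (I.pred \ X') :=
    totalWeight_mono hw Finset.inter_subset_right (hpred Finset.sdiff_subset)
  have heta0 : 0 ≤ totalWeight I.weight (X ∩ (I.pred \ X')) := Finset.sum_nonneg fun e he =>
    hw e (hpred Finset.sdiff_subset (Finset.mem_inter.1 he).2)
  unfold refinedBound
  have hi : 0 < 1 / α := by positivity
  have hi1 : 1 / α ≤ 1 := (div_le_one hα0).2 hα
  rw [div_eq_mul_one_div] at hwrong hcost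
  rw [div_eq_mul_one_div (totalWeight I.weight (X' ∩ I.pred))] at hcost
  have hmul : α * (1 / α) = 1 := by field_simp
  generalize 1 / α = i at *
  generalize totalWeight I.weight (X ∩ (I.pred \ X')) = z at *
  -- Here `z` is the weight of the wrong edges of the output, and (1 - 1/α) z = (α - 1) z/α is what
  -- turns the bound on the scaled weight into the second term of the minimum.
  have hz : (1 - i) * z ≤
      min (totalWeight I.weight (I.pred \ X')) ((α - 1) * ∑ e ∈ S, I.closureCost I.weight e) := by
    refine le_min ?_ ?_
    · nlinarith
    · have h0 : totalWeight I.weight ∅ = 0 := Finset.sum_empty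
      rw [h0, zero_add] at hwrong
      have := mul_le_mul_of_nonneg_left hwrong (sub_nonneg.2 hα)
      have h2 : (α - 1) * (z * i) = (1 - i) * z := by linear_combination z * hmul
      linarith
  refine le_trans ?_ (add_le_add_right hz _)
  have h3 := mul_le_mul_of_nonneg_left hcorrect (sub_nonneg.2 hi1)
  rw [hX'X'] 
  nlinarith

/-- With a and b the weights of X' inside and outside the prediction, the bound is a + 2b + a/α plus
a minimum that increases with α. Only a/β can exceed its counterpart at α; it is at most (1 + ε) a/α
in the first case and at most ε a in the second. -/
theorem Instance.refinedBound_le_of_le {β ε : ℝ} (hε : 0 < ε) (hβ : 1 ≤ β) (hβα : β ≤ α)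
    (h : α ≤ (1 + ε) * β ∨ 1 ≤ ε * β) (hX' : (X' : Set (Sym2 V)) ⊆ I.graph.edgeSet)
    (S : Finset (Sym2 I.terminals)) :
    I.refinedBound X' S β ≤ (1 + ε) * I.refinedBound X' S α := by
  have hα0 : 0 < α := by linarith
  have hβ0 : 0 < β := by linarith
  unfold refinedBound
  have hsplit : totalWeight I.weight X' =
      totalWeight I.weight (X' ∩ I.pred) + totalWeight I.weight (X' \ I.pred) :=
    (Finset.sum_inter_add_sum_sdiff X' I.pred _).symm
  have h1 : 0 ≤ totalWeight I.weight (X' ∩ I.pred) := Finset.sum_nonneg fun e he =>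
    I.weight_nonneg e (hX' (Finset.mem_inter.1 he).1)
  have h2 : 0 ≤ totalWeight I.weight (X' \ I.pred) := Finset.sum_nonneg fun e he =>
    I.weight_nonneg e (hX' (Finset.mem_sdiff.1 he).1)
  have h3 : 0 ≤ totalWeight I.weight (I.pred \ X') := Finset.sum_nonneg fun e he =>
    I.weight_nonneg e (I.pred_subset (Finset.mem_sdiff.1 he).1)
  have h4 : 0 ≤ ∑ e ∈ S, I.closureCost I.weight e :=
    Finset.sum_nonneg fun e _ => I.closureCost_nonneg I.weight_nonneg e
  rw [hsplit]
  generalize totalWeight I.weight (X' ∩ I.pred) = a at *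
  generalize totalWeight I.weight (X' \ I.pred) = b at *
  generalize totalWeight I.weight (I.pred \ X') = c at *
  generalize ∑ e ∈ S, I.closureCost I.weight e = s at *
  have hmin : min c ((β - 1) * s) ≤ (1 + ε) * min c ((α - 1) * s) := by
    have h5 : min c ((β - 1) * s) ≤ min c ((α - 1) * s) :=
      min_le_min le_rfl (mul_le_mul_of_nonneg_right (by linarith) h4)
    have h6 : 0 ≤ min c ((α - 1) * s) := le_min h3 (mul_nonneg (by linarith) h4)
    nlinarith
  have hinv : 1 / β ≤ (1 + ε) * (1 / α) ∨ 1 / β ≤ ε := by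
    rcases h with h | h
    · left
      rw [mul_one_div, div_le_div_iff₀ hβ0 hα0]
      linarith
    · right
      rwa [div_le_iff₀ hβ0]
  have hα1 : 0 < 1 / α := by positivity
  have hmain : a + 2 * b + a * (1 / β) ≤ (1 + ε) * (a + 2 * b + a * (1 / α)) := by
    rcases hinv with hinv | hinv
    · have := mul_le_mul_of_nonneg_left hinv h1
      nlinarith [mul_nonneg hε.le h1, mul_nonneg hε.le h2]
    · have := mul_le_mul_of_nonneg_left hinv h1
      nlinarith [mul_nonneg hε.le h2, mul_nonneg h1 hα1.le, mul_nonneg hε.le (mul_nonneg h1 hα1.le)]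
  linarith

theorem one_le_mul_pow_lastIndex {ε : ℝ} (hε : 0 < ε) : 1 ≤ ε * (1 + ε) ^ lastIndex ε := by
  have h1 : Real.logb (1 + ε) ε⁻¹ ≤ lastIndex ε := Nat.le_ceil _
  rw [Real.logb_le_iff_le_rpow (by linarith) (by positivity), Real.rpow_natCast,
    inv_le_iff_one_le_mul₀ hε] at h1
  linarith

/-- An α within the range of the search is rounded down to a power of 1 + ε. For larger α the last
power suffices, since its reciprocal is at most ε. -/
theorem Instance.IsSearchOutput.quality [Finite V] {ε : ℝ} (hε : 0 < ε)
    (h : I.IsSearchOutput ε X) (hX' : I.IsSteinerTree X') {M S : Finset (Sym2 I.terminals)}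
    (hM : IsSpanningTree M)
    (hS : IsTopEdges (I.closureCost I.weight) M
      (min (I.terminals.card - 1) (I.pred \ X').card) S) (hα : 1 ≤ α) :
    totalWeight I.weight X ≤ (1 + ε) * I.refinedBound X' S α := by
  obtain ⟨Y, hY, j, hj, rfl, hmin⟩ := h
  have hpow : ∀ i : ℕ, 1 ≤ (1 + ε) ^ i := fun i => one_le_pow₀ (by linarith)
  obtain ⟨i, hi, hle, hor⟩ : ∃ i ≤ lastIndex ε, (1 + ε) ^ i ≤ α ∧
      (α ≤ (1 + ε) * (1 + ε) ^ i ∨ 1 ≤ ε * (1 + ε) ^ i) := by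
    rcases le_total ((1 + ε) ^ lastIndex ε) α with hlast | hlast
    · exact ⟨_, le_rfl, hlast, Or.inr (one_le_mul_pow_lastIndex hε)⟩
    · rcases hlast.eq_or_lt with heq | hlt
      · exact ⟨_, le_rfl, heq.ge, Or.inr (one_le_mul_pow_lastIndex hε)⟩
      · obtain ⟨i, hi1, hi2⟩ := exists_nat_pow_near hα (by linarith : 1 < 1 + ε)
        refine ⟨i, ?_, hi1, Or.inl ?_⟩
        · exact ((pow_lt_pow_iff_right₀ (by linarith : 1 < 1 + ε)).1 (hi1.trans_lt hlt)).le
        · rw [← pow_succ']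
          exact hi2.le
  calc totalWeight I.weight (Y j) ≤ totalWeight I.weight (Y i) := hmin i hi
    _ ≤ I.refinedBound X' S ((1 + ε) ^ i) := (hY i hi).totalWeight_le (hpow i) hX' hM hS
    _ ≤ _ := refinedBound_le_of_le hε (hpow i) hle hor hX'.1 S

theorem Instance.IsSearchOutput.isSteinerTree {ε : ℝ} (hε : 0 < ε) (h : I.IsSearchOutput ε X) :
    I.IsSteinerTree X := by
  obtain ⟨Y, hY, j, hj, rfl, -⟩ := h
  exact (hY j hj).isSteinerTree (one_le_pow₀ (by linarith))

end Quality

/-! ### Best-first search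

A common form of the algorithms of Dijkstra and Prim: a vertex that is reached through an arc gets
the key `flag * key u + cost`, where `u` is the tail of the arc. -/

/-- A directed graph with numbered arcs, sources, arc costs and the factor `flag`. -/
structure SearchProblem (V : Type*) where
  arcs : ℕ
  tail : ℕ → V
  head : ℕ → V
  source : V → Prop
  flag : ℝ
  cost : ℕ → ℝ

namespace SearchProblem

variable {V : Type*} (D : SearchProblem V)

/-- The key that a vertex gets through an arc. -/
def arcKey (key : V → ℝ) (h : ℕ) : ℝ := D.flag * key (D.tail h) + D.cost h

/-- The vertex `v` has been reached, as a source or through an arc with tail in `L`. -/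
def Reached (key : V → ℝ) (pe : V → ℕ) (L : List V) (v : V) : Prop :=
  (pe v = 0 ∧ D.source v ∧ key v = 0) ∨
    ∃ h < D.arcs, pe v = h + 1 ∧ D.head h = v ∧ D.tail h ∈ L ∧ key v = D.arcKey key h

/-- The vertex `v` may be scanned after the vertices in `L`. -/
structure CanPop (key : V → ℝ) (pe : V → ℕ) (L : List V) (v : V) : Prop where
  notMem : v ∉ L
  reached : D.Reached key pe L v
  le_arc : ∀ h < D.arcs, D.tail h ∈ L → D.head h ∉ L → key v ≤ D.arcKey key h
  le_source : ∀ y, D.source y → y ∉ L → key v ≤ 0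
  -- A source enters the queue with key 0 and keys are only replaced by strictly smaller ones. With
  -- nonnegative keys this therefore forces sources to remain roots (`Trace.pe_source`).
  source_neg : D.source v → pe v ≠ 0 → key v < 0

/-- The vertices in `L`, latest first, have been scanned in the order of best-first search. -/
def Trace (key : V → ℝ) (pe : V → ℕ) : List V → Prop
  | [] => True
  | v :: L => D.CanPop key pe L v ∧ Trace key pe L

/-- The search has scanned everything that can be reached. -/
structure Closed (L : List V) : Prop where
  arc : ∀ h < D.arcs, D.tail h ∈ L → D.head h ∈ L
  source : ∀ y, D.source y → y ∈ L

/-- The invariant of the search: `L` has been scanned, `Q` is the queue, and the arcs in `pending`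
with tail in `L` are still to be relaxed. -/
structure Invariant (key : V → ℝ) (pe : V → ℕ) (L : List V) (Q : V → Prop)
    (pending : ℕ → Prop) : Prop where
  trace : D.Trace key pe L
  queue_notMem : ∀ v, Q v → v ∉ L
  queue_reached : ∀ v, Q v → D.Reached key pe L v
  arc : ∀ h < D.arcs, D.tail h ∈ L → ¬ pending h → D.head h ∉ L →
    Q (D.head h) ∧ key (D.head h) ≤ D.arcKey key h
  source : ∀ y, D.source y → y ∉ L → Q y ∧ key y ≤ 0
  source_neg : ∀ v, Q v → D.source v → pe v ≠ 0 → key v < 0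
  -- When the queue is empty, this rules out parent arcs at unscanned vertices, which would
  -- otherwise count as forest edges.
  unreached : ∀ v, v ∉ L → ¬ Q v → pe v = 0

variable {D} {key : V → ℝ} {pe : V → ℕ} {L : List V} {Q : V → Prop} {pending : ℕ → Prop}

theorem Reached.congr {key' : V → ℝ} {pe' : V → ℕ} {v : V} (hkey : ∀ x ∈ L, key' x = key x)
    (hkv : key' v = key v) (hpv : pe' v = pe v) (h : D.Reached key pe L v) :
    D.Reached key' pe' L v := by
  rcases h with ⟨h1, h2, h3⟩ | ⟨h, h1, h2, h3, h4, h5⟩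
  · exact Or.inl ⟨hpv.trans h1, h2, hkv.trans h3⟩
  · refine Or.inr ⟨h, h1, hpv.trans h2, h3, h4, ?_⟩
    rw [hkv, h5, arcKey, arcKey, hkey _ h4]

/-- The trace refers only to keys and parents of scanned vertices, so later changes of the queue
cannot invalidate it. -/
theorem Trace.congr {key' : V → ℝ} {pe' : V → ℕ} (hkey : ∀ x ∈ L, key' x = key x)
    (hpe : ∀ x ∈ L, pe' x = pe x) (h : D.Trace key pe L) : D.Trace key' pe' L := by
  induction L with
  | nil => trivial
  | cons v L ih =>
    have hL : ∀ x ∈ L, key' x = key x := fun x hx => hkey x (List.mem_cons_of_mem _ hx)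
    have hv := hkey v List.mem_cons_self
    have hpv := hpe v List.mem_cons_self
    refine ⟨⟨h.1.notMem, h.1.reached.congr hL hv hpv, ?_, ?_, ?_⟩,
      ih hL (fun x hx => hpe x (List.mem_cons_of_mem _ hx)) h.2⟩
    · intro a ha ht hh
      rw [hv, arcKey, hL _ ht]
      exact h.1.le_arc a ha ht hh
    · rw [hv]
      exact h.1.le_source
    · rw [hv, hpv]
      exact h.1.source_neg

theorem Invariant.init (hkey : ∀ v, key v = 0) (hpe : ∀ v, pe v = 0)
    (hQ : ∀ v, Q v ↔ D.source v) : D.Invariant key pe [] Q pending where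
  trace := trivial
  queue_notMem := by simp
  queue_reached v hv := Or.inl ⟨hpe v, (hQ v).1 hv, hkey v⟩
  arc := by simp
  source y hy _ := ⟨(hQ y).2 hy, (hkey y).le⟩
  source_neg v _ _ h := absurd (hpe v) h
  unreached v _ _ := hpe v

/-- With nothing pending, every arc leaving `L` has its head in the queue with a key at most the key
of the arc. A minimum of the queue is therefore at most all of these, which is what `CanPop`
demands. -/
theorem Invariant.pop (h : D.Invariant key pe L Q fun _ => False) {u : V} (hu : Q u)
    (hmin : ∀ v, Q v → key u ≤ key v) {Q' : V → Prop} (hQ' : ∀ v, Q' v ↔ Q v ∧ v ≠ u)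
    {pending : ℕ → Prop} (hpend : ∀ a < D.arcs, D.tail a = u → pending a) :
    D.Invariant key pe (u :: L) Q' pending where
  trace := by
    refine ⟨⟨h.queue_notMem u hu, h.queue_reached u hu, ?_, ?_, h.source_neg u hu⟩, h.trace⟩
    · intro a ha ht hh
      obtain ⟨h1, h2⟩ := h.arc a ha ht id hh
      exact (hmin _ h1).trans h2
    · intro y hy hyL
      obtain ⟨h1, h2⟩ := h.source y hy hyL
      exact (hmin _ h1).trans h2
  queue_notMem v hv := by
    rw [hQ'] at hv
    simpa using ⟨hv.2, h.queue_notMem v hv.1⟩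
  queue_reached v hv := by
    rw [hQ'] at hv
    rcases h.queue_reached v hv.1 with h1 | ⟨a, h1, h2, h3, h4, h5⟩
    · exact Or.inl h1
    · exact Or.inr ⟨a, h1, h2, h3, List.mem_cons_of_mem _ h4, h5⟩
  arc a ha ht hp hh := by
    rw [List.mem_cons, not_or] at hh
    rcases List.mem_cons.1 ht with ht | ht
    · exact absurd (hpend a ha ht) hp
    · obtain ⟨h1, h2⟩ := h.arc a ha ht id hh.2
      exact ⟨(hQ' _).2 ⟨h1, hh.1⟩, h2⟩
  source y hy hyL := by
    rw [List.mem_cons, not_or] at hyL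
    obtain ⟨h1, h2⟩ := h.source y hy hyL.2
    exact ⟨(hQ' _).2 ⟨h1, hyL.1⟩, h2⟩
  source_neg v hv := h.source_neg v ((hQ' v).1 hv).1
  unreached v hv hq := by
    rw [List.mem_cons, not_or] at hv
    exact h.unreached v hv.2 fun hQ => hq ((hQ' v).2 ⟨hQ, hv.1⟩)

theorem Invariant.skip (h : D.Invariant key pe L Q pending) {a : ℕ}
    (ha : D.head a ∈ L ∨ Q (D.head a) ∧ key (D.head a) ≤ D.arcKey key a)
    {pending' : ℕ → Prop} (hpend : ∀ b, pending b → b = a ∨ pending' b) :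
    D.Invariant key pe L Q pending' where
  trace := h.trace
  queue_notMem := h.queue_notMem
  queue_reached := h.queue_reached
  arc b hb ht hp hh := by
    by_cases hba : b = a
    · subst hba
      exact ha.resolve_left hh
    · exact h.arc b hb ht (fun hpb => (hpend b hpb).elim hba hp) hh
  source := h.source
  source_neg := h.source_neg
  unreached := h.unreached

/-- The head is unscanned, so the keys in `L`, and with them the keys of all arcs leaving `L`, stay
fixed, while keys in the queue only decrease. -/
theorem Invariant.relax [DecidableEq V] (h : D.Invariant key pe L Q pending) {a : ℕ}
    (haN : a < D.arcs) (ht : D.tail a ∈ L) (hh : D.head a ∉ L)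
    (hlt : Q (D.head a) → D.arcKey key a < key (D.head a))
    {key' : V → ℝ} {pe' : V → ℕ} {Q' : V → Prop} {pending' : ℕ → Prop}
    (hkey : ∀ v, key' v = if v = D.head a then D.arcKey key a else key v)
    (hpe : ∀ v, pe' v = if v = D.head a then a + 1 else pe v)
    (hQ : ∀ v, Q' v ↔ v = D.head a ∨ Q v)
    (hpend : ∀ b, pending b → b = a ∨ pending' b) :
    D.Invariant key' pe' L Q' pending' := by
  have hkL : ∀ x ∈ L, key' x = key x := fun x hx => by
    rw [hkey, if_neg (by rintro rfl; exact hh hx)]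
  have hpL : ∀ x ∈ L, pe' x = pe x := fun x hx => by
    rw [hpe, if_neg (by rintro rfl; exact hh hx)]
  have harc : ∀ b, D.tail b ∈ L → D.arcKey key' b = D.arcKey key b := fun b hb => by
    rw [arcKey, arcKey, hkL _ hb]
  have hle : ∀ v, Q v → key' v ≤ key v := fun v hv => by
    rw [hkey]
    split_ifs with hva
    · subst hva
      exact (hlt hv).le
    · exact le_rfl
  refine ⟨h.trace.congr hkL hpL, ?_, ?_, ?_, ?_, ?_, ?_⟩
  · intro v hv
    rcases (hQ v).1 hv with rfl | hv
    · exact hh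
    · exact h.queue_notMem v hv
  · intro v hv
    by_cases hva : v = D.head a
    · subst hva
      refine Or.inr ⟨a, haN, ?_, rfl, ht, ?_⟩
      · rw [hpe, if_pos rfl]
      · rw [hkey, if_pos rfl, harc a ht]
    · refine (h.queue_reached v (((hQ v).1 hv).resolve_left hva)).congr hkL ?_ ?_
      · rw [hkey, if_neg hva]
      · rw [hpe, if_neg hva]
  · intro b hb htb hp hhb
    rw [harc b htb]
    by_cases hba : b = a
    · subst hba
      exact ⟨(hQ _).2 (Or.inl rfl), by rw [hkey, if_pos rfl]⟩
    · obtain ⟨h1, h2⟩ := h.arc b hb htb (fun hpb => (hpend b hpb).elim hba hp) hhb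
      exact ⟨(hQ _).2 (Or.inr h1), (hle _ h1).trans h2⟩
  · intro y hy hyL
    obtain ⟨h1, h2⟩ := h.source y hy hyL
    exact ⟨(hQ _).2 (Or.inr h1), (hle _ h1).trans h2⟩
  · intro v hv hs hp
    by_cases hva : v = D.head a
    · subst hva
      -- An unscanned source is in the queue with key at most 0, and the relaxation strictly
      -- improves on that.
      obtain ⟨h1, h2⟩ := h.source _ hs hh
      rw [hkey, if_pos rfl]
      exact (hlt h1).trans_le h2
    · rw [hkey, if_neg hva]
      rw [hpe, if_neg hva] at hp
      exact h.source_neg v (((hQ v).1 hv).resolve_left hva) hs hp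
  · intro v hv hq
    have hva : v ≠ D.head a := fun e => hq ((hQ v).2 (Or.inl e))
    rw [hpe, if_neg hva]
    exact h.unreached v hv fun hQv => hq ((hQ v).2 (Or.inr hQv))

theorem Invariant.closed (h : D.Invariant key pe L Q fun _ => False) (hQ : ∀ v, ¬ Q v) :
    D.Closed L where
  arc a ha ht := by
    by_contra hh
    exact hQ _ (h.arc a ha ht id hh).1
  source y hy := by
    by_contra hyL
    exact hQ _ (h.source y hy hyL).1

theorem Trace.nodup (h : D.Trace key pe L) : L.Nodup := by
  induction L with
  | nil => exact List.nodup_nil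
  | cons v L ih => exact List.nodup_cons.2 ⟨h.1.notMem, ih h.2⟩

theorem Trace.reached (h : D.Trace key pe L) {v : V} (hv : v ∈ L) : D.Reached key pe L v := by
  induction L with
  | nil => simp at hv
  | cons u L ih =>
    have : D.Reached key pe L v := by
      rcases List.mem_cons.1 hv with rfl | hv
      · exact h.1.reached
      · exact ih h.2 hv
    rcases this with h1 | ⟨a, h1, h2, h3, h4, h5⟩
    · exact Or.inl h1
    · exact Or.inr ⟨a, h1, h2, h3, List.mem_cons_of_mem _ h4, h5⟩

/-! #### Dijkstra's algorithm -/

section Dijkstra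

variable (hflag : D.flag = 1) (hcost : ∀ h < D.arcs, 0 ≤ D.cost h)

include hflag hcost

theorem Trace.key_nonneg (h : D.Trace key pe L) : ∀ v ∈ L, 0 ≤ key v := by
  induction L with
  | nil => simp
  | cons u L ih =>
    intro v hv
    rcases List.mem_cons.1 hv with rfl | hv
    · rcases h.1.reached with ⟨-, -, h0⟩ | ⟨a, h1, -, -, h4, h5⟩
      · exact h0.ge
      · rw [h5, arcKey, hflag]
        have := ih h.2 _ h4
        have := hcost a h1
        linarith
    · exact ih h.2 v hv

/-- Compare consecutive scans: either `v` was already available when `u` was chosen, so its key was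
no smaller, or `v` was reached through an arc out of `u` of nonnegative cost. -/
theorem Trace.key_mono {v : V} (h : D.Trace key pe (v :: L)) : ∀ x ∈ L, key x ≤ key v := by
  induction L generalizing v with
  | nil => simp
  | cons u L ih =>
    have huv : key u ≤ key v := by
      rcases h.1.reached with ⟨-, h2, h3⟩ | ⟨a, h1, -, h3, h4, h5⟩
      · rw [h3]
        exact h.2.1.le_source v h2 fun hv => h.1.notMem (List.mem_cons_of_mem _ hv)
      · rw [h5]
        rcases List.mem_cons.1 h4 with h4 | h4
        · rw [arcKey, hflag, h4]
          have := hcost a h1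
          linarith
        · refine h.2.1.le_arc a h1 h4 fun hv => h.1.notMem ?_
          rw [← h3]
          exact List.mem_cons_of_mem _ hv
    intro x hx
    rcases List.mem_cons.1 hx with rfl | hx
    · exact huv
    · exact (ih h.2 x hx).trans huv

/-- If the head is scanned after the tail, this is the choice made at that scan; if before, it
follows from monotonicity of the keys. Hence keys satisfy the triangle inequality along all scanned
arcs. -/
theorem Trace.key_le_arcKey (h : D.Trace key pe L) :
    ∀ a < D.arcs, D.tail a ∈ L → D.head a ∈ L → key (D.head a) ≤ D.arcKey key a := by
  induction L with
  | nil => simp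
  | cons v L ih =>
    intro a ha ht hh
    have hc := hcost a ha
    rcases List.mem_cons.1 ht with ht | ht <;> rcases List.mem_cons.1 hh with hh | hh
    · rw [arcKey, hflag, ht, hh]; linarith
    · rw [arcKey, hflag, ht]
      have := h.key_mono hflag hcost _ hh
      linarith
    · rw [hh]
      refine h.1.le_arc a ha ht ?_
      rw [hh]
      exact h.1.notMem
    · exact ih h.2 a ha ht hh

/-- A source with a parent would have a negative key, which nonnegative costs exclude. Thus every
terminal is the root of its own tree. -/
theorem Trace.pe_source (h : D.Trace key pe L) {v : V} (hv : v ∈ L) (hs : D.source v) :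
    pe v = 0 := by
  induction L with
  | nil => simp at hv
  | cons u L ih =>
    rcases List.mem_cons.1 hv with rfl | hv
    · by_contra h0
      exact absurd (h.key_nonneg hflag hcost v List.mem_cons_self)
        (not_le.2 (h.1.source_neg hs h0))
    · exact ih h.2 hv

end Dijkstra

/-! #### Prim's algorithm -/

section Prim

variable (hflag : D.flag = 0)

/-- Two ends of an arc of cost at most `lam`. -/
def LowArc (D : SearchProblem V) (lam : ℝ) (x y : V) : Prop :=
  ∃ a < D.arcs, D.cost a ≤ lam ∧ D.tail a = x ∧ D.head a = y

theorem Trace.mem_source (h : D.Trace key pe L) {s : V} (hs : ∀ v, D.source v → v = s)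
    (hL : L ≠ []) : s ∈ L := by
  induction L with
  | nil => exact absurd rfl hL
  | cons v L ih =>
    by_cases hL' : L = []
    · subst hL'
      rcases h.1.reached with ⟨-, h2, -⟩ | ⟨a, -, -, -, h4, -⟩
      · rw [hs v h2]
        exact List.mem_cons_self
      · simp at h4
    · exact List.mem_cons_of_mem _ (ih h.2 hL')

theorem exists_crossing {r : V → V → Prop} {S : V → Prop} {x y : V}
    (h : Relation.ReflTransGen r x y) (hx : S x) (hy : ¬ S y) : ∃ a b, r a b ∧ S a ∧ ¬ S b := by
  induction h with
  | refl => exact absurd hx hy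
  | @tail b c _ hbc ih =>
    by_cases hb : S b
    · exact ⟨b, c, hbc, hb, hy⟩
    · exact ih hb

include hflag

/-- The chain leaves `L` somewhere through an arc of cost at most `lam`. With `flag = 0` the cost is
the key of that arc, and the scanned vertex is chosen no worse. -/
theorem CanPop.key_le_of_crossing {v x : V} {lam : ℝ} (h : D.CanPop key pe L v) (hx : x ∈ L)
    (hr : Relation.ReflTransGen (D.LowArc lam) x v) : key v ≤ lam := by
  obtain ⟨a, b, ⟨e, he, hc, rfl, rfl⟩, ha, hb⟩ := exists_crossing (S := (· ∈ L)) hr hx h.notMem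
  refine (h.le_arc e he ha hb).trans ?_
  rwa [arcKey, hflag, zero_mul, zero_add]

/-- The bottleneck property of the tree found by Prim's algorithm: vertices that are connected by
arcs of cost at most `lam` are connected by tree arcs of cost at most `lam`. -/
theorem Trace.bottleneck (h : D.Trace key pe L) {s : V} (hs : ∀ v, D.source v → v = s) {lam : ℝ}
    (hsymm : ∀ x y, D.LowArc lam x y → D.LowArc lam y x) {r : V → V → Prop} (hr : Equivalence r)
    (hL : ∀ v ∈ L, ∀ a < D.arcs, pe v = a + 1 → D.head a = v → D.cost a ≤ lam →
      r (D.tail a) v) :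
    ∀ x ∈ L, ∀ y ∈ L, Relation.ReflTransGen (D.LowArc lam) x y → r x y := by
  have hsymm' : ∀ x y, Relation.ReflTransGen (D.LowArc lam) x y →
      Relation.ReflTransGen (D.LowArc lam) y x := by
    intro x y hxy
    induction hxy with
    | refl => exact .refl
    | tail _ hbc ih => exact .head (hsymm _ _ hbc) ih
  induction L with
  | nil => simp
  | cons v L ih =>
    have ih' := ih h.2 fun u hu => hL u (List.mem_cons_of_mem _ hu)
    -- The chain from `x` to `v` crosses out of `L`, so the parent arc of `v` costs at most `lam`.
    -- Its tail is then linked to `x` by low arcs and lies in `L`, where induction applies.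
    have key : ∀ x ∈ L, Relation.ReflTransGen (D.LowArc lam) x v → r x v := by
      intro x hx hxv
      have hle := h.1.key_le_of_crossing hflag hx hxv
      rcases h.1.reached with ⟨-, h2, -⟩ | ⟨a, h1, h2, h3, h4, h5⟩
      · have := h.2.mem_source hs (List.ne_nil_of_mem hx)
        rw [hs v h2] at h
        exact absurd this h.1.notMem
      · rw [h5, arcKey, hflag, zero_mul, zero_add] at hle
        refine hr.trans (ih' x hx _ h4 (hxv.trans (hsymm' _ _ (.single ?_))))
          (hL v List.mem_cons_self a h1 h2 h3 hle)
        exact ⟨a, h1, hle, rfl, h3⟩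
    intro x hx y hy hxy
    rcases List.mem_cons.1 hx with hx' | hx' <;> rcases List.mem_cons.1 hy with hy' | hy'
    · rw [hx', hy']
      exact hr.refl _
    · subst hx'
      exact hr.symm (key y hy' (hsymm' _ _ hxy))
    · subst hy'
      exact key x hx' hxy
    · exact ih' x hx' y hy' hxy

end Prim

end SearchProblem

/-! ### Mehlhorn's construction of a minimum spanning tree of the metric closure -/

section Mehlhorn

variable {V : Type*}

/-- Every edge of `G` in both directions. -/
structure IsArcList (G : SimpleGraph V) (N : ℕ) (tl hd : ℕ → V) : Prop where
  adj : ∀ a < N, G.Adj (tl a) (hd a)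
  exists_arc : ∀ x y, G.Adj x y → ∃ a < N, tl a = x ∧ hd a = y

/-- The shortest path forest of the terminals. -/
@[simps]
def Instance.forestProblem (I : Instance V) (w : Sym2 V → ℝ) (N : ℕ) (tl hd : ℕ → V) :
    SearchProblem V where
  arcs := N
  tail := tl
  head := hd
  source v := v ∈ I.terminals
  flag := 1
  cost a := w s(tl a, hd a)

/-- The edges of the shortest path forest. -/
def forestEdges (tl hd : ℕ → V) (pe : V → ℕ) : Set (Sym2 V) :=
  {e | ∃ v a, pe v = a + 1 ∧ e = s(tl a, hd a)}

open Classical in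
/-- The spanning tree problem in which the edges of the shortest path forest come first and every
other edge stands for the connection of two terminals through it. -/
@[simps]
noncomputable def treeProblem (w : Sym2 V → ℝ) (N : ℕ) (tl hd : ℕ → V) (d : V → ℝ) (pe : V → ℕ)
    (s : V) : SearchProblem V where
  arcs := N
  tail := tl
  head := hd
  source v := v = s
  flag := 0
  -- Other edges among reached vertices have nonnegative cost, so -1 makes the search exhaust a tree
  -- of the forest before it leaves it.
  cost a := if s(tl a, hd a) ∈ forestEdges tl hd pe then -1 else
    d (tl a) + w s(tl a, hd a) + d (hd a)

/-- `x` is an ancestor of `v` in the forest. -/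
def Ancestor (tl : ℕ → V) (pe : V → ℕ) (x v : V) : Prop :=
  Relation.ReflTransGen (fun x y => ∃ a, pe y = a + 1 ∧ tl a = x) x v

theorem ancestor_root_iff {tl : ℕ → V} {pe : V → ℕ} {x v : V} (h : pe v = 0) :
    Ancestor tl pe x v ↔ x = v := by
  refine ⟨fun hx => ?_, fun hx => hx ▸ .refl⟩
  rcases Relation.ReflTransGen.cases_tail hx with hx | ⟨b, -, a, ha, -⟩
  · exact hx.symm
  · omega

theorem ancestor_child_iff {tl : ℕ → V} {pe : V → ℕ} {x v : V} {a : ℕ} (h : pe v = a + 1) :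
    Ancestor tl pe x v ↔ x = v ∨ Ancestor tl pe x (tl a) := by
  constructor
  · intro hx
    rcases Relation.ReflTransGen.cases_tail hx with hx | ⟨b, hb, a', ha, rfl⟩
    · exact Or.inl hx.symm
    · obtain rfl : a' = a := by omega
      exact Or.inr hb
  · rintro (rfl | hx)
    · exact .refl
    · exact .tail hx ⟨a, h, rfl⟩

variable {I : Instance V} {w : Sym2 V → ℝ} {N : ℕ} {tl hd : ℕ → V}

/-- The paths of the shortest path forest, and the root `r v` of every vertex `v`. -/
theorem exists_forest_paths [DecidableEq V] (hA : IsArcList I.graph N tl hd) {d : V → ℝ}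
    {pe : V → ℕ} {L : List V} (h : (I.forestProblem w N tl hd).Trace d pe L) :
    ∃ r : V → I.terminals, ∀ v ∈ L,
      (∀ a, pe v = a + 1 → r v = r (tl a)) ∧ (pe v = 0 → (r v : V) = v) ∧
      ∃ p : I.graph.Walk (r v) v, p.IsPath ∧ walkWeight w p = d v ∧
        (∀ x ∈ p.support, x ∈ L ∧ r x = r v) ∧
        ∀ e, e ∈ p.edges ↔ ∃ x, Ancestor tl pe x v ∧ ∃ a, pe x = a + 1 ∧ e = s(tl a, hd a) := by
  induction L with
  | nil =>
    obtain ⟨t, ht⟩ := I.terminals_nonempty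
    exact ⟨fun _ => ⟨t, ht⟩, by simp⟩
  | cons v L ih =>
    obtain ⟨r, hr⟩ := ih h.2
    have hvL := h.1.notMem
    have hne : ∀ x ∈ L, x ≠ v := fun x hx => by rintro rfl; exact hvL hx
    obtain ⟨t, ht⟩ : ∃ t : I.terminals, (∀ a, pe v = a + 1 → t = r (tl a)) ∧
        (pe v = 0 → (t : V) = v) := by
      rcases h.1.reached with ⟨h1, h2, -⟩ | ⟨a, -, h2, -⟩
      · exact ⟨⟨v, h2⟩, fun a ha => by omega, fun _ => rfl⟩
      · refine ⟨r (tl a), fun b hb => ?_, fun h0 => by omega⟩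
        obtain rfl : a = b := by omega
        rfl
    have hrv : Function.update r v t v = t := Function.update_self ..
    have hrx : ∀ x ∈ L, Function.update r v t x = r x := fun x hx =>
      Function.update_of_ne (hne x hx) ..
    refine ⟨Function.update r v t, fun u hu => ?_⟩
    rcases List.mem_cons.1 hu with rfl | hu
    · refine ⟨fun a ha => ?_, fun h0 => by rw [hrv]; exact ht.2 h0, ?_⟩
      · rcases h.1.reached with ⟨h1, -⟩ | ⟨b, -, h2, -, h4, -⟩
        · omega
        · obtain rfl : a = b := by omega
          rw [hrv, show Function.update r u t (tl a) = r (tl a) from hrx _ h4]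
          exact ht.1 a ha
      · rw [hrv]
        rcases h.1.reached with ⟨h1, -, h3⟩ | ⟨a, h1, h2, h3, h4, h5⟩
        · obtain rfl := ht.2 h1
          refine ⟨.nil, .nil, by simp [walkWeight, h3], ?_, fun e => ?_⟩
          · intro x hx
            obtain rfl : x = t := by simpa using hx
            exact ⟨List.mem_cons_self, hrv⟩
          · simp only [SimpleGraph.Walk.edges_nil, List.not_mem_nil, false_iff, not_exists, not_and]
            intro x hx a ha
            rw [ancestor_root_iff h1] at hx
            subst hx
            omega
        · obtain ⟨-, -, p, hp, hpw, hps, hpe⟩ := hr (tl a) h4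
          simp only [Instance.forestProblem_head] at h3
          have hta := ht.1 a h2
          subst h3 hta
          have hadj := hA.adj a h1
          -- The path of the parent stays within `L` and `v` is not in `L`, so the extended walk is
          -- again a path.
          refine ⟨p.concat hadj, hp.concat (fun hx => hvL (hps _ hx).1) hadj, ?_, ?_, fun e => ?_⟩
          · rw [SimpleGraph.Walk.concat_eq_append, walkWeight_append, walkWeight_cons, hpw, h5,
              SearchProblem.arcKey]
            simp [walkWeight]
          · intro x hx
            rw [SimpleGraph.Walk.support_concat, List.mem_append, List.mem_singleton] at hx
            rcases hx with hx | rfl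
            · rw [hrx _ (hps x hx).1]
              exact ⟨List.mem_cons_of_mem _ (hps x hx).1, (hps x hx).2⟩
            · exact ⟨List.mem_cons_self, hrv⟩
          · rw [SimpleGraph.Walk.edges_concat, List.concat_eq_append, List.mem_append, List.mem_singleton, hpe]
            constructor
            · rintro (⟨x, hx, hx'⟩ | he)
              · exact ⟨x, (ancestor_child_iff h2).2 (Or.inr hx), hx'⟩
              · exact ⟨_, .refl, a, h2, he⟩
            · rintro ⟨x, hx, b, hb, he⟩
              rcases (ancestor_child_iff h2).1 hx with rfl | hx
              · obtain rfl : a = b := by omega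
                exact Or.inr he
              · exact Or.inl ⟨x, hx, b, hb, he⟩
    · obtain ⟨h1, h2, h3⟩ := hr u hu
      rw [hrx u hu]
      refine ⟨fun a ha => ?_, h2, ?_⟩
      · rcases h.2.reached hu with ⟨h0, -⟩ | ⟨b, -, hb, -, hbL, -⟩
        · omega
        · obtain rfl : a = b := by omega
          rw [show Function.update r v t (tl a) = r (tl a) from hrx _ hbL]
          exact h1 a ha
      · obtain ⟨p, hp, hpw, hps, hpe⟩ := h3
        refine ⟨p, hp, hpw, fun x hx => ?_, hpe⟩
        rw [hrx _ (hps x hx).1]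
        exact ⟨List.mem_cons_of_mem _ (hps x hx).1, (hps x hx).2⟩

/-- The data of the two searches. -/
structure TwoSearches (I : Instance V) (w : Sym2 V → ℝ) (N : ℕ) (tl hd : ℕ → V) (d : V → ℝ)
    (pe : V → ℕ) (L : List V) (s : V) (k : V → ℝ) (pe' : V → ℕ) (L' : List V) : Prop where
  weight_nonneg : ∀ e ∈ I.graph.edgeSet, 0 ≤ w e
  arcList : IsArcList I.graph N tl hd
  trace : (I.forestProblem w N tl hd).Trace d pe L
  closed : (I.forestProblem w N tl hd).Closed L
  unreached : ∀ v, v ∉ L → pe v = 0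
  source_mem : s ∈ I.terminals
  trace' : (treeProblem w N tl hd d pe s).Trace k pe' L'
  closed' : (treeProblem w N tl hd d pe s).Closed L'

/-- The vertices whose tree edge is not in the forest. -/
def IsBridgeVertex (tl hd : ℕ → V) (pe pe' : V → ℕ) (v : V) : Prop :=
  ∃ a, pe' v = a + 1 ∧ s(tl a, hd a) ∉ forestEdges tl hd pe

namespace TwoSearches

variable {d k : V → ℝ} {pe pe' : V → ℕ} {L L' : List V} {s : V}

theorem cost_nonneg (h : TwoSearches I w N tl hd d pe L s k pe' L') :
    ∀ a < (I.forestProblem w N tl hd).arcs, 0 ≤ (I.forestProblem w N tl hd).cost a :=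
  fun a ha => h.weight_nonneg _ (h.arcList.adj a ha)

theorem key_nonneg (h : TwoSearches I w N tl hd d pe L s k pe' L') : ∀ v ∈ L, 0 ≤ d v :=
  h.trace.key_nonneg rfl h.cost_nonneg

theorem terminal_pe (h : TwoSearches I w N tl hd d pe L s k pe' L') (t : I.terminals) :
    pe t = 0 :=
  h.trace.pe_source rfl h.cost_nonneg (h.closed.source t t.2) t.2

theorem terminal_key (h : TwoSearches I w N tl hd d pe L s k pe' L') (t : I.terminals) :
    d t = 0 := by
  rcases h.trace.reached (h.closed.source t t.2) with ⟨-, -, h0⟩ | ⟨a, -, ha, -⟩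
  · exact h0
  · have := h.terminal_pe t
    omega

theorem key_le_add (h : TwoSearches I w N tl hd d pe L s k pe' L') {u v : V} (hu : u ∈ L)
    (huv : I.graph.Adj u v) : v ∈ L ∧ d v ≤ d u + w s(u, v) := by
  obtain ⟨a, ha, rfl, rfl⟩ := h.arcList.exists_arc _ _ huv
  have hv := h.closed.arc a ha hu
  refine ⟨hv, (h.trace.key_le_arcKey rfl h.cost_nonneg a ha hu hv).trans_eq ?_⟩
  simp [SearchProblem.arcKey]

/-- Reading the walk backwards from its terminal, where the key is 0, the triangle inequality adds
one edge at a time. So `d u` is at most the distance from `u` to any terminal. -/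
theorem key_le_walkWeight (h : TwoSearches I w N tl hd d pe L s k pe' L') {u t : V}
    (q : I.graph.Walk u t) (ht : t ∈ I.terminals) : u ∈ L ∧ d u ≤ walkWeight w q := by
  induction q with
  | nil => exact ⟨h.closed.source _ ht, by simp [walkWeight, h.terminal_key ⟨_, ht⟩]⟩
  | cons huv q ih =>
    obtain ⟨h1, h2⟩ := ih ht
    obtain ⟨h3, h4⟩ := h.key_le_add h1 huv.symm
    refine ⟨h3, ?_⟩
    rw [walkWeight_cons, Sym2.eq_swap]
    linarith

/-- Distances and roots are meaningful only on `L`, so the second search must stay inside it; `L`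
contains `s` and is closed under arcs. -/
theorem mem_of_mem' (h : TwoSearches I w N tl hd d pe L s k pe' L') {v : V} (hv : v ∈ L') :
    v ∈ L := by
  have htr := h.trace'
  have hcl := h.closed
  obtain ⟨hs, harc⟩ : s ∈ L ∧ ∀ a < N, tl a ∈ L → hd a ∈ L :=
    ⟨hcl.source s h.source_mem, hcl.arc⟩
  clear h
  induction L' generalizing v with
  | nil => simp at hv
  | cons u L' ih =>
    rcases List.mem_cons.1 hv with rfl | hv
    · rcases htr.1.reached with ⟨-, h2, -⟩ | ⟨a, h1, -, h3, h4, -⟩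
      · rw [show v = s from h2]
        exact hs
      · rw [← h3]
        exact harc a h1 (ih h4 htr.2)
    · exact ih hv htr.2

theorem mem' (h : TwoSearches I w N tl hd d pe L s k pe' L') (t : I.terminals) :
    (t : V) ∈ L' := by
  obtain ⟨q⟩ := I.terminals_reachable s h.source_mem t t.2
  suffices H : ∀ x y (_ : I.graph.Walk x y), x ∈ L' → y ∈ L' from H _ _ q (h.closed'.source s rfl)
  intro x y q
  induction q with
  | nil => exact id
  | cons huv q ih =>
    intro hu
    obtain ⟨a, ha, rfl, rfl⟩ := h.arcList.exists_arc _ _ huv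
    exact ih (h.closed'.arc a ha hu)

/-- Costs are symmetric. -/
theorem lowArc_symm (h : TwoSearches I w N tl hd d pe L s k pe' L') (lam : ℝ) (x y : V)
    (hxy : (treeProblem w N tl hd d pe s).LowArc lam x y) :
    (treeProblem w N tl hd d pe s).LowArc lam y x := by
  obtain ⟨a, ha, hc, rfl, rfl⟩ := hxy
  obtain ⟨b, hb, hb1, hb2⟩ := h.arcList.exists_arc _ _ (h.arcList.adj a ha).symm
  refine ⟨b, hb, le_of_eq_of_le ?_ hc, hb1, hb2⟩
  have he : s(tl b, hd b) = s(tl a, hd a) := by rw [hb1, hb2, Sym2.eq_swap]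
  rw [treeProblem_cost, treeProblem_cost, he, hb1, hb2]
  split_ifs
  · rfl
  · ring

theorem reflTransGen_symm (h : TwoSearches I w N tl hd d pe L s k pe' L') {lam : ℝ} {x y : V}
    (hxy : Relation.ReflTransGen ((treeProblem w N tl hd d pe s).LowArc lam) x y) :
    Relation.ReflTransGen ((treeProblem w N tl hd d pe s).LowArc lam) y x := by
  induction hxy with
  | refl => exact .refl
  | tail _ hbc ih => exact .head (h.lowArc_symm _ _ _ hbc) ih

/-- Paths in the forest consist of arcs of cost `-1`. -/
theorem reflTransGen_of_walk (h : TwoSearches I w N tl hd d pe L s k pe' L') {x y : V}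
    (p : I.graph.Walk x y) (hp : ∀ e ∈ p.edges, e ∈ forestEdges tl hd pe) :
    Relation.ReflTransGen ((treeProblem w N tl hd d pe s).LowArc (-1)) x y := by
  induction p with
  | nil => exact .refl
  | cons huv p ih =>
    obtain ⟨a, ha, rfl, rfl⟩ := h.arcList.exists_arc _ _ huv
    refine .head ⟨a, ha, ?_, rfl, rfl⟩ (ih fun e he => hp e (by simp [he]))
    rw [treeProblem_cost, if_pos (hp _ (by simp))]

/-- A walk to a terminal consists of arcs that cost at most as much as the walk. -/
theorem reflTransGen_of_walkWeight (h : TwoSearches I w N tl hd d pe L s k pe' L') {lam : ℝ}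
    {u t : V} (q : I.graph.Walk u t) (ht : t ∈ I.terminals) (x : ℝ) (hx : d u ≤ x)
    (hlam : x + walkWeight w q ≤ lam) :
    Relation.ReflTransGen ((treeProblem w N tl hd d pe s).LowArc lam) u t := by
  -- `x` is the length walked so far and bounds `d u` throughout. The rest of the walk bounds `d v`,
  -- so the arc from `u` to `v` costs at most the whole length.
  induction q generalizing x with
  | nil => exact .refl
  | @cons u v t huv q ih =>
    rw [walkWeight_cons] at hlam
    have hu := (h.key_le_walkWeight (.cons huv q) ht).1
    obtain ⟨hv, hdv⟩ := h.key_le_walkWeight q ht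
    have h1 := (h.key_le_add hu huv).2
    refine .head ?_ (ih ht (x + w s(u, v)) (by linarith) (by linarith))
    obtain ⟨a, ha, rfl, rfl⟩ := h.arcList.exists_arc _ _ huv
    refine ⟨a, ha, ?_, rfl, rfl⟩
    have hw := h.weight_nonneg s(_, _) huv
    have h2 := h.key_nonneg _ hu
    have h3 := h.key_nonneg _ hv
    rw [treeProblem_cost]
    split_ifs <;> linarith [walkWeight_nonneg h.weight_nonneg q]

/-- The properties of the root function that the construction of the spanning tree uses. -/
structure IsRoot (I : Instance V) (w : Sym2 V → ℝ) (tl hd : ℕ → V) (d : V → ℝ) (pe : V → ℕ)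
    (L : List V) (r : V → I.terminals) : Prop where
  parent : ∀ v ∈ L, ∀ a, pe v = a + 1 → r v = r (tl a)
  root : ∀ t : I.terminals, r t = t
  path : ∀ v ∈ L, ∃ p : I.graph.Walk (r v) v, p.IsPath ∧ walkWeight w p = d v ∧
        (∀ x ∈ p.support, x ∈ L ∧ r x = r v) ∧
        ∀ e, e ∈ p.edges ↔ ∃ x, Ancestor tl pe x v ∧ ∃ a, pe x = a + 1 ∧ e = s(tl a, hd a)

theorem exists_isRoot [DecidableEq V] (h : TwoSearches I w N tl hd d pe L s k pe' L') :
    ∃ r, IsRoot I w tl hd d pe L r := by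
  obtain ⟨r, hr⟩ := exists_forest_paths h.arcList h.trace
  exact ⟨r, fun v hv => (hr v hv).1, fun t => Subtype.ext
    ((hr t (h.closed.source t t.2)).2.1 (h.terminal_pe t)), fun v hv => (hr v hv).2.2⟩

variable {r : V → I.terminals}

theorem root_eq_of_forestEdge (h : TwoSearches I w N tl hd d pe L s k pe' L')
    (hr : IsRoot I w tl hd d pe L r) {x y : V} (hxy : s(x, y) ∈ forestEdges tl hd pe) :
    r x = r y := by
  obtain ⟨v, a, hv, he⟩ := hxy
  have hvL : v ∈ L := by
    by_contra hv'
    have := h.unreached v hv'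
    omega
  have hhd : hd a = v := by
    rcases h.trace.reached hvL with ⟨h0, -⟩ | ⟨b, -, hb, hb', -⟩
    · omega
    · obtain rfl : a = b := by omega
      exact hb'
  have := hr.parent v hvL a hv
  rw [hhd] at he
  rcases Sym2.eq_iff.1 he with ⟨rfl, rfl⟩ | ⟨rfl, rfl⟩
  · exact this.symm
  · exact this

theorem reflTransGen_root (h : TwoSearches I w N tl hd d pe L s k pe' L')
    (hr : IsRoot I w tl hd d pe L r) {x : V} (hx : x ∈ L) :
    Relation.ReflTransGen ((treeProblem w N tl hd d pe s).LowArc (-1)) (r x) x := by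
  obtain ⟨p, -, -, -, hp⟩ := hr.path x hx
  refine h.reflTransGen_of_walk p fun e he => ?_
  obtain ⟨y, -, a, ha, he⟩ := (hp e).1 he
  exact ⟨y, a, ha, he⟩

/-- Each tree of the forest is entered by at most one edge that is not in the forest. -/
theorem bridge_roots (h : TwoSearches I w N tl hd d pe L s k pe' L')
    (hr : IsRoot I w tl hd d pe L r) :
    ∀ v ∈ L', IsBridgeVertex tl hd pe pe' v →
      (r v : V) ≠ s ∧ (∀ a, pe' v = a + 1 → r (tl a) ≠ r v) ∧
      ∀ v' ∈ L', IsBridgeVertex tl hd pe pe' v' → r v = r v' → v = v' := by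
  have hL : ∀ v ∈ L', v ∈ L := fun v hv => h.mem_of_mem' hv
  suffices H : ∀ K, (treeProblem w N tl hd d pe s).Trace k pe' K → (∀ v ∈ K, v ∈ L) →
      ∀ v ∈ K, IsBridgeVertex tl hd pe pe' v → (r v : V) ≠ s ∧
      (∀ a, pe' v = a + 1 → r (tl a) ≠ r v) ∧
      ∀ v' ∈ K, IsBridgeVertex tl hd pe pe' v' → r v = r v' → v = v' from
    H L' h.trace' hL
  intro K hK hKL
  induction K with
  | nil => simp
  | cons u K ih =>
    have ih' := ih hK.2 fun v hv => hKL v (List.mem_cons_of_mem _ hv)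
    have huL := hKL u List.mem_cons_self
    -- If the tree of `u` already contained a scanned vertex, that vertex would be linked to `u` by
    -- arcs of cost -1, so the key of `u` would be at most -1. A bridge has nonnegative cost.
    have hnew : IsBridgeVertex tl hd pe pe' u → ∀ x ∈ K, r x ≠ r u := by
      rintro ⟨a, ha, hae⟩ x hx hxu
      have hxL := hKL x (List.mem_cons_of_mem _ hx)
      have hle := hK.1.key_le_of_crossing rfl hx
        ((h.reflTransGen_symm (h.reflTransGen_root hr hxL)).trans
          (hxu ▸ h.reflTransGen_root hr huL))
      rcases hK.1.reached with ⟨h0, -⟩ | ⟨b, hb, hb', hbu, hbK, hbk⟩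
      · omega
      · obtain rfl : a = b := by omega
        have h1 := h.key_nonneg _ (hKL _ (List.mem_cons_of_mem _ hbK))
        have h2 := h.key_nonneg _ huL
        have h3 := h.weight_nonneg s(_, _) (h.arcList.adj a hb)
        rw [hbk, SearchProblem.arcKey, treeProblem_flag, zero_mul, zero_add, treeProblem_cost,
          if_neg hae] at hle
        simp only [treeProblem_head, treeProblem_tail] at hbu h1
        rw [hbu] at hle h3
        linarith
    intro v hv hbv
    rcases List.mem_cons.1 hv with hvu | hvK
    · subst hvu
      obtain ⟨a, ha, hae⟩ := hbv
      rcases hK.1.reached with ⟨h0, -⟩ | ⟨b, hb, hb', hbu, hbK, hbk⟩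
      · omega
      obtain rfl : a = b := by omega
      have hsK := hK.2.mem_source (fun v hv => hv) (List.ne_nil_of_mem hbK)
      refine ⟨fun hvs => ?_, fun b hb => ?_, fun v' hv' hbv' hvv' => ?_⟩
      · refine hnew ⟨a, ha, hae⟩ s hsK ?_
        rw [← hvs, hr.root]
      · obtain rfl : a = b := by omega
        exact hnew ⟨a, ha, hae⟩ _ hbK
      · rcases List.mem_cons.1 hv' with hv' | hv'
        · exact hv'.symm
        · exact absurd hvv'.symm (hnew ⟨a, ha, hae⟩ v' hv')
    · obtain ⟨h1, h2, h3⟩ := ih' v hvK hbv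
      refine ⟨h1, h2, fun v' hv' hbv' hvv' => ?_⟩
      rcases List.mem_cons.1 hv' with hv'u | hv'K
      · subst hv'u
        exact absurd hvv' (hnew hbv' v hvK)
      · exact h3 v' hv'K hbv' hvv'

/-- The path through a bridge. -/
theorem exists_bridge_path (h : TwoSearches I w N tl hd d pe L s k pe' L')
    (hr : IsRoot I w tl hd d pe L r) {v : V} (hv : v ∈ L') {a : ℕ} (ha : pe' v = a + 1)
    (hae : s(tl a, hd a) ∉ forestEdges tl hd pe) :
    hd a = v ∧ tl a ∈ L' ∧ ∃ q : I.graph.Walk (r (tl a)) (r v), q.IsPath ∧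
      walkWeight w q = (treeProblem w N tl hd d pe s).cost a ∧
      ∀ e, e ∈ q.edges ↔ e = s(tl a, hd a) ∨ ∃ x, (Ancestor tl pe x (tl a) ∨ Ancestor tl pe x v) ∧
        ∃ b, pe x = b + 1 ∧ e = s(tl b, hd b) := by
  have hne := (h.bridge_roots hr v hv ⟨a, ha, hae⟩).2.1 a ha
  rcases h.trace'.reached hv with ⟨h0, -⟩ | ⟨b, hb, hb', hbv, hbL, -⟩
  · omega
  obtain rfl : a = b := by omega
  simp only [treeProblem_head, treeProblem_tail] at hbv hbL
  subst hbv
  refine ⟨rfl, hbL, ?_⟩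
  obtain ⟨p, hp, hpw, hps, hpe⟩ := hr.path _ (h.mem_of_mem' hbL)
  obtain ⟨p', hp', hpw', hps', hpe'⟩ := hr.path _ (h.mem_of_mem' hv)
  refine ⟨p.append (.cons (h.arcList.adj a hb) p'.reverse), ?_, ?_, fun e => ?_⟩
  · rw [SimpleGraph.Walk.isPath_def, SimpleGraph.Walk.support_append,
      SimpleGraph.Walk.support_cons, List.tail_cons, List.nodup_append']
    refine ⟨hp.support_nodup, hp'.reverse.support_nodup, fun x hx hx' => hne ?_⟩
    rw [SimpleGraph.Walk.support_reverse, List.mem_reverse] at hx'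
    rw [← (hps x hx).2, (hps' x hx').2]
  · rw [walkWeight_append, walkWeight_cons, walkWeight_reverse, hpw, hpw', treeProblem_cost,
      if_neg hae, add_assoc]
  · rw [SimpleGraph.Walk.edges_append, SimpleGraph.Walk.edges_cons, SimpleGraph.Walk.edges_reverse,
      List.mem_append, List.mem_cons, List.mem_reverse, hpe, hpe']
    constructor
    · rintro (⟨x, hx, he⟩ | he | ⟨x, hx, he⟩)
      · exact Or.inr ⟨x, Or.inl hx, he⟩
      · exact Or.inl he
      · exact Or.inr ⟨x, Or.inr hx, he⟩
    · rintro (he | ⟨x, hx | hx, he⟩)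
      · exact Or.inr (Or.inl he)
      · exact Or.inl ⟨x, hx, he⟩
      · exact Or.inr (Or.inr ⟨x, hx, he⟩)

/-- The edge of the metric closure that belongs to the tree edge of `v`. -/
def bridgeEdge (tl : ℕ → V) (pe' : V → ℕ) (r : V → I.terminals) (v : V) : Sym2 I.terminals :=
  s(r (tl (pe' v - 1)), r v)

/-- Terminals are connected by bridges that cost at most as much as their distance. -/
theorem reachable_bridges [Finite V] (h : TwoSearches I w N tl hd d pe L s k pe' L')
    (hr : IsRoot I w tl hd d pe L r) (x y : I.terminals) :
    (SimpleGraph.fromEdgeSet {e : Sym2 I.terminals | ∃ v ∈ L', ∃ a, pe' v = a + 1 ∧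
      s(tl a, hd a) ∉ forestEdges tl hd pe ∧ bridgeEdge tl pe' r v = e ∧
      (treeProblem w N tl hd d pe s).cost a ≤ I.closureCost w s(x, y)}).Reachable x y := by
  set lam := I.closureCost w s(x, y) with hlam
  have hlam' : pathDist I.graph w x y = lam := rfl
  set H := SimpleGraph.fromEdgeSet {e : Sym2 I.terminals | ∃ v ∈ L', ∃ a, pe' v = a + 1 ∧
      s(tl a, hd a) ∉ forestEdges tl hd pe ∧ bridgeEdge tl pe' r v = e ∧
      (treeProblem w N tl hd d pe s).cost a ≤ lam} with hH
  obtain ⟨q, -, hq⟩ := exists_walkWeight_eq_pathDist (w := w) (I.reachable x y)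
  have hxy := h.reflTransGen_of_walkWeight q y.2 0 (h.terminal_key x).le
    (by rw [hq, zero_add, hlam'])
  -- The equivalence is connectedness of the roots in `H`. A forest arc does not change the root,
  -- and any other tree arc of low cost is an edge of `H` unless the roots agree.
  have hb := h.trace'.bottleneck rfl (s := s) (fun v hv => hv) (lam := lam)
    (h.lowArc_symm lam) (r := fun u v => H.Reachable (r u) (r v))
    ⟨fun _ => .rfl, fun h => h.symm, fun h h' => h.trans h'⟩ (fun v hv a ha hpa hav hc => ?_)
    x (h.mem' x) y (h.mem' y) hxy
  · rwa [hr.root, hr.root] at hb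
  · change H.Reachable (r (tl a)) (r v)
    by_cases hae : s(tl a, hd a) ∈ forestEdges tl hd pe
    · rw [h.root_eq_of_forestEdge hr hae, show hd a = v from hav]
    · by_cases heq : r (tl a) = r v
      · rw [heq]
      · refine SimpleGraph.Adj.reachable ?_
        rw [hH, SimpleGraph.fromEdgeSet_adj]
        exact ⟨⟨v, hv, a, hpa, hae, by rw [bridgeEdge, hpa, Nat.add_sub_cancel], hc⟩, heq⟩

/-- Mehlhorn's construction is correct. -/
theorem exists_minSpanningTree [Finite V] [DecidableEq V]
    (h : TwoSearches I w N tl hd d pe L s k pe' L') :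
    ∃ M : Finset (Sym2 I.terminals), IsMinSpanningTree (I.closureCost w) M ∧
      ∃ p : Sym2 I.terminals → Finset (Sym2 V),
        (∀ e ∈ M, ∃ (s t : I.terminals) (q : I.graph.Walk s t),
          e = s(s, t) ∧ IsCheapestPath w q ∧ p e = q.edges.toFinset) ∧
        ∀ e, e ∈ M.biUnion p ↔ ∃ v ∈ L', ∃ a, pe' v = a + 1 ∧
          s(tl a, hd a) ∉ forestEdges tl hd pe ∧ (e = s(tl a, hd a) ∨
            ∃ x, (Ancestor tl pe x (tl a) ∨ Ancestor tl pe x v) ∧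
              ∃ b, pe x = b + 1 ∧ e = s(tl b, hd b)) := by
  classical
  obtain ⟨r, hr⟩ := h.exists_isRoot
  have hbr := h.bridge_roots hr
  set B := L'.toFinset.filter (IsBridgeVertex tl hd pe pe') with hB
  have hmemB : ∀ v, v ∈ B ↔ v ∈ L' ∧ IsBridgeVertex tl hd pe pe' v := fun v => by
    rw [hB, Finset.mem_filter, List.mem_toFinset]
  set M := B.image (bridgeEdge tl pe' r) with hM
  -- Bridges enter pairwise different trees of the forest, and never the one rooted at `s`.
  have hBcard : B.card + 1 ≤ Fintype.card I.terminals := by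
    have h1 : (B.image r).card = B.card := Finset.card_image_of_injOn fun v hv v' hv' hvv' => by
      rw [Finset.mem_coe, hmemB] at hv hv'
      exact (hbr v hv.1 hv.2).2.2 v' hv'.1 hv'.2 hvv'
    have h2 : (B.image r).card < Fintype.card I.terminals := by
      rw [← Finset.card_univ]
      refine Finset.card_lt_card (Finset.ssubset_univ_iff.2 fun huniv => ?_)
      have := huniv ▸ Finset.mem_univ (⟨s, h.source_mem⟩ : I.terminals)
      obtain ⟨v, hv, hvs⟩ := Finset.mem_image.1 this
      rw [hmemB] at hv
      exact (hbr v hv.1 hv.2).1 (by rw [hvs])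
    omega
  have hsub : ∀ lam, {e : Sym2 I.terminals | ∃ v ∈ L', ∃ a, pe' v = a + 1 ∧
      s(tl a, hd a) ∉ forestEdges tl hd pe ∧ bridgeEdge tl pe' r v = e ∧
      (treeProblem w N tl hd d pe s).cost a ≤ lam} ⊆ M := by
    rintro lam e ⟨v, hv, a, ha, hae, rfl, -⟩
    exact Finset.mem_image_of_mem _ ((hmemB v).2 ⟨hv, a, ha, hae⟩)
  have hconn : (SimpleGraph.fromEdgeSet (M : Set (Sym2 I.terminals))).Connected :=
    { preconnected := fun x y =>
        (h.reachable_bridges hr x y).mono (SimpleGraph.fromEdgeSet_mono (hsub _))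
      nonempty := ⟨⟨s, h.source_mem⟩⟩ }
  have hdiag : ∀ e ∈ M, ¬ e.IsDiag := by
    intro e he
    obtain ⟨v, hv, rfl⟩ := Finset.mem_image.1 he
    obtain ⟨hv, a, ha, hae⟩ := (hmemB v).1 hv
    rw [bridgeEdge, ha, Nat.add_sub_cancel, Sym2.mk_isDiag_iff]
    exact (hbr v hv ⟨a, ha, hae⟩).2.1 a ha
  have hMB : M.card ≤ B.card := Finset.card_image_le
  have htree : IsSpanningTree M := isSpanningTree_of_card hdiag hconn (by omega)
  -- A connected graph on the terminals has at least as many edges as `B` has vertices, so no two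
  -- bridges give the same edge.
  have hinj : Set.InjOn (bridgeEdge tl pe' r) B := by
    rw [← Finset.card_image_iff, ← hM]
    have := card_le_of_connected hconn
    omega
  have hcost_ge : ∀ v ∈ L', ∀ a, pe' v = a + 1 → s(tl a, hd a) ∉ forestEdges tl hd pe →
      I.closureCost w (bridgeEdge tl pe' r v) ≤ (treeProblem w N tl hd d pe s).cost a := by
    intro v hv a ha hae
    obtain ⟨-, -, q, -, hq, -⟩ := h.exists_bridge_path hr hv ha hae
    rw [bridgeEdge, ha, Nat.add_sub_cancel, ← hq, I.closureCost_mk]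
    exact pathDist_le_walkWeight h.weight_nonneg q
  -- If a bridge were longer than the distance of its two roots, the roots would be connected by
  -- strictly cheaper bridges, hence without this one, against the tree property. Together with
  -- `hcost_ge`, bridge paths are cheapest paths.
  have hcost_le : ∀ v ∈ L', ∀ a, pe' v = a + 1 → s(tl a, hd a) ∉ forestEdges tl hd pe →
      (treeProblem w N tl hd d pe s).cost a ≤ I.closureCost w (bridgeEdge tl pe' r v) := by
    intro v hv a ha hae
    by_contra hlt
    push Not at hlt
    have hvB := (hmemB v).2 ⟨hv, a, ha, hae⟩
    have hm : bridgeEdge tl pe' r v ∈ M := Finset.mem_image_of_mem _ hvB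
    have hreach := h.reachable_bridges hr (r (tl a)) (r v)
    have hbe : bridgeEdge tl pe' r v = s(r (tl a), r v) := by
      rw [bridgeEdge, ha, Nat.add_sub_cancel]
    rw [← hbe] at hreach
    refine htree.not_reachable (hbe ▸ hm) (hreach.mono (SimpleGraph.fromEdgeSet_mono ?_))
    rintro e ⟨v', hv', a', ha', hae', rfl, hc⟩
    have hv'B := (hmemB v').2 ⟨hv', a', ha', hae'⟩
    rw [Finset.mem_coe, Finset.mem_erase]
    refine ⟨fun heq => ?_, Finset.mem_image_of_mem _ hv'B⟩
    rw [← hbe] at heq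
    obtain rfl := hinj hv'B hvB heq
    obtain rfl : a' = a := by omega
    linarith
  have hpaths : ∀ v, ∃ P : Finset (Sym2 V), v ∈ B → (∃ (s t : I.terminals)
      (q : I.graph.Walk s t), bridgeEdge tl pe' r v = s(s, t) ∧ IsCheapestPath w q ∧
        P = q.edges.toFinset) ∧ ∀ e, e ∈ P ↔ ∃ a, pe' v = a + 1 ∧
          s(tl a, hd a) ∉ forestEdges tl hd pe ∧ (e = s(tl a, hd a) ∨
            ∃ x, (Ancestor tl pe x (tl a) ∨ Ancestor tl pe x v) ∧
              ∃ b, pe x = b + 1 ∧ e = s(tl b, hd b)) := by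
    intro v
    by_cases hvB : v ∈ B
    · obtain ⟨hv, a, ha, hae⟩ := (hmemB v).1 hvB
      obtain ⟨-, -, q, hqp, hq, hqe⟩ := h.exists_bridge_path hr hv ha hae
      have hbe : bridgeEdge tl pe' r v = s(r (tl a), r v) := by
        rw [bridgeEdge, ha, Nat.add_sub_cancel]
      refine ⟨q.edges.toFinset, fun _ => ⟨⟨_, _, q, hbe, ⟨hqp, fun q' _ => ?_⟩, rfl⟩, fun e => ?_⟩⟩
      · rw [hq]
        refine (hcost_le v hv a ha hae).trans ?_
        rw [hbe, I.closureCost_mk]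
        exact pathDist_le_walkWeight h.weight_nonneg q'
      · rw [List.mem_toFinset, hqe]
        constructor
        · exact fun he => ⟨a, ha, hae, he⟩
        · rintro ⟨a', ha', -, he⟩
          obtain rfl : a = a' := by omega
          exact he
    · exact ⟨∅, fun h => absurd h hvB⟩
  choose P hP using hpaths
  have hinv : ∀ e, ∃ v, e ∈ M → v ∈ B ∧ bridgeEdge tl pe' r v = e := by
    intro e
    by_cases he : e ∈ M
    · obtain ⟨v, hv⟩ := Finset.mem_image.1 he
      exact ⟨v, fun _ => hv⟩
    · exact ⟨s, fun h => absurd h he⟩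
  choose u hu using hinv
  refine ⟨M, isMinSpanningTree_of_bottleneck htree fun x y _ => ?_, fun e => P (u e), ?_, ?_⟩
  · refine (h.reachable_bridges hr x y).mono (SimpleGraph.fromEdgeSet_mono fun e he => ?_)
    refine ⟨hsub _ he, ?_⟩
    obtain ⟨v, hv, a, ha, hae, rfl, hc⟩ := he
    exact (hcost_ge v hv a ha hae).trans hc
  · intro e he
    obtain ⟨h1, h2⟩ := hu e he
    have := (hP _ h1).1
    rwa [h2] at this
  · intro e
    rw [Finset.mem_biUnion]
    constructor
    · rintro ⟨f, hf, he⟩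
      obtain ⟨h1, h2⟩ := hu f hf
      obtain ⟨a, ha⟩ := ((hP _ h1).2 e).1 he
      exact ⟨u f, ((hmemB _).1 h1).1, a, ha⟩
    · rintro ⟨v, hv, a, ha, hae, he⟩
      have hvB := (hmemB v).2 ⟨hv, a, ha, hae⟩
      have hm : bridgeEdge tl pe' r v ∈ M := Finset.mem_image_of_mem _ hvB
      obtain ⟨h1, h2⟩ := hu _ hm
      refine ⟨_, hm, ?_⟩
      rw [hinj h1 hvB h2]
      exact ((hP v hvB).2 e).2 ⟨a, ha, hae, he⟩

end TwoSearches

end Mehlhorn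

/-! ### Reasoning about programs -/

section Programs

theorem Memory.nat_setNat (μ : Memory) (a i x b j : ℕ) :
    (μ.setNat a i x).nat b j = if b = a ∧ j = i then x else μ.nat b j := by
  simp only [Memory.setNat, Function.update_apply]
  by_cases hb : b = a
  · subst hb
    simp [Function.update_apply]
  · simp [hb]

theorem Memory.real_setNat (μ : Memory) (a i x : ℕ) : (μ.setNat a i x).real = μ.real := rfl

theorem Memory.nat_setReal (μ : Memory) (a i : ℕ) (x : ℝ) : (μ.setReal a i x).nat = μ.nat := rfl

theorem Memory.real_setReal (μ : Memory) (a i : ℕ) (x : ℝ) (b j : ℕ) :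
    (μ.setReal a i x).real b j = if b = a ∧ j = i then x else μ.real b j := by
  simp only [Memory.setReal, Function.update_apply]
  by_cases hb : b = a
  · subst hb
    simp [Function.update_apply]
  · simp [hb]

/-- Started in `μ`, the program `P` halts, and its running time and final memory satisfy `Q`. -/
def Ensures (P : Cmd) (μ : Memory) (Q : ℕ → Memory → Prop) : Prop :=
  ∃ μ' t, Exec P μ μ' t ∧ Q t μ'

theorem Ensures.mono {P : Cmd} {μ : Memory} {Q Q' : ℕ → Memory → Prop} (h : Ensures P μ Q)
    (hQ : ∀ t μ', Q t μ' → Q' t μ') : Ensures P μ Q' := by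
  obtain ⟨μ', t, h1, h2⟩ := h
  exact ⟨μ', t, h1, hQ _ _ h2⟩

/-- These rules are equivalences, so that rewriting with them executes straight-line code
symbolically. -/
theorem ensures_skip {μ : Memory} {Q : ℕ → Memory → Prop} : Ensures .skip μ Q ↔ Q 0 μ := by
  constructor
  · rintro ⟨_, _, ⟨⟩, h⟩
    exact h
  · exact fun h => ⟨_, _, .skip μ, h⟩

theorem ensures_setNat {a : ℕ} {i x : NatExp} {μ : Memory} {Q : ℕ → Memory → Prop} :
    Ensures (.setNat a i x) μ Q ↔ Q 1 (μ.setNat a (i.eval μ) (x.eval μ)) := by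
  constructor
  · rintro ⟨_, _, ⟨⟩, h⟩
    exact h
  · exact fun h => ⟨_, _, .setNat a i x μ, h⟩

theorem ensures_setReal {a : ℕ} {i : NatExp} {x : RealExp} {μ : Memory}
    {Q : ℕ → Memory → Prop} :
    Ensures (.setReal a i x) μ Q ↔ Q 1 (μ.setReal a (i.eval μ) (x.eval μ)) := by
  constructor
  · rintro ⟨_, _, ⟨⟩, h⟩
    exact h
  · exact fun h => ⟨_, _, .setReal a i x μ, h⟩

theorem ensures_seq {P P' : Cmd} {μ : Memory} {Q : ℕ → Memory → Prop} :
    Ensures (.seq P P') μ Q ↔ Ensures P μ fun t μ' => Ensures P' μ' fun t' => Q (t + t') := by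
  constructor
  · rintro ⟨_, _, h, hQ⟩
    cases h with
    | seq h1 h2 => exact ⟨_, _, h1, _, _, h2, hQ⟩
  · rintro ⟨_, _, h1, _, _, h2, hQ⟩
    exact ⟨_, _, .seq h1 h2, hQ⟩

theorem ensures_ite {b : Test} {P P' : Cmd} {μ : Memory} {Q : ℕ → Memory → Prop} :
    Ensures (.ite b P P') μ Q ↔ (b.Holds μ → Ensures P μ fun t => Q (t + 1)) ∧
      (¬ b.Holds μ → Ensures P' μ fun t => Q (t + 1)) := by
  constructor
  · rintro ⟨_, _, h, hQ⟩
    cases h with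
    | ite_true hb h => exact ⟨fun _ => ⟨_, _, h, hQ⟩, fun hb' => absurd hb hb'⟩
    | ite_false hb h => exact ⟨fun hb' => absurd hb' hb, fun _ => ⟨_, _, h, hQ⟩⟩
  · intro h
    by_cases hb : b.Holds μ
    · obtain ⟨_, _, h, hQ⟩ := h.1 hb
      exact ⟨_, _, .ite_true hb h, hQ⟩
    · obtain ⟨_, _, h, hQ⟩ := h.2 hb
      exact ⟨_, _, .ite_false hb h, hQ⟩

/-- Loops: `Inv μ φ` is an invariant in which `φ` bounds the remaining running time. -/
theorem Ensures.loop {b : Test} {P : Cmd} (Inv : Memory → ℕ → Prop)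
    (step : ∀ μ φ, Inv μ φ → b.Holds μ →
      Ensures P μ fun t μ' => ∃ φ', Inv μ' φ' ∧ φ' + t + 1 ≤ φ) {μ : Memory} {φ : ℕ}
    (h : Inv μ φ) :
    Ensures (.loop b P) μ fun t μ' => ∃ φ', Inv μ' φ' ∧ ¬ b.Holds μ' ∧ φ' + t ≤ φ + 1 := by
  induction φ using Nat.strong_induction_on generalizing μ with
  | _ φ ih =>
    by_cases hb : b.Holds μ
    · obtain ⟨μ', t, hP, φ', hφ', hle⟩ := step μ φ h hb
      obtain ⟨μ'', t', hl, φ'', hφ'', hb', hle'⟩ := ih φ' (by omega) hφ'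
      exact ⟨μ'', _, .loop_true hb hP hl, φ'', hφ'', hb', by omega⟩
    · exact ⟨μ, _, .loop_false hb, φ, h, hb, le_rfl⟩

/-- `for (i = 0; i < N; i++) P`, where the entry `0` of array `i` is the loop variable. -/
def forLoop (i : ℕ) (N : NatExp) (P : Cmd) : Cmd :=
  .seq (.setNat i (.const 0) (.const 0))
    (.loop (.not (.natLe N (.get i (.const 0))))
      (.seq P (.setNat i (.const 0) (.succ (.get i (.const 0))))))

/-- `Inv k` describes the memory in which the loop variable has already been set to `k`. Each pass
adds a test and an increment to `T`; the final 2 is the initial assignment and the last test. -/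
theorem Ensures.forLoop {i : ℕ} {N : NatExp} {P : Cmd} (Inv : ℕ → Memory → Prop) (K T : ℕ)
    {μ : Memory} (hN : ∀ k μ, Inv k μ → N.eval μ = K) (h0 : Inv 0 (μ.setNat i 0 0))
    (step : ∀ k μ, k < K → Inv k μ → μ.nat i 0 = k →
      Ensures P μ fun t μ' => t ≤ T ∧ μ'.nat i 0 = k ∧ Inv (k + 1) (μ'.setNat i 0 (k + 1))) :
    Ensures (forLoop i N P) μ fun t μ' => t ≤ K * (T + 2) + 2 ∧ Inv K μ' := by
  rw [SteinerPred.forLoop, ensures_seq, ensures_setNat]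
  refine (Ensures.loop (fun μ φ => ∃ k, k ≤ K ∧ Inv k μ ∧ μ.nat i 0 = k ∧
    φ = (K - k) * (T + 2)) ?_ (φ := K * (T + 2)) ⟨0, Nat.zero_le _, h0, ?_, ?_⟩).mono ?_
  · rintro μ φ ⟨k, hk, hInv, hik, rfl⟩ hb
    simp only [Test.Holds, NatExp.eval, hN k μ hInv, hik] at hb
    rw [ensures_seq]
    refine (step k μ (by omega) hInv hik).mono ?_
    rintro t μ' ⟨ht, hik', hInv'⟩
    rw [ensures_setNat]
    simp only [NatExp.eval, hik']
    refine ⟨_, ⟨k + 1, by omega, hInv', ?_, rfl⟩, ?_⟩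
    · rw [Memory.nat_setNat, if_pos ⟨rfl, rfl⟩]
    · obtain ⟨d, rfl⟩ : ∃ d, K = k + 1 + d := ⟨K - (k + 1), by omega⟩
      have h1 : k + 1 + d - (k + 1) = d := by omega
      have h2 : k + 1 + d - k = d + 1 := by omega
      rw [h1, h2, add_mul]
      omega
  · simp [Memory.nat_setNat]
  · simp
  · rintro t μ' ⟨φ', ⟨k, hk, hInv, hik, rfl⟩, hb, hle⟩
    simp only [Test.Holds, NatExp.eval, hN k μ' hInv, hik, not_not] at hb
    obtain rfl : k = K := le_antisymm hk hb
    exact ⟨by omega, hInv⟩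

/-- Only the named arrays of natural numbers and of real numbers have changed. -/
def ChangesOnly (A R : List ℕ) (μ μ' : Memory) : Prop :=
  (∀ a, a ∉ A → μ'.nat a = μ.nat a) ∧ ∀ a, a ∉ R → μ'.real a = μ.real a

theorem ChangesOnly.refl (A R : List ℕ) (μ : Memory) : ChangesOnly A R μ μ :=
  ⟨fun _ _ => rfl, fun _ _ => rfl⟩

theorem ChangesOnly.trans {A R : List ℕ} {μ μ' μ'' : Memory} (h : ChangesOnly A R μ μ')
    (h' : ChangesOnly A R μ' μ'') : ChangesOnly A R μ μ'' :=
  ⟨fun a ha => (h'.1 a ha).trans (h.1 a ha), fun a ha => (h'.2 a ha).trans (h.2 a ha)⟩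

theorem ChangesOnly.mono {A R A' R' : List ℕ} {μ μ' : Memory} (h : ChangesOnly A R μ μ')
    (hA : A ⊆ A') (hR : R ⊆ R') : ChangesOnly A' R' μ μ' :=
  ⟨fun a ha => h.1 a fun h => ha (hA h), fun a ha => h.2 a fun h => ha (hR h)⟩

theorem ChangesOnly.setNat {A R : List ℕ} {μ μ' : Memory} (h : ChangesOnly A R μ μ') {a : ℕ}
    (ha : a ∈ A) (i x : ℕ) : ChangesOnly A R μ (μ'.setNat a i x) := by
  refine ⟨fun b hb => ?_, h.2⟩
  rw [← h.1 b hb]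
  have : b ≠ a := by rintro rfl; exact hb ha
  exact Function.update_of_ne this _ _

theorem ChangesOnly.setReal {A R : List ℕ} {μ μ' : Memory} (h : ChangesOnly A R μ μ') {a : ℕ}
    (ha : a ∈ R) (i : ℕ) (x : ℝ) : ChangesOnly A R μ (μ'.setReal a i x) := by
  refine ⟨h.1, fun b hb => ?_⟩
  rw [← h.2 b hb]
  have : b ≠ a := by rintro rfl; exact hb ha
  exact Function.update_of_ne this _ _

end Programs

/-! ### The program

The arrays of natural numbers beyond those of the input and the output:
* `6`, `7`, `8`: tail, head and edge number of an arc; `9`, `10`: linked lists of the arcs with a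
  given tail, with arc `h` represented by `h + 1`;
* `11`, `12`: left child and parent in the tournament tree with nodes `1, …, 2 n - 1`; `19`: the
  leaf of a vertex; `13`: the winner at a node, with the vertex `v` represented by `v + 1`;
* `14`, `15`, `16`: scanned vertices, parent arcs and scan order of a search; `17`, `18`: copies of
  `15` and `16`; `20`: sources of a search;
* `21`, `22`, `23`: edges of the current solution, vertices to be connected, edges of the forest;
* `30`, …, `40`: single numbers.

The arrays of real numbers: `2` keys at the nodes of the tree, `3` keys of a search, `4` a copy of
it, `6` costs of the edges in a search, `7` scaled weights; and the single numbers `5` (the factor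
`flag` of a search), `8` (a new key), `9` (`α`), `10` and `11` (current and best total weight). -/

/-- A single number. -/
abbrev natVar (a : ℕ) : NatExp := .get a (.const 0)

/-- A single real number. -/
abbrev realVar (a : ℕ) : RealExp := .get a (.const 0)

/-! ### The tournament tree as a priority queue -/

section Heap

/-- Copy the entries at `x` of the tournament tree to the current node. -/
def copyNode (x : NatExp) : Cmd :=
  .seq (.setNat 13 (natVar 31) (.get 13 x)) (.setReal 2 (natVar 31) (.get 2 x))

/-- Recompute the current node from its children. -/
def pullNode : Cmd :=
  .ite (.natEq (.get 13 (.succ (.get 11 (natVar 31)))) (.const 0))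
    (copyNode (.get 11 (natVar 31)))
    (.ite (.natEq (.get 13 (.get 11 (natVar 31))) (.const 0))
      (copyNode (.succ (.get 11 (natVar 31))))
      (.ite (.realLe (.get 2 (.get 11 (natVar 31))) (.get 2 (.succ (.get 11 (natVar 31)))))
        (copyNode (.get 11 (natVar 31)))
        (copyNode (.succ (.get 11 (natVar 31))))))

/-- Recompute the ancestors of the current node. -/
def siftUp : Cmd :=
  .loop (.not (.natLe (natVar 31) (.const 1)))
    (.seq (.setNat 31 (.const 0) (.get 12 (natVar 31))) pullNode)

/-- The tables of children and parents are correct. -/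
def HeapTables (n : ℕ) (μ : Memory) : Prop :=
  (∀ i, 1 ≤ i → i < n → μ.nat 11 i = 2 * i) ∧ ∀ i, 2 ≤ i → i < 2 * n → μ.nat 12 i = i / 2

/-- The node `i` is the better one of its children. -/
structure NodeOK (win : ℕ → ℕ) (nk : ℕ → ℝ) (i : ℕ) : Prop where
  le : ∀ c, c = 2 * i ∨ c = 2 * i + 1 → win c ≠ 0 → win i ≠ 0 ∧ nk i ≤ nk c
  exists_eq : win i ≠ 0 → ∃ c, (c = 2 * i ∨ c = 2 * i + 1) ∧ win c = win i ∧ nk c = nk i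

/-- One criterion for all branches of `pullNode`: `c` is the child that was copied and `c'` its
sibling, which must be empty or no better. -/
theorem NodeOK.of_copy {win : ℕ → ℕ} {nk : ℕ → ℝ} {i c c' : ℕ}
    (hc : c = 2 * i ∧ c' = 2 * i + 1 ∨ c = 2 * i + 1 ∧ c' = 2 * i) (h1 : win i = win c)
    (h2 : nk i = nk c) (h3 : win c' ≠ 0 → win c ≠ 0 ∧ nk c ≤ nk c') : NodeOK win nk i where
  le := by
    have hc' : ∀ x, x = 2 * i ∨ x = 2 * i + 1 → x = c ∨ x = c' := by omega
    intro x hx hw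
    rcases hc' x hx with rfl | rfl
    · exact ⟨h1 ▸ hw, h2.le⟩
    · exact ⟨h1 ▸ (h3 hw).1, h2 ▸ (h3 hw).2⟩
  exists_eq _ := ⟨c, by omega, h1.symm, h2.symm⟩

theorem NodeOK.congr {win win' : ℕ → ℕ} {nk nk' : ℕ → ℝ} {i : ℕ} (h : NodeOK win nk i)
    (hw : ∀ j, j = i ∨ j = 2 * i ∨ j = 2 * i + 1 → win' j = win j ∧ nk' j = nk j) :
    NodeOK win' nk' i where
  le c hc hwc := by
    rw [(hw c (Or.inr hc)).1] at hwc
    rw [(hw i (Or.inl rfl)).1, (hw i (Or.inl rfl)).2, (hw c (Or.inr hc)).2]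
    exact h.le c hc hwc
  exists_eq hi := by
    rw [(hw i (Or.inl rfl)).1] at hi
    obtain ⟨c, hc, h1, h2⟩ := h.exists_eq hi
    refine ⟨c, hc, ?_, ?_⟩
    · rw [(hw c (Or.inr hc)).1, h1, (hw i (Or.inl rfl)).1]
    · rw [(hw c (Or.inr hc)).2, h2, (hw i (Or.inl rfl)).2]

/-- The index `x` is evaluated again after the first assignment, which writes to array 13; `hx` says
that this does not change it. -/
theorem ensures_copyNode {x : NatExp} {μ : Memory} {p c : ℕ} (hp : μ.nat 31 0 = p)
    (hx : ∀ y, x.eval (μ.setNat 13 p y) = c) (hx' : x.eval μ = c) :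
    Ensures (copyNode x) μ fun t μ' => t = 2 ∧ ChangesOnly [13] [2] μ μ' ∧
      (∀ j, j ≠ p → μ'.nat 13 j = μ.nat 13 j ∧ μ'.real 2 j = μ.real 2 j) ∧
      μ'.nat 13 p = μ.nat 13 c ∧ μ'.real 2 p = μ.real 2 c := by
  simp only [copyNode, ensures_seq, ensures_setNat, ensures_setReal, NatExp.eval, RealExp.eval, hp,
    hx', Memory.nat_setNat, Memory.real_setNat, Memory.nat_setReal, Memory.real_setReal, hx]
  refine ⟨trivial, ((ChangesOnly.refl _ _ _).setNat (by simp) _ _).setReal (by simp) _ _,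
    fun j hj => ?_, ?_, ?_⟩ <;> simp [*]

theorem ensures_pullNode {p : ℕ} {μ : Memory} (hp : μ.nat 31 0 = p)
    (hc : μ.nat 11 p = 2 * p) (hp1 : 1 ≤ p) :
    Ensures pullNode μ fun t μ' => t ≤ 5 ∧ ChangesOnly [13] [2] μ μ' ∧
      (∀ j, j ≠ p → μ'.nat 13 j = μ.nat 13 j ∧ μ'.real 2 j = μ.real 2 j) ∧
      NodeOK (μ'.nat 13) (μ'.real 2) p := by
  have hl := ensures_copyNode (x := .get 11 (natVar 31)) (c := 2 * p) hp
    (by simp [NatExp.eval, Memory.nat_setNat, hp, hc]) (by simp [NatExp.eval, hp, hc])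
  have hr := ensures_copyNode (x := .succ (.get 11 (natVar 31))) (c := 2 * p + 1) hp
    (by simp [NatExp.eval, Memory.nat_setNat, hp, hc]) (by simp [NatExp.eval, hp, hc])
  have hne : 2 * p ≠ p ∧ 2 * p + 1 ≠ p := by omega
  simp only [pullNode, ensures_ite, Test.Holds, NatExp.eval, RealExp.eval, hp, hc]
  refine ⟨fun h => hl.mono ?_, fun h => ⟨fun h' => hr.mono ?_, fun h' => ⟨fun h'' => hl.mono ?_,
    fun h'' => hr.mono ?_⟩⟩⟩
  all_goals
    rintro t μ' ⟨rfl, h1, h2, h3, h4⟩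
    refine ⟨by norm_num, h1, h2, ?_⟩
    have e1 := h2 _ hne.1
    have e2 := h2 _ hne.2
  · refine NodeOK.of_copy (Or.inl ⟨rfl, rfl⟩) ?_ ?_ ?_ <;> simp [*]
  · refine NodeOK.of_copy (Or.inr ⟨rfl, rfl⟩) ?_ ?_ ?_ <;> simp [*]
  · refine NodeOK.of_copy (Or.inl ⟨rfl, rfl⟩) ?_ ?_ ?_ <;> simp [*]
  · refine NodeOK.of_copy (Or.inr ⟨rfl, rfl⟩) ?_ ?_ ?_ <;> simp [*, le_of_not_ge h'']

/-- Only the parent of the current node may be wrong. Recomputing it moves the possible fault one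
level up, until the current node is the root. Each level costs a test, an assignment and at most
five steps of `pullNode`. -/
theorem ensures_siftUp {n p : ℕ} {μ : Memory} (ht : HeapTables n μ) (hp : μ.nat 31 0 = p)
    (hp1 : 1 ≤ p) (hpn : p < 2 * n)
    (hOK : ∀ i, 1 ≤ i → i < n → i ≠ p / 2 → NodeOK (μ.nat 13) (μ.real 2) i) :
    Ensures siftUp μ fun t μ' => t ≤ 7 * Nat.log 2 p + 1 ∧ ChangesOnly [13, 31] [2] μ μ' ∧
      (∀ i, 1 ≤ i → i < n → NodeOK (μ'.nat 13) (μ'.real 2) i) ∧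
      ∀ i, n ≤ i → μ'.nat 13 i = μ.nat 13 i ∧ μ'.real 2 i = μ.real 2 i := by
  refine (Ensures.loop (fun μ' φ => ChangesOnly [13, 31] [2] μ μ' ∧
    (∀ i, n ≤ i → μ'.nat 13 i = μ.nat 13 i ∧ μ'.real 2 i = μ.real 2 i) ∧
    ∃ p, μ'.nat 31 0 = p ∧ 1 ≤ p ∧ p < 2 * n ∧ φ = 7 * Nat.log 2 p ∧
      ∀ i, 1 ≤ i → i < n → i ≠ p / 2 → NodeOK (μ'.nat 13) (μ'.real 2) i) ?_
    ⟨ChangesOnly.refl _ _ _, fun _ _ => ⟨rfl, rfl⟩, p, hp, hp1, hpn, rfl, hOK⟩).mono ?_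
  · rintro μ' φ ⟨hch, hleaf, p, hp, hp1, hpn, rfl, hOK⟩ hb
    simp only [Test.Holds, NatExp.eval, hp] at hb
    have h12 : μ'.nat 12 p = p / 2 := by
      rw [hch.1 12 (by simp)]
      exact ht.2 p (by omega) hpn
    have h11 : μ'.nat 11 (p / 2) = 2 * (p / 2) := by
      rw [hch.1 11 (by simp)]
      exact ht.1 _ (by omega) (by omega)
    simp only [ensures_seq, ensures_setNat, NatExp.eval, hp, h12]
    refine (ensures_pullNode (p := p / 2) (by simp [Memory.nat_setNat])
      (by simp [Memory.nat_setNat, h11]) (by omega)).mono ?_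
    rintro t μ'' ⟨ht', hch', hoth, hnode⟩
    have hch1 : ChangesOnly [13, 31] [2] μ μ'' :=
      (hch.setNat (by simp) _ _).trans (hch'.mono (by simp) (by simp))
    have hoth' : ∀ j, j ≠ p / 2 → μ''.nat 13 j = μ'.nat 13 j ∧ μ''.real 2 j = μ'.real 2 j := by
      intro j hj
      have := hoth j hj
      simpa [Memory.nat_setNat, Memory.real_setNat] using this
    refine ⟨_, ⟨hch1, fun i hi => ?_, p / 2, ?_, by omega, by omega, rfl, fun i hi1 hin hip => ?_⟩, ?_⟩
    · obtain ⟨h1, h2⟩ := hoth' i (by omega)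
      rw [h1, h2]
      exact hleaf i hi
    · rw [hch'.1 31 (by simp)]
      simp [Memory.nat_setNat]
    · by_cases hi : i = p / 2
      · rw [hi]
        exact hnode
      · refine (hOK i hi1 hin hi).congr fun j hj => hoth' j (by omega)
    · have h1 := Nat.log_div_base 2 p
      have h2 := Nat.log_pos (b := 2) (n := p) (by norm_num) (by omega)
      omega
  · rintro t μ' ⟨φ, ⟨hch, hleaf, p, hp, hp1, hpn, rfl, hOK⟩, hb, hle⟩
    simp only [Test.Holds, NatExp.eval, hp, not_not] at hb
    exact ⟨by omega, hch, fun i hi hin => hOK i hi hin (by omega), hleaf⟩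

/-- The root of the tournament tree is the best leaf. -/
theorem heap_root_le {win : ℕ → ℕ} {nk : ℕ → ℝ} {n : ℕ}
    (hOK : ∀ i, 1 ≤ i → i < n → NodeOK win nk i) :
    ∀ i, 1 ≤ i → i < 2 * n → win i ≠ 0 → win 1 ≠ 0 ∧ nk 1 ≤ nk i := by
  intro i
  induction i using Nat.strong_induction_on with
  | _ i ih =>
    intro hi hin hw
    by_cases h1 : i = 1
    · subst h1
      exact ⟨hw, le_rfl⟩
    · obtain ⟨h2, h3⟩ := (hOK (i / 2) (by omega) (by omega)).le i (by omega) hw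
      obtain ⟨h4, h5⟩ := ih (i / 2) (by omega) (by omega) (by omega) h2
      exact ⟨h4, h5.trans h3⟩

/-- Following the child that supplied the winner leads down to a leaf. Any `n` works, as the nodes
below `n` have both children below `2 * n`. -/
theorem heap_exists_leaf {win : ℕ → ℕ} {nk : ℕ → ℝ} {n : ℕ}
    (hOK : ∀ i, 1 ≤ i → i < n → NodeOK win nk i) :
    ∀ d i, 2 * n - i = d → 1 ≤ i → i < 2 * n → win i ≠ 0 →
      ∃ j, n ≤ j ∧ j < 2 * n ∧ win j = win i ∧ nk j = nk i := by
  intro d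
  induction d using Nat.strong_induction_on with
  | _ d ih =>
    intro i hd hi hin hw
    by_cases h1 : n ≤ i
    · exact ⟨i, h1, hin, rfl, rfl⟩
    · obtain ⟨c, hc, h2, h3⟩ := (hOK i hi (by omega)).exists_eq hw
      obtain ⟨j, hj, hj', h4, h5⟩ := ih (2 * n - c) (by omega) c rfl (by omega) (by omega)
        (by rwa [h2])
      exact ⟨j, hj, hj', h4.trans h2, h5.trans h3⟩

/-- A bound for the running time of `siftUp`. -/
def siftTime (n : ℕ) : ℕ := 7 * Nat.log 2 (2 * n) + 1

/-- Recompute the ancestors of the leaf of the vertex `x`. -/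
def updateLeaf (x : NatExp) : Cmd := .seq (.setNat 31 (.const 0) (.get 19 x)) siftUp

/-- `win` and `nk` are the tree before the leaf of `v` was overwritten. The tree was consistent
then, so at most the parent of that leaf is wrong now. -/
theorem ensures_updateLeaf {n : ℕ} {v : ℕ} (hv : v < n) {win : ℕ → ℕ} {nk : ℕ → ℝ} {μ : Memory}
    (ht : HeapTables n μ) (hl : μ.nat 19 v = n + v) {x : NatExp} (hx : x.eval μ = v)
    (h0 : ∀ i, 1 ≤ i → i < n → NodeOK win nk i)
    (hd : ∀ j, j ≠ n + v → μ.nat 13 j = win j ∧ μ.real 2 j = nk j) :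
    Ensures (updateLeaf x) μ fun t μ' => t ≤ siftTime n + 1 ∧ ChangesOnly [13, 31] [2] μ μ' ∧
      (∀ i, 1 ≤ i → i < n → NodeOK (μ'.nat 13) (μ'.real 2) i) ∧
      ∀ i, n ≤ i → μ'.nat 13 i = μ.nat 13 i ∧ μ'.real 2 i = μ.real 2 i := by
  rw [updateLeaf, ensures_seq, ensures_setNat]
  simp only [NatExp.eval, hx, hl]
  refine (ensures_siftUp (n := n) (p := n + v) ?_ (by simp [Memory.nat_setNat]) (by omega)
    (by omega) fun i hi hin hip => ?_).mono ?_
  · exact ⟨by simpa [Memory.nat_setNat] using ht.1, by simpa [Memory.nat_setNat] using ht.2⟩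
  · refine (h0 i hi hin).congr fun j hj => ?_
    have := hd j (by omega)
    simpa [Memory.nat_setNat, Memory.real_setNat] using this
  · rintro t μ' ⟨h1, h2, h3, h4⟩
    refine ⟨?_, ((ChangesOnly.refl _ _ _).setNat (by simp) _ _).trans h2, h3, fun i hi => ?_⟩
    · have : Nat.log 2 (n + v) ≤ Nat.log 2 (2 * n) := Nat.log_mono_right (by omega)
      unfold siftTime
      omega
    · simpa [Memory.nat_setNat, Memory.real_setNat] using h4 i hi

end Heap

/-! ### Best-first search on the machine: scanning and relaxation -/

section SearchProgram

/-- The list `l` of numbers is linked by `next`, starting at `x`. -/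
def IsLinked (next : ℕ → ℕ) : ℕ → List ℕ → Prop
  | x, [] => x = 0
  | x, h :: l => x = h + 1 ∧ IsLinked next (next h) l

/-- The list `l`, latest first, is stored in the array `o`. -/
def IsStored {n : ℕ} (o : ℕ → ℕ) : List (Fin n) → Prop
  | [] => True
  | v :: l => o l.length = v ∧ IsStored o l

theorem IsStored.congr {n : ℕ} {o o' : ℕ → ℕ} {l : List (Fin n)} (h : IsStored o l)
    (ho : ∀ i < l.length, o' i = o i) : IsStored o' l := by
  induction l with
  | nil => trivial
  | cons v l ih =>
    rw [List.length_cons] at ho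
    exact ⟨(ho _ (by omega)).trans h.1, ih h.2 fun i hi => ho i (by omega)⟩

/-- The tables that describe the graph. -/
structure GraphTables (n N : ℕ) (tl hd : ℕ → Fin n) (μ : Memory) : Prop where
  size : μ.nat 0 0 = n
  tail : ∀ h < N, μ.nat 6 h = tl h
  head : ∀ h < N, μ.nat 7 h = hd h
  edge : ∀ h < N, μ.nat 8 h = h / 2
  lists : ∀ v : Fin n, ∃ l, IsLinked (μ.nat 10) (μ.nat 9 v) l ∧ l.Nodup ∧
    ∀ h, h ∈ l ↔ h < N ∧ tl h = v
  heap : HeapTables n μ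
  leaf : ∀ v, v < n → μ.nat 19 v = n + v

theorem GraphTables.congr {n N : ℕ} {tl hd : ℕ → Fin n} {μ μ' : Memory}
    (h : GraphTables n N tl hd μ)
    (hμ : ∀ a ∈ [0, 6, 7, 8, 9, 10, 11, 12, 19], μ'.nat a = μ.nat a) :
    GraphTables n N tl hd μ' where
  size := by rw [hμ 0 (by simp)]; exact h.size
  tail := by rw [hμ 6 (by simp)]; exact h.tail
  head := by rw [hμ 7 (by simp)]; exact h.head
  edge := by rw [hμ 8 (by simp)]; exact h.edge
  lists := by rw [hμ 9 (by simp), hμ 10 (by simp)]; exact h.lists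
  heap := by
    unfold HeapTables
    rw [hμ 11 (by simp), hμ 12 (by simp)]
    exact h.heap
  leaf := by rw [hμ 19 (by simp)]; exact h.leaf

/-- The input of the search program. -/
structure SearchInput {n : ℕ} (D : SearchProblem (Fin n)) (μ : Memory) : Prop where
  tables : GraphTables n D.arcs D.tail D.head μ
  flag : μ.real 5 0 = D.flag
  cost : ∀ h < D.arcs, μ.real 6 (h / 2) = D.cost h
  source : ∀ v : Fin n, μ.nat 20 v ≠ 0 ↔ D.source v

/-- The memory that the search program changes. -/
abbrev SearchChanges : Memory → Memory → Prop :=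
  ChangesOnly [13, 14, 15, 16, 30, 31, 32, 33, 34, 35, 36] [2, 3, 8]

theorem SearchInput.congr {n : ℕ} {D : SearchProblem (Fin n)} {μ μ' : Memory}
    (h : SearchInput D μ) (hμ : SearchChanges μ μ') : SearchInput D μ' where
  tables := h.tables.congr fun a ha => hμ.1 a (by
    simp only [List.mem_cons, List.not_mem_nil, or_false] at ha
    rcases ha with rfl | rfl | rfl | rfl | rfl | rfl | rfl | rfl | rfl <;> simp)
  flag := by rw [hμ.2 5 (by simp)]; exact h.flag
  cost := by rw [hμ.2 6 (by simp)]; exact h.cost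
  source := by rw [hμ.1 20 (by simp)]; exact h.source

/-- The memory during the search. -/
structure SearchState {n : ℕ} (D : SearchProblem (Fin n)) (L : List (Fin n)) (pending : ℕ → Prop)
    (μ : Memory) : Prop where
  node : ∀ i, 1 ≤ i → i < n → NodeOK (μ.nat 13) (μ.real 2) i
  leaf : ∀ v : Fin n, μ.nat 13 (n + v) ≠ 0 →
    μ.nat 13 (n + v) = v + 1 ∧ μ.real 2 (n + v) = μ.real 3 v
  inv : D.Invariant (fun v => μ.real 3 v) (fun v => μ.nat 15 v) L
    (fun v => μ.nat 13 (n + v) ≠ 0) pending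
  done : ∀ v : Fin n, μ.nat 14 v ≠ 0 ↔ v ∈ L
  order : IsStored (μ.nat 16) L
  count : μ.nat 32 0 = L.length

/-- Scan the next vertex. -/
def popVertex : Cmd :=
  .seq (.setNat 33 (.const 0) (.pred (.get 13 (.const 1))))
  (.seq (.setNat 16 (natVar 32) (natVar 33))
  (.seq (.setNat 32 (.const 0) (.succ (natVar 32)))
  (.seq (.setNat 14 (natVar 33) (.const 1))
  (.seq (.setNat 34 (.const 0) (.get 9 (natVar 33)))
  (.seq (.setNat 13 (.get 19 (natVar 33)) (.const 0))
  (updateLeaf (natVar 33)))))))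

/-- The winner at the root comes from some leaf, which identifies the scanned vertex, and is minimal
among all leaves, as `Invariant.pop` requires. Emptying the leaf removes the vertex from the queue.
-/
theorem ensures_popVertex {n : ℕ} {D : SearchProblem (Fin n)} {L : List (Fin n)} {μ : Memory}
    (hI : SearchInput D μ) (hS : SearchState D L (fun _ => False) μ) (h1 : μ.nat 13 1 ≠ 0)
    (hn : 0 < n) :
    Ensures popVertex μ fun t μ' => t ≤ siftTime n + 7 ∧ SearchChanges μ μ' ∧
      ∃ u : Fin n, u ∉ L ∧ μ'.nat 33 0 = u ∧ μ'.nat 34 0 = μ.nat 9 u ∧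
        SearchState D (u :: L) (fun a => D.tail a = u) μ' := by
  obtain ⟨j, hj, hjn, hj1, hj2⟩ := heap_exists_leaf hS.node _ 1 rfl le_rfl (by omega) h1
  obtain ⟨u, rfl⟩ : ∃ u : Fin n, j = n + u := ⟨⟨j - n, by omega⟩, by simp; omega⟩
  obtain ⟨hw, hk⟩ := hS.leaf u (by rwa [hj1])
  have hu : μ.nat 13 1 = u + 1 := by rw [← hj1, hw]
  have hleaf := hI.tables.leaf u u.2
  have huL := hS.inv.queue_notMem u (by rwa [hj1])
  have hmin : ∀ v : Fin n, μ.nat 13 (n + v) ≠ 0 → μ.real 3 u ≤ μ.real 3 v := by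
    intro v hv
    rw [← hk, hj2, ← (hS.leaf v hv).2]
    exact (heap_root_le hS.node _ (by omega) (by omega) hv).2
  simp only [popVertex, ensures_seq, ensures_setNat, NatExp.eval, Memory.nat_setNat, hu,
    Nat.add_sub_cancel]
  simp only [Nat.reduceEqDiff, false_and, and_self, if_true, if_false, hleaf, hS.count]
  generalize hμ1 : Memory.setNat _ 13 (n + u) 0 = μ1
  have hch : SearchChanges μ μ1 := by
    rw [← hμ1]
    exact ((((((ChangesOnly.refl _ _ _).setNat (by simp) _ _).setNat (by simp) _ _).setNat
      (by simp) _ _).setNat (by simp) _ _).setNat (by simp) _ _).setNat (by simp) _ _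
  have e33 : μ1.nat 33 0 = u := by simp [← hμ1, Memory.nat_setNat]
  have e34 : μ1.nat 34 0 = μ.nat 9 u := by simp [← hμ1, Memory.nat_setNat]
  have e32 : μ1.nat 32 0 = L.length + 1 := by simp [← hμ1, Memory.nat_setNat]
  have e14 : ∀ j, μ1.nat 14 j = if j = u then 1 else μ.nat 14 j := by
    simp [← hμ1, Memory.nat_setNat]
  have e16 : ∀ j, μ1.nat 16 j = if j = L.length then (u : ℕ) else μ.nat 16 j := by
    simp [← hμ1, Memory.nat_setNat]
  have e13 : ∀ j, μ1.nat 13 j = if j = n + u then 0 else μ.nat 13 j := by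
    simp [← hμ1, Memory.nat_setNat]
  have e15 : μ1.nat 15 = μ.nat 15 := by
    ext j; simp [← hμ1, Memory.nat_setNat]
  have er : μ1.real = μ.real := by rw [← hμ1]; rfl
  have hI1 := hI.congr hch
  refine (ensures_updateLeaf u.2 hI1.tables.heap (hI1.tables.leaf u u.2)
    (by simp [NatExp.eval, e33]) hS.node fun j hj => ?_).mono ?_
  · rw [e13, if_neg hj, er]
    exact ⟨rfl, rfl⟩
  rintro t μ2 ⟨ht, hch2, hnode2, hleaf2⟩
  have e13' : ∀ v : Fin n, μ2.nat 13 (n + v) = if v = u then 0 else μ.nat 13 (n + v) := by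
    intro v
    rw [(hleaf2 (n + v) (by omega)).1, e13]
    simp [Fin.ext_iff]
  have e2' : ∀ v : Fin n, μ2.real 2 (n + v) = μ.real 2 (n + v) := by
    intro v
    rw [(hleaf2 (n + v) (by omega)).2, er]
  have e3' : μ2.real 3 = μ.real 3 := by rw [hch2.2 3 (by simp), er]
  refine ⟨by omega, hch.trans (hch2.mono (by simp) (by simp)), u, huL, ?_, ?_, hnode2, ?_, ?_, ?_,
    ?_, ?_⟩
  · rw [hch2.1 33 (by simp), e33]
  · rw [hch2.1 34 (by simp), e34]
  · intro v hv
    rw [e13'] at hv ⊢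
    by_cases hvu : v = u
    · simp [hvu] at hv
    · rw [if_neg hvu] at hv ⊢
      rw [e2', e3']
      exact hS.leaf v hv
  · rw [e3', hch2.1 15 (by simp), e15]
    refine hS.inv.pop (by rwa [hj1]) hmin (fun v => ?_) fun a _ ha => ha
    rw [e13']
    by_cases hvu : v = u <;> simp [hvu]
  · intro v
    rw [hch2.1 14 (by simp), e14, List.mem_cons, ← hS.done v]
    by_cases hvu : v = u
    · simp [hvu]
    · simp [hvu, Fin.val_inj]
  · rw [hch2.1 16 (by simp)]
    refine ⟨by rw [e16, if_pos rfl], hS.order.congr fun i hi => ?_⟩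
    rw [e16, if_neg (by omega)]
  · rw [hch2.1 32 (by simp), e32, List.length_cons]

/-- Enter the new key of the head of the current arc. -/
def improveKey : Cmd :=
  .seq (.setReal 3 (natVar 35) (realVar 8))
  (.seq (.setNat 15 (natVar 35) (.succ (natVar 36)))
  (.seq (.setNat 13 (.get 19 (natVar 35)) (.succ (natVar 35)))
  (.seq (.setReal 2 (.get 19 (natVar 35)) (realVar 8))
  (updateLeaf (natVar 35)))))

/-- Relax the next arc of the list and go on to the one after it. -/
def relaxArc : Cmd :=
  .seq (.setNat 36 (.const 0) (.pred (natVar 34)))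
  (.seq (.setNat 35 (.const 0) (.get 7 (natVar 36)))
  (.seq (.setReal 8 (.const 0) (.add (.mul (realVar 5) (.get 3 (natVar 33)))
    (.get 6 (.get 8 (natVar 36)))))
  (.seq (.ite (.natEq (.get 14 (natVar 35)) (.const 0))
    (.ite (.and (.not (.natEq (.get 13 (.get 19 (natVar 35))) (.const 0)))
        (.realLe (.get 3 (natVar 35)) (realVar 8))) .skip improveKey) .skip)
  (.setNat 34 (.const 0) (.get 10 (natVar 36))))))

theorem SearchState.congr_of_scalars {n : ℕ} {D : SearchProblem (Fin n)} {L : List (Fin n)}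
    {pending : ℕ → Prop} {μ μ' : Memory} (hS : SearchState D L pending μ)
    (h : ChangesOnly [30, 31, 33, 34, 35, 36] [8] μ μ') : SearchState D L pending μ' where
  node := by rw [h.1 13 (by simp), h.2 2 (by simp)]; exact hS.node
  leaf := by rw [h.1 13 (by simp), h.2 2 (by simp), h.2 3 (by simp)]; exact hS.leaf
  inv := by rw [h.1 13 (by simp), h.2 3 (by simp), h.1 15 (by simp)]; exact hS.inv
  done := by rw [h.1 14 (by simp)]; exact hS.done
  order := by rw [h.1 16 (by simp)]; exact hS.order
  count := by rw [h.1 32 (by simp)]; exact hS.count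

theorem SearchState.skip {n : ℕ} {D : SearchProblem (Fin n)} {L : List (Fin n)}
    {pending pending' : ℕ → Prop} {μ : Memory} (hS : SearchState D L pending μ) {a : ℕ}
    (ha : D.head a ∈ L ∨ μ.nat 13 (n + D.head a) ≠ 0 ∧
      μ.real 3 (D.head a) ≤ D.arcKey (fun v => μ.real 3 v) a)
    (hpend : ∀ b, pending b → b = a ∨ pending' b) : SearchState D L pending' μ :=
  { hS with inv := hS.inv.skip ha hpend }

theorem ensures_improveKey {n : ℕ} {D : SearchProblem (Fin n)} {L : List (Fin n)}
    {pending pending' : ℕ → Prop} {μ : Memory} (hI : SearchInput D μ)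
    (hS : SearchState D L pending μ) {a : ℕ} (ha : a < D.arcs) (ht : D.tail a ∈ L)
    (hh : D.head a ∉ L) (h35 : μ.nat 35 0 = D.head a) (h36 : μ.nat 36 0 = a)
    (h8 : μ.real 8 0 = D.arcKey (fun v => μ.real 3 v) a)
    (hlt : μ.nat 13 (n + D.head a) ≠ 0 → D.arcKey (fun v => μ.real 3 v) a < μ.real 3 (D.head a))
    (hpend : ∀ b, pending b → b = a ∨ pending' b) :
    Ensures improveKey μ fun t μ' => t ≤ siftTime n + 5 ∧
      ChangesOnly [13, 15, 31] [2, 3] μ μ' ∧ SearchState D L pending' μ' := by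
  have hleaf := hI.tables.leaf (D.head a) (D.head a).2
  simp only [improveKey, ensures_seq, ensures_setNat, ensures_setReal, NatExp.eval, RealExp.eval,
    Memory.nat_setNat, Memory.real_setNat, Memory.nat_setReal, Memory.real_setReal, h35, h36]
  simp only [Nat.reduceEqDiff, false_and, if_false, hleaf, h8]
  generalize hμ1 : Memory.setReal _ 2 (n + (D.head a : ℕ)) _ = μ1
  have hch : ChangesOnly [13, 15, 31] [2, 3] μ μ1 := by
    rw [← hμ1]
    exact ((((ChangesOnly.refl _ _ _).setReal (by simp) _ _).setNat (by simp) _ _).setNat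
      (by simp) _ _).setReal (by simp) _ _
  have e13 : ∀ j, μ1.nat 13 j = if j = n + D.head a then (D.head a + 1 : ℕ) else μ.nat 13 j := by
    simp [← hμ1, Memory.nat_setNat, Memory.nat_setReal]
  have e15 : ∀ j, μ1.nat 15 j = if j = D.head a then a + 1 else μ.nat 15 j := by
    simp [← hμ1, Memory.nat_setNat, Memory.nat_setReal]
  have e2 : ∀ j, μ1.real 2 j =
      if j = n + D.head a then D.arcKey (fun v => μ.real 3 v) a else μ.real 2 j := by
    simp [← hμ1, Memory.real_setNat, Memory.real_setReal]
  have e3 : ∀ j, μ1.real 3 j =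
      if j = D.head a then D.arcKey (fun v => μ.real 3 v) a else μ.real 3 j := by
    simp [← hμ1, Memory.real_setNat, Memory.real_setReal]
  have hI1 := hI.congr (hch.mono (by simp) (by simp))
  refine (ensures_updateLeaf (D.head a).2 hI1.tables.heap (hI1.tables.leaf _ (D.head a).2)
    (by simp [NatExp.eval, hch.1 35, h35]) hS.node fun j hj => ?_).mono ?_
  · rw [e13, e2, if_neg hj, if_neg hj]
    exact ⟨rfl, rfl⟩
  rintro t μ2 ⟨ht2, hch2, hnode2, hleaf2⟩
  have e13' : ∀ v : Fin n, μ2.nat 13 (n + v) =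
      if v = D.head a then (D.head a + 1 : ℕ) else μ.nat 13 (n + v) := by
    intro v
    rw [(hleaf2 (n + v) (by omega)).1, e13]
    simp [Fin.ext_iff]
  have e2' : ∀ v : Fin n, μ2.real 2 (n + v) =
      if v = D.head a then D.arcKey (fun v => μ.real 3 v) a else μ.real 2 (n + v) := by
    intro v
    rw [(hleaf2 (n + v) (by omega)).2, e2]
    simp [Fin.ext_iff]
  have e3' : ∀ v : Fin n, μ2.real 3 v =
      if v = D.head a then D.arcKey (fun v => μ.real 3 v) a else μ.real 3 v := by
    intro v
    rw [hch2.2 3 (by simp), e3]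
    simp [Fin.ext_iff]
  refine ⟨by omega, hch.trans (hch2.mono (by simp) (by simp)), hnode2, ?_, ?_, ?_, ?_, ?_⟩
  · intro v hv
    rw [e13'] at hv
    rw [e13', e2', e3']
    by_cases hva : v = D.head a
    · simp [hva]
    · rw [if_neg hva] at hv
      rw [if_neg hva, if_neg hva, if_neg hva]
      exact hS.leaf v hv
  · refine hS.inv.relax ha ht hh hlt e3' (fun v => ?_) (fun v => ?_) hpend
    · rw [hch2.1 15 (by simp), e15]
      simp [Fin.ext_iff]
    · rw [e13']
      by_cases hva : v = D.head a <;> simp [hva]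
  · rw [hch2.1 14 (by simp), hch.1 14 (by simp)]
    exact hS.done
  · rw [hch2.1 16 (by simp), hch.1 16 (by simp)]
    exact hS.order
  · rw [hch2.1 32 (by simp), hch.1 32 (by simp)]
    exact hS.count

theorem ensures_relaxArc {n : ℕ} {D : SearchProblem (Fin n)} {L : List (Fin n)}
    {pending pending' : ℕ → Prop} {μ : Memory} (hI : SearchInput D μ)
    (hS : SearchState D L pending μ) {a : ℕ} (ha : a < D.arcs) (ht : D.tail a ∈ L)
    (h33 : μ.nat 33 0 = D.tail a) (h34 : μ.nat 34 0 = a + 1)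
    (hpend : ∀ b, pending b → b = a ∨ pending' b) :
    Ensures relaxArc μ fun t μ' => t ≤ siftTime n + 11 ∧ SearchChanges μ μ' ∧
      μ'.nat 33 0 = D.tail a ∧ μ'.nat 34 0 = μ.nat 10 a ∧ SearchState D L pending' μ' := by
  have hhead := hI.tables.head a ha
  have hedge := hI.tables.edge a ha
  have hcost := hI.cost a ha
  simp only [relaxArc, ensures_seq, ensures_setNat, ensures_setReal, NatExp.eval, RealExp.eval,
    Memory.nat_setNat, Memory.real_setNat, h33, h34,
    Nat.add_sub_cancel]
  simp only [Nat.reduceEqDiff, false_and, if_false, and_self, if_true, hhead, hedge, hcost,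
    hI.flag]
  generalize hμ1 : Memory.setReal _ 8 0 _ = μ1
  have hch1 : ChangesOnly [30, 31, 33, 34, 35, 36] [8] μ μ1 := by
    rw [← hμ1]
    exact (((ChangesOnly.refl _ _ _).setNat (by simp) _ _).setNat (by simp) _ _).setReal
      (by simp) _ _
  have e33 : μ1.nat 33 0 = D.tail a := by simp [← hμ1, Memory.nat_setNat, Memory.nat_setReal, h33]
  have e35 : μ1.nat 35 0 = D.head a := by simp [← hμ1, Memory.nat_setNat, Memory.nat_setReal]
  have e36 : μ1.nat 36 0 = a := by simp [← hμ1, Memory.nat_setNat, Memory.nat_setReal]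
  have e3 : μ1.real 3 = μ.real 3 := hch1.2 3 (by simp)
  have e8 : μ1.real 8 0 = D.arcKey (fun v => μ1.real 3 v) a := by
    rw [e3]
    simp [← hμ1, Memory.real_setReal, SearchProblem.arcKey]
  have hchS : SearchChanges μ μ1 := hch1.mono (by simp) (by simp)
  have hI1 := hI.congr hchS
  have hS1 := hS.congr_of_scalars hch1
  have hleaf := hI1.tables.leaf (D.head a) (D.head a).2
  -- All three outcomes of the tests end with the same advance to the next arc of the list.
  have hfin : ∀ t μ2, t ≤ siftTime n + 7 → ChangesOnly [13, 15, 31] [2, 3] μ1 μ2 →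
      SearchState D L pending' μ2 →
      1 + (1 + (1 + (t + 1))) ≤ siftTime n + 11 ∧
      SearchChanges μ (μ2.setNat 34 0 (μ2.nat 10 (μ2.nat 36 0))) ∧
      (μ2.setNat 34 0 (μ2.nat 10 (μ2.nat 36 0))).nat 33 0 = D.tail a ∧
      (μ2.setNat 34 0 (μ2.nat 10 (μ2.nat 36 0))).nat 34 0 = μ.nat 10 a ∧
      SearchState D L pending' (μ2.setNat 34 0 (μ2.nat 10 (μ2.nat 36 0))) := by
    intro t μ2 ht2 hch2 hS2
    refine ⟨by omega, (hchS.trans (hch2.mono (by simp) (by simp))).setNat (by simp) _ _, ?_, ?_,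
      hS2.congr_of_scalars ((ChangesOnly.refl _ _ _).setNat (by simp) _ _)⟩
    · simp [Memory.nat_setNat, hch2.1 33, e33]
    · simp [Memory.nat_setNat, hch2.1 36, e36, hch2.1 10, hch1.1 10]
  simp only [ensures_ite, ensures_skip, Test.Holds, NatExp.eval, RealExp.eval, e35, hleaf]
  refine ⟨fun h14 => ⟨fun hle => ?_, fun hle => ?_⟩, fun h14 => ?_⟩
  · refine hfin _ _ (by omega) (ChangesOnly.refl _ _ _) (hS1.skip (Or.inr ⟨hle.1, ?_⟩) hpend)
    rw [← e8]
    exact hle.2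
  · refine (ensures_improveKey hI1 hS1 ha ht (fun hL => ?_) e35 e36 e8 (fun hQ => ?_)
      hpend).mono ?_
    · exact (hS1.done _).2 hL h14
    · rw [← e8]
      by_contra hcon
      exact hle ⟨hQ, not_lt.1 hcon⟩
    · rintro t μ2 ⟨h1, h2, h3⟩
      exact hfin _ _ (by omega) h2 h3
  · exact hfin _ _ (by omega) (ChangesOnly.refl _ _ _)
      (hS1.skip (Or.inl ((hS1.done _).1 h14)) hpend)

/-- Relax all arcs of the list. -/
def scanArcs : Cmd := .loop (.not (.natEq (natVar 34) (.const 0))) relaxArc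

theorem ensures_scanArcs {n : ℕ} {D : SearchProblem (Fin n)} {L : List (Fin n)} {μ : Memory}
    (hI : SearchInput D μ) {u : Fin n} (hS : SearchState D L (fun a => D.tail a = u) μ)
    (hu : u ∈ L) (h33 : μ.nat 33 0 = u) {l : List ℕ}
    (hl : IsLinked (μ.nat 10) (μ.nat 34 0) l) (hl' : ∀ h, h ∈ l ↔ h < D.arcs ∧ D.tail h = u) :
    Ensures scanArcs μ fun t μ' => t ≤ l.length * (siftTime n + 12) + 1 ∧ SearchChanges μ μ' ∧
      SearchState D L (fun _ => False) μ' := by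
  -- The pending arcs are exchanged for the rest of the linked list, which shrinks by one arc per
  -- pass and is empty at the end.
  have hS0 : SearchState D L (fun a => a ∈ l) μ :=
    { hS with
      inv := { hS.inv with
        arc := fun a ha hta hp hh => hS.inv.arc a ha hta (fun h => hp ((hl' a).2 ⟨ha, h⟩)) hh } }
  refine (Ensures.loop (fun μ' φ => SearchChanges μ μ' ∧ μ'.nat 33 0 = u ∧
    ∃ l, (∀ h ∈ l, h < D.arcs ∧ D.tail h = u) ∧ IsLinked (μ.nat 10) (μ'.nat 34 0) l ∧
      SearchState D L (fun a => a ∈ l) μ' ∧ φ = l.length * (siftTime n + 12)) ?_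
    ⟨ChangesOnly.refl _ _ _, h33, l, fun h hh => (hl' h).1 hh, hl, hS0, rfl⟩).mono ?_
  · rintro μ' φ ⟨hch, h33, l, hlu, hl, hSl, rfl⟩ hb
    simp only [Test.Holds, NatExp.eval] at hb
    cases l with
    | nil => exact absurd hl hb
    | cons a l =>
      obtain ⟨haN, rfl⟩ := hlu a List.mem_cons_self
      refine (ensures_relaxArc (hI.congr hch) hSl haN hu h33 hl.1 (pending' := fun b => b ∈ l)
        fun b hb => List.mem_cons.1 hb).mono ?_
      rintro t μ'' ⟨ht, hch', h33', h34', hS'⟩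
      refine ⟨_, ⟨hch.trans hch', h33', l, fun h hh => hlu h (List.mem_cons_of_mem _ hh), ?_, hS',
        rfl⟩, ?_⟩
      · rw [h34', hch.1 10 (by simp)]
        exact hl.2
      · rw [List.length_cons, add_mul]
        omega
  · rintro t μ' ⟨φ, ⟨hch, h33, l', -, hl', hS', rfl⟩, hb, hle⟩
    simp only [Test.Holds, NatExp.eval, not_not] at hb
    have hnil : l' = [] := by
      cases l' with
      | nil => rfl
      | cons a l' =>
        have := hl'.1
        omega
    subst hnil
    refine ⟨?_, hch, ?_⟩
    · simp only [List.length_nil, Nat.zero_mul, Nat.zero_add] at hle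
      exact hle
    · exact { hS' with
        inv := { hS'.inv with arc := fun a ha hta _ hh => hS'.inv.arc a ha hta (by simp) hh } }

/-- Scan vertices until the queue is empty. -/
def scanLoop : Cmd := .loop (.not (.natEq (.get 13 (.const 1)) (.const 0))) (.seq popVertex scanArcs)

-- The potential counts unscanned vertices and arcs with unscanned tail. A scan lowers the first by
-- one and the second by the number of arcs it relaxes, and each unit pays for one update of the
-- tournament tree.
open Classical in
theorem ensures_scanLoop {n : ℕ} {D : SearchProblem (Fin n)} {μ : Memory}
    (hI : SearchInput D μ) (hS : SearchState D [] (fun _ => False) μ) (hn : 0 < n) :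
    Ensures scanLoop μ fun t μ' => t ≤ (n + D.arcs) * (siftTime n + 12) + 1 ∧
      SearchChanges μ μ' ∧ ∃ L, SearchState D L (fun _ => False) μ' ∧
        ∀ v : Fin n, ¬ μ'.nat 13 (n + v) ≠ 0 := by
  refine (Ensures.loop (fun μ' φ => SearchChanges μ μ' ∧ ∃ L, SearchState D L (fun _ => False) μ' ∧
    φ = ((n - L.length) + ((Finset.range D.arcs).filter (D.tail · ∉ L)).card) *
      (siftTime n + 12)) ?_ ⟨ChangesOnly.refl _ _ _, [], hS, rfl⟩).mono ?_
  · rintro μ' φ ⟨hch, L, hS, rfl⟩ hb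
    simp only [Test.Holds, NatExp.eval] at hb
    have hI' := hI.congr hch
    rw [ensures_seq]
    refine (ensures_popVertex hI' hS hb hn).mono ?_
    rintro t1 μ1 ⟨ht1, hch1, u, huL, h33, h34, hS1⟩
    have hI1 := hI'.congr hch1
    obtain ⟨l, hl, hnd, hl'⟩ := hI1.tables.lists u
    refine (ensures_scanArcs hI1 hS1 List.mem_cons_self h33 (l := l) ?_ hl').mono ?_
    · rw [h34, ← hch1.1 9 (by simp)]
      exact hl
    rintro t2 μ2 ⟨ht2, hch2, hS2⟩
    refine ⟨_, ⟨(hch.trans hch1).trans hch2, u :: L, hS2, rfl⟩, ?_⟩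
    have hlen : L.length + 1 ≤ n := by
      have := (hS1.inv.trace.nodup).length_le_card
      simpa using this
    have hcard : ((Finset.range D.arcs).filter (D.tail · ∉ L)).card =
        ((Finset.range D.arcs).filter (D.tail · ∉ u :: L)).card + l.length := by
      rw [← List.toFinset_card_of_nodup hnd, ← Finset.card_union_of_disjoint]
      · congr 1
        ext h
        simp only [Finset.mem_filter, Finset.mem_range, Finset.mem_union, List.mem_toFinset, hl',
          List.mem_cons, not_or]
        constructor
        · rintro ⟨h1, h2⟩
          by_cases h3 : D.tail h = u
          · exact Or.inr ⟨h1, h3⟩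
          · exact Or.inl ⟨h1, h3, h2⟩
        · rintro (⟨h1, -, h2⟩ | ⟨h1, rfl⟩)
          · exact ⟨h1, h2⟩
          · exact ⟨h1, huL⟩
      · rw [Finset.disjoint_left]
        intro h h1 h2
        rw [List.mem_toFinset, hl'] at h2
        exact (Finset.mem_filter.1 h1).2 (by simp [h2.2])
    rw [hcard, List.length_cons]
    obtain ⟨d, hd⟩ : ∃ d, n = L.length + 1 + d := ⟨n - (L.length + 1), by omega⟩
    have h1 : n - L.length = d + 1 := by omega
    have h2 : n - (L.length + 1) = d := by omega
    rw [h1, h2]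
    have h3 : (d + 1 + (((Finset.range D.arcs).filter (D.tail · ∉ u :: L)).card + l.length)) *
        (siftTime n + 12) = (d + ((Finset.range D.arcs).filter (D.tail · ∉ u :: L)).card) *
        (siftTime n + 12) + l.length * (siftTime n + 12) + (siftTime n + 12) := by ring
    rw [h3]
    omega
  · rintro t μ' ⟨φ, ⟨hch, L, hS, rfl⟩, hb, hle⟩
    simp only [Test.Holds, NatExp.eval, not_not] at hb
    refine ⟨?_, hch, L, hS, fun v hv => ?_⟩
    · simp only [List.length_nil, Nat.sub_zero, List.not_mem_nil, not_false_eq_true,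
        Finset.filter_true, Finset.card_range] at hle
      omega
    · exact (heap_root_le hS.node _ (by omega) (by omega) hv).1 hb

end SearchProgram

/-! ### Best-first search on the machine: initialization and the whole search -/

section SearchProgram

/-- Clear the entries of the search for every vertex. -/
def clearSearch : Cmd :=
  forLoop 30 (natVar 0)
    (.seq (.setNat 14 (natVar 30) (.const 0))
    (.seq (.setNat 15 (natVar 30) (.const 0))
    (.seq (.setReal 3 (natVar 30) (.const 0))
    (.seq (.setNat 13 (natVar 30) (.const 0))
    (.setNat 13 (.get 19 (natVar 30)) (.const 0))))))

theorem ensures_clearSearch {n : ℕ} {D : SearchProblem (Fin n)} {μ : Memory}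
    (hI : SearchInput D μ) :
    Ensures clearSearch μ fun t μ' => t ≤ n * 7 + 2 ∧ SearchChanges μ μ' ∧
      ∀ j < n, μ'.nat 14 j = 0 ∧ μ'.nat 15 j = 0 ∧ μ'.real 3 j = 0 ∧ μ'.nat 13 j = 0 ∧
        μ'.nat 13 (n + j) = 0 := by
  refine (Ensures.forLoop (fun k μ' => SearchChanges μ μ' ∧ k ≤ n ∧ ∀ j < k, μ'.nat 14 j = 0 ∧
    μ'.nat 15 j = 0 ∧ μ'.real 3 j = 0 ∧ μ'.nat 13 j = 0 ∧ μ'.nat 13 (n + j) = 0) n 5 ?_ ?_ ?_).mono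
    fun t μ' h => ⟨h.1, h.2.1, h.2.2.2⟩
  · rintro k μ' ⟨h, -⟩
    simp only [NatExp.eval, h.1 0 (by simp)]
    exact hI.tables.size
  · exact ⟨(ChangesOnly.refl _ _ _).setNat (by simp) _ _, Nat.zero_le _, by simp⟩
  · rintro k μ' hk ⟨hch, -, hj⟩ h30
    have hleaf := (hI.congr hch).tables.leaf k hk
    simp only [ensures_seq, ensures_setNat, ensures_setReal, NatExp.eval, RealExp.eval,
      Memory.nat_setNat, Memory.real_setNat, Memory.nat_setReal, Memory.real_setReal, h30]
    simp only [Nat.reduceEqDiff, false_and, if_false, hleaf]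
    refine ⟨by norm_num, trivial, ?_, hk, fun j hjk => ?_⟩
    · exact (((((hch.setNat (by simp) _ _).setNat (by simp) _ _).setReal (by simp) _ _).setNat
        (by simp) _ _).setNat (by simp) _ _).setNat (by simp) _ _
    · simp only [true_and, Nat.cast_zero]
      by_cases hjk' : j = k
      · subst hjk'
        simp
      · have h1 : j < k := by omega
        have h2 : n + j ≠ k := by omega
        have h3 : j ≠ n + k := by omega
        simpa [hjk', h2, h3] using hj j h1

/-- Enter the sources into the queue. -/
def insertSources : Cmd :=
  forLoop 30 (natVar 0)
    (.ite (.natEq (.get 20 (natVar 30)) (.const 0)) .skip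
      (.seq (.setNat 13 (.get 19 (natVar 30)) (.succ (natVar 30)))
      (.seq (.setReal 2 (.get 19 (natVar 30)) (.const 0))
      (updateLeaf (natVar 30)))))

theorem ensures_insertSources {n : ℕ} {D : SearchProblem (Fin n)} {μ : Memory}
    (hI : SearchInput D μ) (h13 : ∀ j < n, μ.nat 13 j = 0 ∧ μ.nat 13 (n + j) = 0) :
    Ensures insertSources μ fun t μ' => t ≤ n * (siftTime n + 6) + 2 ∧
      ChangesOnly [13, 30, 31] [2] μ μ' ∧
      (∀ i, 1 ≤ i → i < n → NodeOK (μ'.nat 13) (μ'.real 2) i) ∧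
      ∀ j < n, (μ'.nat 13 (n + j) ≠ 0 ↔ μ.nat 20 j ≠ 0) ∧ (μ'.nat 13 (n + j) ≠ 0 →
        μ'.nat 13 (n + j) = j + 1 ∧ μ'.real 2 (n + j) = 0) := by
  refine (Ensures.forLoop (fun k μ' => ChangesOnly [13, 30, 31] [2] μ μ' ∧ k ≤ n ∧
    (∀ i, 1 ≤ i → i < n → NodeOK (μ'.nat 13) (μ'.real 2) i) ∧
    ∀ j < n, (μ'.nat 13 (n + j) ≠ 0 ↔ j < k ∧ μ.nat 20 j ≠ 0) ∧ (μ'.nat 13 (n + j) ≠ 0 →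
      μ'.nat 13 (n + j) = j + 1 ∧ μ'.real 2 (n + j) = 0)) n (siftTime n + 4) ?_ ?_ ?_).mono ?_
  · rintro k μ' ⟨h, -⟩
    simp only [NatExp.eval, h.1 0 (by simp)]
    exact hI.tables.size
  · have hz : ∀ i < 2 * n, μ.nat 13 i = 0 := by
      intro i hi
      by_cases hin : i < n
      · exact (h13 i hin).1
      · have := (h13 (i - n) (by omega)).2
        rwa [show n + (i - n) = i by omega] at this
    refine ⟨(ChangesOnly.refl _ _ _).setNat (by simp) _ _, Nat.zero_le _, fun i hi hin => ?_,
      fun j hj => ?_⟩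
    · have h30 : (μ.setNat 30 0 0).nat 13 = μ.nat 13 := by
        ext j
        simp [Memory.nat_setNat]
      rw [h30]
      -- All entries of the tree below `2 * n` are empty, so every node is trivially consistent; the
      -- stale keys do not matter.
      exact ⟨fun c hc hc' => absurd (hz c (by omega)) hc', fun hc => absurd (hz i (by omega)) hc⟩
    · simp [Memory.nat_setNat, (h13 j hj).2]
  · rintro k μ' hk ⟨hch, -, hnode, hj⟩ h30
    have hchS : SearchChanges μ μ' := hch.mono (by simp) (by simp)
    have hI' := hI.congr hchS
    have hleaf := hI'.tables.leaf k hk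
    have h20 : μ'.nat 20 = μ.nat 20 := hch.1 20 (by simp)
    simp only [ensures_ite, ensures_skip, ensures_seq, ensures_setNat, ensures_setReal,
      Test.Holds, NatExp.eval, RealExp.eval, Memory.nat_setNat, Memory.real_setNat,
      h30, h20]
    simp only [Nat.reduceEqDiff, false_and, if_false, hleaf]
    refine ⟨fun hk0 => ?_, fun hk0 => ?_⟩
    · refine ⟨by omega, trivial, hch.setNat (by simp) _ _, hk, ?_, fun j hjn => ?_⟩
      · exact hnode
      · have h1 := hj j hjn
        refine ⟨?_, h1.2⟩
        rw [h1.1]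
        constructor
        · rintro ⟨h2, h3⟩
          exact ⟨by omega, h3⟩
        · rintro ⟨h2, h3⟩
          refine ⟨?_, h3⟩
          -- Vertex `k` is no source in this branch, so extending the range by it changes nothing.
          have : j ≠ k := by
            rintro rfl
            exact h3 hk0
          omega
    · generalize hμ1 : Memory.setReal _ 2 (n + k) _ = μ1
      have hch1 : ChangesOnly [13] [2] μ' μ1 := by
        rw [← hμ1]
        exact ((ChangesOnly.refl _ _ _).setNat (by simp) _ _).setReal (by simp) _ _
      have e13 : ∀ j, μ1.nat 13 j = if j = n + k then k + 1 else μ'.nat 13 j := by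
        simp [← hμ1, Memory.nat_setNat, Memory.nat_setReal]
      have e2 : ∀ j, μ1.real 2 j = if j = n + k then 0 else μ'.real 2 j := by
        simp [← hμ1, Memory.real_setNat, Memory.real_setReal]
      have hI1 := hI'.congr (hch1.mono (by simp) (by simp))
      refine (ensures_updateLeaf hk hI1.tables.heap (hI1.tables.leaf k hk)
        (by simp [NatExp.eval, hch1.1 30, h30]) hnode fun j hj => ?_).mono ?_
      · rw [e13, e2, if_neg hj, if_neg hj]
        exact ⟨rfl, rfl⟩
      rintro t μ2 ⟨ht2, hch2, hnode2, hleaf2⟩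
      refine ⟨by omega, by rw [hch2.1 30 (by simp), hch1.1 30 (by simp), h30],
        ((hch.trans (hch1.mono (by simp) (by simp))).trans
          (hch2.mono (by simp) (by simp))).setNat (by simp) _ _, hk, ?_, fun j hjn => ?_⟩
      · exact hnode2
      · rw [(hleaf2 _ (by omega)).1, (hleaf2 _ (by omega)).2, e13, e2]
        by_cases hjk : j = k
        · subst hjk
          simp [hk0]
        · have h1 := hj j hjn
          have h2 : n + j ≠ n + k := by omega
          rw [if_neg h2, if_neg h2]
          refine ⟨?_, h1.2⟩
          rw [h1.1]
          have : j < k ↔ j < k + 1 := by omega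
          rw [this]
  · rintro t μ' ⟨ht, hch, -, hnode, hj⟩
    refine ⟨ht, hch, hnode, fun j hjn => ⟨?_, (hj j hjn).2⟩⟩
    rw [(hj j hjn).1]
    simp [hjn]

/-- Best-first search. -/
def search : Cmd :=
  .seq clearSearch (.seq insertSources (.seq (.setNat 32 (.const 0) (.const 0)) scanLoop))

/-- A bound for the running time of a search. -/
def searchTime (n N : ℕ) : ℕ := (n + N) * (siftTime n + 12) + n * (siftTime n + 13) + 6

/-- The memory after a search that scans the vertices in `L`. -/
structure SearchResult {n : ℕ} (D : SearchProblem (Fin n)) (L : List (Fin n)) (μ : Memory) :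
    Prop where
  trace : D.Trace (fun v => μ.real 3 v) (fun v => μ.nat 15 v) L
  closed : D.Closed L
  unreached : ∀ v : Fin n, v ∉ L → μ.nat 15 v = 0
  order : IsStored (μ.nat 16) L
  count : μ.nat 32 0 = L.length

theorem ensures_search {n : ℕ} {D : SearchProblem (Fin n)} {μ : Memory} (hI : SearchInput D μ)
    (hn : 0 < n) :
    Ensures search μ fun t μ' => t ≤ searchTime n D.arcs ∧ SearchChanges μ μ' ∧
      ∃ L, SearchResult D L μ' := by
  rw [search, ensures_seq]
  refine (ensures_clearSearch hI).mono ?_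
  rintro t1 μ1 ⟨ht1, hch1, hz⟩
  rw [ensures_seq]
  refine (ensures_insertSources (hI.congr hch1)
    fun j hj => ⟨(hz j hj).2.2.2.1, (hz j hj).2.2.2.2⟩).mono ?_
  rintro t2 μ2 ⟨ht2, hch2, hnode2, hleaf2⟩
  rw [ensures_seq, ensures_setNat]
  simp only [NatExp.eval]
  have hch3 : ChangesOnly [13, 30, 31, 32] [2] μ1 (μ2.setNat 32 0 0) :=
    (hch2.mono (by simp) (by simp)).setNat (by simp) _ _
  have hchS : SearchChanges μ (μ2.setNat 32 0 0) := hch1.trans (hch3.mono (by simp) (by simp))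
  have e13 : (μ2.setNat 32 0 0).nat 13 = μ2.nat 13 := by
    ext j
    simp [Memory.nat_setNat]
  refine (ensures_scanLoop (hI.congr hchS) ⟨?_, ?_, ?_, ?_, trivial, ?_⟩ hn).mono ?_
  · rw [e13]
    exact hnode2
  · intro v hv
    rw [e13] at hv ⊢
    rw [hch3.2 3 (by simp), Memory.real_setNat, (hz v v.2).2.2.1]
    exact (hleaf2 v v.2).2 hv
  · refine SearchProblem.Invariant.init (fun v => ?_) (fun v => ?_) (fun v => ?_)
    · rw [hch3.2 3 (by simp), (hz v v.2).2.2.1]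
    · rw [hch3.1 15 (by simp), (hz v v.2).2.1]
    · rw [e13, (hleaf2 v v.2).1]
      exact (hI.congr hch1).source v
  · intro v
    rw [hch3.1 14 (by simp), (hz v v.2).1]
    simp
  · simp [Memory.nat_setNat]
  · rintro t4 μ4 ⟨ht4, hch4, L, hS, hQ⟩
    refine ⟨?_, hchS.trans hch4, L, hS.inv.trace, hS.inv.closed hQ,
      fun v hv => hS.inv.unreached v hv (hQ v), hS.order, hS.count⟩
    unfold searchTime
    have : n * (siftTime n + 13) = n * 7 + n * (siftTime n + 6) := by ring
    omega

end SearchProgram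

/-! ### The refined Steiner algorithm on the machine: instance tables, weights and marks -/

section RoundProgram

variable {n m : ℕ}

/-- The tail of the arc `h`: the arcs `2 j` and `2 j + 1` are the directions of the edge `j` from
its first to its second end and back. -/
def arcTail (ends : Fin m → Fin n × Fin n) (v₀ : Fin n) (h : ℕ) : Fin n :=
  if hm : h / 2 < m then (if h % 2 = 0 then (ends ⟨h / 2, hm⟩).1 else (ends ⟨h / 2, hm⟩).2) else v₀

/-- The head of the arc `h`. -/
def arcHead (ends : Fin m → Fin n × Fin n) (v₀ : Fin n) (h : ℕ) : Fin n :=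
  if hm : h / 2 < m then (if h % 2 = 0 then (ends ⟨h / 2, hm⟩).2 else (ends ⟨h / 2, hm⟩).1) else v₀

theorem arcEdge_eq (ends : Fin m → Fin n × Fin n) (v₀ : Fin n) {h j : ℕ} (hj : h / 2 = j)
    (hm : j < m) : s(arcTail ends v₀ h, arcHead ends v₀ h) = edgeAt ends ⟨j, hm⟩ := by
  subst hj
  unfold arcTail arcHead edgeAt
  rw [dif_pos hm, dif_pos hm]
  split_ifs
  · rfl
  · exact Sym2.eq_swap

theorem isArcList_arcs {G : SimpleGraph (Fin n)} {ends : Fin m → Fin n × Fin n}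
    (h : IsEdgeList G ends) (v₀ : Fin n) :
    IsArcList G (2 * m) (arcTail ends v₀) (arcHead ends v₀) where
  adj a ha := by
    rw [← SimpleGraph.mem_edgeSet, arcEdge_eq ends v₀ rfl (by omega), ← h.2]
    exact ⟨_, rfl⟩
  exists_arc x y hxy := by
    rw [← SimpleGraph.mem_edgeSet, ← h.2] at hxy
    obtain ⟨j, hj⟩ := hxy
    have h0 : 2 * (j : ℕ) / 2 = j := by omega
    have h1 : (2 * (j : ℕ) + 1) / 2 = j := by omega
    have h0' : 2 * (j : ℕ) % 2 = 0 := by omega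
    have h1' : (2 * (j : ℕ) + 1) % 2 ≠ 0 := by omega
    rcases Sym2.eq_iff.1 hj with ⟨rfl, rfl⟩ | ⟨rfl, rfl⟩
    · refine ⟨2 * j, by omega, ?_, ?_⟩
      · simp only [arcTail, h0, h0', j.2, dif_pos, if_true]
      · simp only [arcHead, h0, h0', j.2, dif_pos, if_true]
    · refine ⟨2 * j + 1, by omega, ?_, ?_⟩
      · simp only [arcTail, h1, h1', j.2, dif_pos, if_false]
      · simp only [arcHead, h1, h1', j.2, dif_pos, if_false]

/-- The instance is stored in the memory. -/
structure InstanceTables (I : Instance (Fin n)) (ends : Fin m → Fin n × Fin n) (v₀ : Fin n)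
    (μ : Memory) : Prop where
  tables : GraphTables n (2 * m) (arcTail ends v₀) (arcHead ends v₀) μ
  size : μ.nat 0 1 = m
  fst : ∀ j : Fin m, μ.nat 1 j = (ends j).1
  snd : ∀ j : Fin m, μ.nat 2 j = (ends j).2
  terminal : ∀ v : Fin n, μ.nat 3 v ≠ 0 ↔ v ∈ I.terminals
  pred : ∀ j : Fin m, μ.nat 4 j ≠ 0 ↔ edgeAt ends j ∈ I.pred
  weight : ∀ j : Fin m, μ.real 0 j = I.weight (edgeAt ends j)

/-- The memory that a run of the refined Steiner algorithm changes. -/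
abbrev RoundChanges : Memory → Memory → Prop :=
  ChangesOnly [5, 13, 14, 15, 16, 17, 18, 20, 21, 22, 23, 30, 31, 32, 33, 34, 35, 36, 37, 38, 39]
    [2, 3, 4, 5, 6, 7, 8, 10, 11]

variable {I : Instance (Fin n)} {ends : Fin m → Fin n × Fin n} {v₀ : Fin n} {μ : Memory}

theorem InstanceTables.of_other {μ' : Memory} {A R : List ℕ} (h : InstanceTables I ends v₀ μ)
    (hμ : ChangesOnly A R μ μ') (hA : ∀ a ∈ [0, 1, 2, 3, 4, 6, 7, 8, 9, 10, 11, 12, 19], a ∉ A)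
    (hR : 0 ∉ R) : InstanceTables I ends v₀ μ' where
  tables := h.tables.congr fun a ha => hμ.1 a (hA a (by
    simp only [List.mem_cons, List.not_mem_nil, or_false] at ha ⊢
    omega))
  size := by rw [hμ.1 0 (hA 0 (by simp))]; exact h.size
  fst := by rw [hμ.1 1 (hA 1 (by simp))]; exact h.fst
  snd := by rw [hμ.1 2 (hA 2 (by simp))]; exact h.snd
  terminal := by rw [hμ.1 3 (hA 3 (by simp))]; exact h.terminal
  pred := by rw [hμ.1 4 (hA 4 (by simp))]; exact h.pred
  weight := by rw [hμ.2 0 hR]; exact h.weight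

theorem InstanceTables.congr {μ' : Memory} (h : InstanceTables I ends v₀ μ)
    (hμ : RoundChanges μ μ') : InstanceTables I ends v₀ μ' :=
  h.of_other hμ (by simp) (by simp)

/-- Loops over the vertices and over the edges. -/
def forVertices (P : Cmd) : Cmd := forLoop 30 (natVar 0) P

def forEdges (P : Cmd) : Cmd := forLoop 30 (.get 0 (.const 1)) P

theorem ensures_forVertices (hI : InstanceTables I ends v₀ μ) {P : Cmd} {A R : List ℕ} (T : ℕ)
    (Inv : ℕ → Memory → Prop) (h30 : 30 ∈ A) (h0 : 0 ∉ A) (hA : A ⊆ [5, 13, 14, 15, 16, 17, 18, 20,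
      21, 22, 23, 30, 31, 32, 33, 34, 35, 36, 37, 38, 39]) (hR : R ⊆ [2, 3, 4, 5, 6, 7, 8, 10, 11])
    (hinit : Inv 0 (μ.setNat 30 0 0))
    (step : ∀ (k : Fin n) (μ' : Memory), ChangesOnly A R μ μ' → InstanceTables I ends v₀ μ' →
      μ'.nat 30 0 = k → Inv k μ' → Ensures P μ' fun t μ'' => t ≤ T ∧ ChangesOnly A R μ' μ'' ∧
        μ''.nat 30 0 = k ∧ Inv (k + 1) (μ''.setNat 30 0 (k + 1))) :
    Ensures (forVertices P) μ fun t μ' => t ≤ n * (T + 2) + 2 ∧ ChangesOnly A R μ μ' ∧ Inv n μ' := by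
  refine (Ensures.forLoop (fun k μ' => ChangesOnly A R μ μ' ∧ Inv k μ') n T ?_ ?_ ?_).mono
    fun t μ' h => h
  · rintro k μ' ⟨h, -⟩
    simp only [NatExp.eval, h.1 0 h0]
    exact hI.tables.size
  · exact ⟨(ChangesOnly.refl _ _ _).setNat h30 _ _, hinit⟩
  · rintro k μ' hk ⟨hch, hInv⟩ h30'
    refine (step ⟨k, hk⟩ μ' hch (hI.congr (hch.mono hA hR)) h30' hInv).mono ?_
    rintro t μ'' ⟨h1, h2, h3, h4⟩
    exact ⟨h1, h3, (hch.trans h2).setNat h30 _ _, h4⟩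

theorem ensures_forEdges (hI : InstanceTables I ends v₀ μ) {P : Cmd} {A R : List ℕ} (T : ℕ)
    (Inv : ℕ → Memory → Prop) (h30 : 30 ∈ A) (h0 : 0 ∉ A) (hA : A ⊆ [5, 13, 14, 15, 16, 17, 18, 20,
      21, 22, 23, 30, 31, 32, 33, 34, 35, 36, 37, 38, 39]) (hR : R ⊆ [2, 3, 4, 5, 6, 7, 8, 10, 11])
    (hinit : Inv 0 (μ.setNat 30 0 0))
    (step : ∀ (k : Fin m) (μ' : Memory), ChangesOnly A R μ μ' → InstanceTables I ends v₀ μ' →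
      μ'.nat 30 0 = k → Inv k μ' → Ensures P μ' fun t μ'' => t ≤ T ∧ ChangesOnly A R μ' μ'' ∧
        μ''.nat 30 0 = k ∧ Inv (k + 1) (μ''.setNat 30 0 (k + 1))) :
    Ensures (forEdges P) μ fun t μ' => t ≤ m * (T + 2) + 2 ∧ ChangesOnly A R μ μ' ∧ Inv m μ' := by
  refine (Ensures.forLoop (fun k μ' => ChangesOnly A R μ μ' ∧ Inv k μ') m T ?_ ?_ ?_).mono
    fun t μ' h => h
  · rintro k μ' ⟨h, -⟩
    simp only [NatExp.eval, h.1 0 h0]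
    exact hI.size
  · exact ⟨(ChangesOnly.refl _ _ _).setNat h30 _ _, hinit⟩
  · rintro k μ' hk ⟨hch, hInv⟩ h30'
    refine (step ⟨k, hk⟩ μ' hch (hI.congr (hch.mono hA hR)) h30' hInv).mono ?_
    rintro t μ'' ⟨h1, h2, h3, h4⟩
    exact ⟨h1, h3, (hch.trans h2).setNat h30 _ _, h4⟩

/-- Compute the scaled weights. -/
def scaleWeights : Cmd :=
  forEdges (.seq
    (.ite (.natEq (.get 4 (natVar 30)) (.const 0))
      (.setReal 7 (natVar 30) (.get 0 (natVar 30)))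
      (.setReal 7 (natVar 30) (.div (.get 0 (natVar 30)) (realVar 9))))
    (.setReal 6 (natVar 30) (.get 7 (natVar 30))))

theorem ensures_scaleWeights (hI : InstanceTables I ends v₀ μ) {α : ℝ} (hα : μ.real 9 0 = α) :
    Ensures scaleWeights μ fun t μ' => t ≤ m * 5 + 2 ∧ ChangesOnly [30] [6, 7] μ μ' ∧
      ∀ j : Fin m, μ'.real 6 j = I.scaledWeight α (edgeAt ends j) ∧
        μ'.real 7 j = I.scaledWeight α (edgeAt ends j) := by
  refine (ensures_forEdges hI (A := [30]) (R := [6, 7]) 3 (fun k μ' => ∀ j : Fin m, (j : ℕ) < k →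
    μ'.real 6 j = I.scaledWeight α (edgeAt ends j) ∧
    μ'.real 7 j = I.scaledWeight α (edgeAt ends j)) (by simp) (by simp) (by simp) (by simp)
    (by simp) ?_).mono fun t μ' h => ⟨h.1, h.2.1, fun j => h.2.2 j j.2⟩
  intro k μ' hch hI' h30 hInv
  have hpred := hI'.pred k
  have h9 : μ'.real 9 0 = α := by rw [hch.2 9 (by simp), hα]
  have key : ∀ x, x = I.scaledWeight α (edgeAt ends k) →
      ∀ j : Fin m, (j : ℕ) < k + 1 →
        (if (j : ℕ) = k then x else μ'.real 6 j) = I.scaledWeight α (edgeAt ends j) ∧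
        (if (j : ℕ) = k then x else μ'.real 7 j) = I.scaledWeight α (edgeAt ends j) := by
    intro x hx j hj
    by_cases hjk : (j : ℕ) = k
    · rw [Fin.ext hjk]
      simp [hx]
    · simpa [hjk] using hInv j (by omega)
  simp only [ensures_seq, ensures_ite, ensures_setReal, Test.Holds, NatExp.eval, RealExp.eval,
    Memory.real_setNat, Memory.nat_setReal, Memory.real_setReal, h30, h9, hI'.weight]
  refine ⟨fun h4 => ⟨by norm_num, ?_, trivial, ?_⟩, fun h4 => ⟨by norm_num, ?_, trivial, ?_⟩⟩
  · exact ((ChangesOnly.refl _ _ _).setReal (by simp) _ _).setReal (by simp) _ _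
  · have := key (I.weight (edgeAt ends k)) (by
      rw [Instance.scaledWeight, if_neg]
      rw [← hpred]
      exact fun h => h h4)
    simpa using this
  · exact ((ChangesOnly.refl _ _ _).setReal (by simp) _ _).setReal (by simp) _ _
  · have := key (I.weight (edgeAt ends k) / α) (by
      rw [Instance.scaledWeight, if_pos]
      exact hpred.1 h4)
    simpa using this

/-- Make the terminals the sources. -/
def terminalSources : Cmd := forVertices (.setNat 20 (natVar 30) (.get 3 (natVar 30)))

theorem ensures_terminalSources (hI : InstanceTables I ends v₀ μ) :
    Ensures terminalSources μ fun t μ' => t ≤ n * 3 + 2 ∧ ChangesOnly [20, 30] [] μ μ' ∧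
      ∀ v : Fin n, μ'.nat 20 v ≠ 0 ↔ v ∈ I.terminals := by
  refine (ensures_forVertices hI (A := [20, 30]) (R := []) 1 (fun k μ' => ∀ j : Fin n,
    (j : ℕ) < k → (μ'.nat 20 j ≠ 0 ↔ j ∈ I.terminals)) (by simp) (by simp) (by simp) (by simp)
    (by simp) ?_).mono fun t μ' h => ⟨h.1, h.2.1, fun j => h.2.2 j j.2⟩
  intro k μ' hch hI' h30 hInv
  simp only [ensures_setNat, NatExp.eval, Memory.nat_setNat, h30]
  refine ⟨le_rfl, (ChangesOnly.refl _ _ _).setNat (by simp) _ _, by simp, fun j hj => ?_⟩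
  by_cases hjk : (j : ℕ) = k
  · simpa [Fin.ext hjk] using hI'.terminal k
  · simpa [hjk] using hInv j (by omega)

/-- Save the result of the first search, clear the solution, and find a terminal. -/
def saveSearch : Cmd :=
  .seq (forVertices
    (.seq (.setNat 17 (natVar 30) (.get 15 (natVar 30)))
    (.seq (.setNat 18 (natVar 30) (.get 16 (natVar 30)))
    (.seq (.setReal 4 (natVar 30) (.get 3 (natVar 30)))
    (.seq (.setNat 20 (natVar 30) (.const 0))
    (.seq (.setNat 22 (natVar 30) (.const 0))
    (.ite (.natEq (.get 3 (natVar 30)) (.const 0)) .skip (.setNat 37 (.const 0) (natVar 30)))))))))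
  (.setNat 38 (.const 0) (natVar 32))

theorem ensures_saveSearch (hI : InstanceTables I ends v₀ μ) :
    Ensures saveSearch μ fun t μ' => t ≤ n * 9 + 3 ∧
      ChangesOnly [17, 18, 20, 22, 30, 37, 38] [4] μ μ' ∧ μ'.nat 38 0 = μ.nat 32 0 ∧
      (∃ s ∈ I.terminals, μ'.nat 37 0 = s) ∧
      ∀ v : Fin n, μ'.nat 17 v = μ.nat 15 v ∧ μ'.nat 18 v = μ.nat 16 v ∧
        μ'.real 4 v = μ.real 3 v ∧ μ'.nat 20 v = 0 ∧ μ'.nat 22 v = 0 := by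
  rw [saveSearch, ensures_seq]
  refine (ensures_forVertices hI (A := [17, 18, 20, 22, 30, 37]) (R := [4]) 7 (fun k μ' =>
    (∀ v : Fin n, (v : ℕ) < k → v ∈ I.terminals → ∃ s ∈ I.terminals, μ'.nat 37 0 = s) ∧
    ∀ v : Fin n, (v : ℕ) < k → μ'.nat 17 v = μ.nat 15 v ∧ μ'.nat 18 v = μ.nat 16 v ∧
        μ'.real 4 v = μ.real 3 v ∧ μ'.nat 20 v = 0 ∧ μ'.nat 22 v = 0) (by simp) (by simp) (by simp)
    (by simp) (by simp) ?_).mono ?_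
  · intro k μ' hch hI' h30 ⟨hInv1, hInv2⟩
    have hterm := hI'.terminal k
    have key : ∀ j : Fin n, (j : ℕ) < k + 1 →
        (if (j : ℕ) = k then μ'.nat 15 k else μ'.nat 17 j) = μ.nat 15 j ∧
        (if (j : ℕ) = k then μ'.nat 16 k else μ'.nat 18 j) = μ.nat 16 j ∧
        (if (j : ℕ) = k then μ'.real 3 k else μ'.real 4 j) = μ.real 3 j ∧
        (if (j : ℕ) = k then 0 else μ'.nat 20 j) = 0 ∧
        (if (j : ℕ) = k then 0 else μ'.nat 22 j) = 0 := by
      intro j hj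
      by_cases hjk : (j : ℕ) = k
      · simp [hjk, hch.1 15, hch.1 16, hch.2 3]
      · simpa [hjk] using hInv2 j (by omega)
    simp only [ensures_seq, ensures_ite, ensures_skip, ensures_setNat, ensures_setReal, Test.Holds,
      NatExp.eval, RealExp.eval, Memory.nat_setNat, Memory.real_setNat, Memory.nat_setReal,
      Memory.real_setReal, h30]
    simp only [Nat.reduceEqDiff, false_and, if_false, true_and]
    have hc : ChangesOnly [17, 18, 20, 22, 30, 37] [4] μ' _ :=
      ((((((ChangesOnly.refl _ _ μ').setNat (a := 17) (by simp) k (μ'.nat 15 k)).setNat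
        (a := 18) (by simp) k (μ'.nat 16 k)).setReal (a := 4) (by simp) k (μ'.real 3 k)).setNat
        (a := 20) (by simp) k 0).setNat (a := 22) (by simp) k 0)
    refine ⟨fun h3 => ⟨by norm_num, hc, fun v hv hvt => ?_, key⟩,
      fun h3 => ⟨by norm_num, hc.setNat (by simp) _ _, fun v hv hvt => ?_, key⟩⟩
    -- A vertex that is not a terminal leaves the stored terminal unchanged. After the loop the last
    -- terminal is stored, which exists since the set is nonempty.
    · refine hInv1 v ?_ hvt
      have : v ≠ k := by
        rintro rfl
        exact hterm.2 hvt h3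
      have := Fin.val_ne_of_ne this
      omega
    · exact ⟨k, hterm.1 h3, by simp⟩
  · rintro t μ' ⟨ht, hch, h1, h2⟩
    rw [ensures_setNat]
    simp only [NatExp.eval]
    refine ⟨by omega, (hch.mono (by simp) (by simp)).setNat (by simp) _ _, ?_, ?_, ?_⟩
    · simp [Memory.nat_setNat, hch.1 32]
    · obtain ⟨t, ht⟩ := I.terminals_nonempty
      simpa [Memory.nat_setNat] using h1 t t.2 ht
    · intro v
      simpa [Memory.nat_setNat, Memory.real_setNat] using h2 v v.2

/-- Clear the marks of the edges. -/
def clearMarks : Cmd :=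
  forEdges (.seq (.setNat 21 (natVar 30) (.const 0)) (.setNat 23 (natVar 30) (.const 0)))

theorem ensures_clearMarks (hI : InstanceTables I ends v₀ μ) :
    Ensures clearMarks μ fun t μ' => t ≤ m * 4 + 2 ∧ ChangesOnly [21, 23, 30] [] μ μ' ∧
      ∀ j < m, μ'.nat 21 j = 0 ∧ μ'.nat 23 j = 0 := by
  refine (ensures_forEdges hI (A := [21, 23, 30]) (R := []) 2 (fun k μ' => ∀ j < k,
    μ'.nat 21 j = 0 ∧ μ'.nat 23 j = 0) (by simp) (by simp) (by simp) (by simp) (by simp) ?_).mono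
    fun t μ' h => h
  intro k μ' hch hI' h30 hInv
  simp only [ensures_seq, ensures_setNat, NatExp.eval, Memory.nat_setNat, h30]
  refine ⟨le_rfl, ((ChangesOnly.refl _ _ _).setNat (by simp) _ _).setNat (by simp) _ _, by simp,
    fun j hj => ?_⟩
  by_cases hjk : j = k
  · simp [hjk]
  · simpa [hjk] using hInv j (by omega)

/-- Mark the edges of the forest. -/
def markForest : Cmd :=
  forVertices (.ite (.natEq (.get 17 (natVar 30)) (.const 0)) .skip
    (.setNat 23 (.get 8 (.pred (.get 17 (natVar 30)))) (.const 1)))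

theorem ensures_markForest (hI : InstanceTables I ends v₀ μ)
    (hpe : ∀ (v : Fin n) (a : ℕ), μ.nat 17 v = a + 1 → a < 2 * m)
    (h23 : ∀ j < m, μ.nat 23 j = 0) :
    Ensures markForest μ fun t μ' => t ≤ n * 4 + 2 ∧ ChangesOnly [23, 30] [] μ μ' ∧
      ∀ j < m, (μ'.nat 23 j ≠ 0 ↔ ∃ (v : Fin n) (a : ℕ), μ.nat 17 v = a + 1 ∧ a / 2 = j) := by
  refine (ensures_forVertices hI (A := [23, 30]) (R := []) 2 (fun k μ' => ∀ j < m,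
    (μ'.nat 23 j ≠ 0 ↔ ∃ (v : Fin n) (a : ℕ), (v : ℕ) < k ∧ μ.nat 17 v = a + 1 ∧ a / 2 = j))
    (by simp) (by simp) (by simp) (by simp) ?_ ?_).mono ?_
  · intro j hj
    simp [Memory.nat_setNat, h23 j hj]
  · intro k μ' hch hI' h30 hInv
    have e17 : μ'.nat 17 = μ.nat 17 := hch.1 17 (by simp)
    simp only [ensures_ite, ensures_skip, ensures_setNat, Test.Holds, NatExp.eval,
      Memory.nat_setNat, h30, e17]
    refine ⟨fun h17 => ⟨by norm_num, ChangesOnly.refl _ _ _, trivial, fun j hj => ?_⟩, fun h17 => ?_⟩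
    · simp only [Nat.reduceEqDiff, false_and, if_false]
      rw [hInv j hj]
      constructor
      · rintro ⟨v, a, h1, h2⟩
        exact ⟨v, a, by omega, h2⟩
      · rintro ⟨v, a, h1, h2, h3⟩
        have : (v : ℕ) ≠ k := by
          intro h
          rw [h] at h2
          omega
        exact ⟨v, a, by omega, h2, h3⟩
    · obtain ⟨a, ha⟩ : ∃ a, μ.nat 17 k = a + 1 := ⟨μ.nat 17 k - 1, by omega⟩
      have h8 := hI'.tables.edge a (hpe k a ha)
      simp only [ha, Nat.add_sub_cancel, h8]
      refine ⟨le_rfl, (ChangesOnly.refl _ _ _).setNat (by simp) _ _, by simp, fun j hj => ?_⟩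
      simp only [Nat.reduceEqDiff, false_and, if_false, true_and]
      by_cases hja : j = a / 2
      · rw [if_pos hja]
        exact ⟨fun _ => ⟨k, a, by omega, ha, hja.symm⟩, fun _ => one_ne_zero⟩
      · rw [if_neg hja, hInv j hj]
        constructor
        · rintro ⟨v, a, h1, h2⟩
          exact ⟨v, a, by omega, h2⟩
        · rintro ⟨v, b, h1, h2, h3⟩
          have : (v : ℕ) ≠ k := by
            intro h
            rw [h] at h2
            obtain rfl : a = b := by omega
            exact hja h3.symm
          exact ⟨v, b, by omega, h2, h3⟩
  · rintro t μ' ⟨ht, hch, h⟩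
    refine ⟨ht, hch, fun j hj => ?_⟩
    rw [h j hj]
    simp

/-- Compute the costs of the edges for the second search. -/
def treeCosts : Cmd :=
  forEdges (.ite (.natEq (.get 23 (natVar 30)) (.const 0))
    (.setReal 6 (natVar 30) (.add (.add (.get 4 (.get 1 (natVar 30))) (.get 7 (natVar 30)))
      (.get 4 (.get 2 (natVar 30)))))
    (.setReal 6 (natVar 30) (.sub (.const 0) (.const 1))))

theorem ensures_treeCosts (hI : InstanceTables I ends v₀ μ) :
    Ensures treeCosts μ fun t μ' => t ≤ m * 4 + 2 ∧ ChangesOnly [30] [6] μ μ' ∧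
      ∀ j : Fin m, μ'.real 6 j = if μ.nat 23 j = 0 then
        μ.real 4 (ends j).1 + μ.real 7 j + μ.real 4 (ends j).2 else -1 := by
  refine (ensures_forEdges hI (A := [30]) (R := [6]) 2 (fun k μ' => ∀ j : Fin m, (j : ℕ) < k →
    μ'.real 6 j = if μ.nat 23 j = 0 then
      μ.real 4 (ends j).1 + μ.real 7 j + μ.real 4 (ends j).2 else -1) (by simp) (by simp)
    (by simp) (by simp) (by simp) ?_).mono fun t μ' h => ⟨h.1, h.2.1, fun j => h.2.2 j j.2⟩
  intro k μ' hch hI' h30 hInv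
  simp only [ensures_ite, ensures_setReal, Test.Holds, NatExp.eval, RealExp.eval,
    Memory.real_setNat, Memory.nat_setReal, Memory.real_setReal, h30, hI'.fst, hI'.snd,
    hch.1 23 (by simp), hch.2 4 (by simp), hch.2 7 (by simp)]
  have key : ∀ x : ℝ, x = (if μ.nat 23 k = 0 then
      μ.real 4 (ends k).1 + μ.real 7 k + μ.real 4 (ends k).2 else -1) →
      ∀ j : Fin m, (j : ℕ) < k + 1 → (if (j : ℕ) = k then x else μ'.real 6 j) =
        if μ.nat 23 j = 0 then μ.real 4 (ends j).1 + μ.real 7 j + μ.real 4 (ends j).2 else -1 := by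
    intro x hx j hj
    by_cases hjk : (j : ℕ) = k
    · rw [Fin.ext hjk, if_pos rfl, hx]
    · rw [if_neg hjk]
      exact hInv j (by omega)
  refine ⟨fun h => ⟨le_rfl, (ChangesOnly.refl _ _ _).setReal (by simp) _ _, trivial, ?_⟩,
    fun h => ⟨le_rfl, (ChangesOnly.refl _ _ _).setReal (by simp) _ _, trivial, ?_⟩⟩
  · simpa using key _ (by rw [if_pos h])
  · simpa using key (-1) (by rw [if_neg h])

end RoundProgram

/-! ### Marking the bridges and their forest paths -/

section RoundProgram

variable {n m : ℕ} {I : Instance (Fin n)} {ends : Fin m → Fin n × Fin n} {v₀ : Fin n} {μ : Memory}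

theorem SearchProblem.Trace.parent_lt {V : Type*} {D : SearchProblem V} {key : V → ℝ} {pe : V → ℕ}
    {L : List V} (h : D.Trace key pe L) (hun : ∀ v, v ∉ L → pe v = 0) (v : V) (a : ℕ)
    (ha : pe v = a + 1) : a < D.arcs := by
  have hv : v ∈ L := by
    by_contra hv
    have := hun v hv
    omega
  rcases h.reached hv with ⟨h0, -⟩ | ⟨b, hb, hb', -⟩
  · omega
  · obtain rfl : a = b := by omega
    exact hb

/-- Mark the tree edges that are not in the forest, and their ends. -/
def markBridges : Cmd :=
  forVertices (.ite (.natEq (.get 15 (natVar 30)) (.const 0)) .skip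
    (.ite (.natEq (.get 23 (.get 8 (.pred (.get 15 (natVar 30))))) (.const 0))
      (.seq (.setNat 21 (.get 8 (.pred (.get 15 (natVar 30)))) (.const 1))
      (.seq (.setNat 22 (.get 6 (.pred (.get 15 (natVar 30)))) (.const 1))
      (.setNat 22 (natVar 30) (.const 1)))) .skip))

theorem ensures_markBridges (hI : InstanceTables I ends v₀ μ)
    (hpe : ∀ (v : Fin n) (a : ℕ), μ.nat 15 v = a + 1 → a < 2 * m)
    (h21 : ∀ j < m, μ.nat 21 j = 0) (h22 : ∀ v : Fin n, μ.nat 22 v = 0) :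
    Ensures markBridges μ fun t μ' => t ≤ n * 7 + 2 ∧ ChangesOnly [21, 22, 30] [] μ μ' ∧
      (∀ j < m, (μ'.nat 21 j ≠ 0 ↔ ∃ (v : Fin n) (a : ℕ), μ.nat 15 v = a + 1 ∧
        μ.nat 23 (a / 2) = 0 ∧ a / 2 = j)) ∧
      ∀ x : Fin n, (μ'.nat 22 x ≠ 0 ↔ ∃ (v : Fin n) (a : ℕ), μ.nat 15 v = a + 1 ∧
        μ.nat 23 (a / 2) = 0 ∧ (x = arcTail ends v₀ a ∨ x = v)) := by
  refine (ensures_forVertices hI (A := [21, 22, 30]) (R := []) 5 (fun k μ' =>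
    (∀ j < m, (μ'.nat 21 j ≠ 0 ↔ ∃ (v : Fin n) (a : ℕ), (v : ℕ) < k ∧ μ.nat 15 v = a + 1 ∧
        μ.nat 23 (a / 2) = 0 ∧ a / 2 = j)) ∧
    ∀ x : Fin n, (μ'.nat 22 x ≠ 0 ↔ ∃ (v : Fin n) (a : ℕ), (v : ℕ) < k ∧ μ.nat 15 v = a + 1 ∧
        μ.nat 23 (a / 2) = 0 ∧ (x = arcTail ends v₀ a ∨ x = v)))
    (by simp) (by simp) (by simp) (by simp) ?_ ?_).mono ?_
  · refine ⟨fun j hj => ?_, fun x => ?_⟩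
    · simp [Memory.nat_setNat, h21 j hj]
    · simp [Memory.nat_setNat, h22 x]
  · intro k μ' hch hI' h30 ⟨hInv1, hInv2⟩
    have e15 : μ'.nat 15 = μ.nat 15 := hch.1 15 (by simp)
    have e23 : μ'.nat 23 = μ.nat 23 := hch.1 23 (by simp)
    -- Covers both cases in which nothing is marked: the vertex has no parent arc, or its parent arc
    -- belongs to the forest.
    have hkeep : (∀ a, μ.nat 15 k = a + 1 → μ.nat 23 (a / 2) ≠ 0) →
        (∀ j < m, (μ'.nat 21 j ≠ 0 ↔ ∃ (v : Fin n) (a : ℕ), (v : ℕ) < k + 1 ∧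
          μ.nat 15 v = a + 1 ∧ μ.nat 23 (a / 2) = 0 ∧ a / 2 = j)) ∧
        ∀ x : Fin n, (μ'.nat 22 x ≠ 0 ↔ ∃ (v : Fin n) (a : ℕ), (v : ℕ) < k + 1 ∧
          μ.nat 15 v = a + 1 ∧ μ.nat 23 (a / 2) = 0 ∧ (x = arcTail ends v₀ a ∨ x = v)) := by
      intro hno
      have hlt : ∀ (v : Fin n) (a : ℕ), (v : ℕ) < k + 1 → μ.nat 15 v = a + 1 →
          μ.nat 23 (a / 2) = 0 → (v : ℕ) < k := by
        intro v a h1 h2 h3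
        have : (v : ℕ) ≠ k := fun h => hno a (h ▸ h2) h3
        omega
      refine ⟨fun j hj => (hInv1 j hj).trans ?_, fun x => (hInv2 x).trans ?_⟩
      · constructor
        · rintro ⟨v, a, h1, h2⟩
          exact ⟨v, a, by omega, h2⟩
        · rintro ⟨v, a, h1, h2, h3, h4⟩
          exact ⟨v, a, hlt v a h1 h2 h3, h2, h3, h4⟩
      · constructor
        · rintro ⟨v, a, h1, h2⟩
          exact ⟨v, a, by omega, h2⟩
        · rintro ⟨v, a, h1, h2, h3, h4⟩
          exact ⟨v, a, hlt v a h1 h2 h3, h2, h3, h4⟩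
    rw [ensures_ite, ensures_skip]
    simp only [Test.Holds, NatExp.eval, h30, e15]
    refine ⟨fun h15 => ?_, fun h15 => ?_⟩
    · refine ⟨by norm_num, ChangesOnly.refl _ _ _, trivial, ?_⟩
      simpa [Memory.nat_setNat] using hkeep fun a ha => by omega
    obtain ⟨a, ha⟩ : ∃ a, μ.nat 15 k = a + 1 := ⟨μ.nat 15 k - 1, by omega⟩
    have haN := hpe k a ha
    have h8 := hI'.tables.edge a haN
    have h6 := hI'.tables.tail a haN
    simp only [ensures_ite, ensures_skip, ensures_seq, ensures_setNat, Test.Holds, NatExp.eval,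
      Memory.nat_setNat, h30, e15, ha, Nat.add_sub_cancel, h8, e23]
    simp only [Nat.reduceEqDiff, false_and, if_false, true_and, ha, Nat.add_sub_cancel, h6]
    refine ⟨fun h23 => ⟨by norm_num, ?_, ?_, ?_⟩,
      fun h23 => ⟨by norm_num, ChangesOnly.refl _ _ _, hkeep fun b hb => ?_⟩⟩
    · exact (((ChangesOnly.refl _ _ _).setNat (by simp) _ _).setNat (by simp) _ _).setNat
        (by simp) _ _
    · intro j hj
      by_cases hja : j = a / 2
      · rw [if_pos hja]
        exact ⟨fun _ => ⟨k, a, by omega, ha, h23, hja.symm⟩, fun _ => one_ne_zero⟩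
      · rw [if_neg hja, hInv1 j hj]
        constructor
        · rintro ⟨v, b, h1, h2⟩
          exact ⟨v, b, by omega, h2⟩
        · rintro ⟨v, b, h1, h2, h3, h4⟩
          have : (v : ℕ) ≠ k := by
            intro h
            rw [h] at h2
            obtain rfl : a = b := by omega
            exact hja h4.symm
          exact ⟨v, b, by omega, h2, h3, h4⟩
    · intro x
      by_cases hxk : x = k
      · rw [if_pos (by rw [hxk])]
        exact ⟨fun _ => ⟨k, a, by omega, ha, h23, Or.inr hxk⟩, fun _ => one_ne_zero⟩
      rw [if_neg (fun h => hxk (Fin.ext h))]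
      by_cases hxa : x = arcTail ends v₀ a
      · rw [if_pos (by rw [hxa])]
        exact ⟨fun _ => ⟨k, a, by omega, ha, h23, Or.inl hxa⟩, fun _ => one_ne_zero⟩
      rw [if_neg (fun h => hxa (Fin.ext h)), hInv2 x]
      constructor
      · rintro ⟨v, b, h1, h2⟩
        exact ⟨v, b, by omega, h2⟩
      · rintro ⟨v, b, h1, h2, h3, h4⟩
        have : (v : ℕ) ≠ k := by
          intro h
          rw [h] at h2
          obtain rfl : a = b := by omega
          rcases h4 with h4 | h4
          · exact hxa h4
          · exact hxk (h4.trans (Fin.ext h))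
        exact ⟨v, b, by omega, h2, h3, h4⟩
    · obtain rfl : a = b := by omega
      exact h23
  · rintro t μ' ⟨ht, hch, h1, h2⟩
    refine ⟨ht, hch, fun j hj => (h1 j hj).trans ?_, fun x => (h2 x).trans ?_⟩ <;> simp

/-- Mark the forest edges on the paths from the marked vertices to their roots. -/
def markAncestors : Cmd :=
  .loop (.not (.natEq (natVar 38) (.const 0)))
    (.seq (.setNat 38 (.const 0) (.pred (natVar 38)))
    (.seq (.setNat 35 (.const 0) (.get 18 (natVar 38)))
    (.ite (.and (.not (.natEq (.get 22 (natVar 35)) (.const 0)))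
        (.not (.natEq (.get 17 (natVar 35)) (.const 0))))
      (.seq (.setNat 21 (.get 8 (.pred (.get 17 (natVar 35)))) (.const 1))
        (.setNat 22 (.get 6 (.pred (.get 17 (natVar 35)))) (.const 1)))
      .skip)))

/-- Parents are scanned before their children, so going through the scan order backwards meets every
vertex after all its descendants. A single pass thus propagates the marks up to the roots. `K` is
the part not yet processed, and processed marked vertices have passed their mark on. -/
theorem ensures_markAncestors (hI : InstanceTables I ends v₀ μ) {w : Sym2 (Fin n) → ℝ}
    {d : Fin n → ℝ} {pe : Fin n → ℕ} {L : List (Fin n)}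
    (hT : (I.forestProblem w (2 * m) (arcTail ends v₀) (arcHead ends v₀)).Trace d pe L)
    (hun : ∀ v, v ∉ L → pe v = 0) (hpe : ∀ v : Fin n, μ.nat 17 v = pe v)
    (ho : IsStored (μ.nat 18) L) (h38 : μ.nat 38 0 = L.length) :
    Ensures markAncestors μ fun t μ' => t ≤ n * 6 + 1 ∧
      ChangesOnly [21, 22, 35, 38] [] μ μ' ∧
      ∀ j < m, (μ'.nat 21 j ≠ 0 ↔ μ.nat 21 j ≠ 0 ∨ ∃ x u : Fin n, μ.nat 22 u ≠ 0 ∧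
        Ancestor (arcTail ends v₀) pe x u ∧ ∃ a, pe x = a + 1 ∧ a / 2 = j) := by
  have hparc : ∀ v a, pe v = a + 1 → a < 2 * m := hT.parent_lt hun
  refine (Ensures.loop (fun μ' φ => ChangesOnly [21, 22, 35, 38] [] μ μ' ∧ ∃ K : List (Fin n),
    (I.forestProblem w (2 * m) (arcTail ends v₀) (arcHead ends v₀)).Trace d pe K ∧
    IsStored (μ.nat 18) K ∧ μ'.nat 38 0 = K.length ∧ φ = K.length * 6 ∧
    (∀ x : Fin n, μ'.nat 22 x ≠ 0 →
      ∃ u : Fin n, μ.nat 22 u ≠ 0 ∧ Ancestor (arcTail ends v₀) pe x u) ∧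
    (∀ x : Fin n, μ.nat 22 x ≠ 0 → μ'.nat 22 x ≠ 0) ∧
    (∀ j < m, μ.nat 21 j ≠ 0 → μ'.nat 21 j ≠ 0) ∧
    (∀ j < m, μ'.nat 21 j ≠ 0 → μ.nat 21 j ≠ 0 ∨ ∃ x u : Fin n, μ.nat 22 u ≠ 0 ∧
        Ancestor (arcTail ends v₀) pe x u ∧ ∃ a, pe x = a + 1 ∧ a / 2 = j) ∧
    ∀ v, v ∉ K → ∀ a, pe v = a + 1 → μ'.nat 22 v ≠ 0 →
      μ'.nat 22 (arcTail ends v₀ a) ≠ 0 ∧ μ'.nat 21 (a / 2) ≠ 0) ?_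
    (φ := L.length * 6) ⟨ChangesOnly.refl _ _ _, L, hT, ho, h38, rfl, fun x hx => ⟨x, hx, .refl⟩,
      fun _ h => h, fun _ _ h => h, fun _ _ h => Or.inl h, fun v hv a ha => ?_⟩).mono ?_
  · rintro μ' φ ⟨hch, K, hK, hoK, h38, rfl, h1, h2, h3, h4, h5⟩ hb
    simp only [Test.Holds, NatExp.eval, h38] at hb
    cases K with
    | nil => exact absurd rfl hb
    | cons v K =>
      have hI' := hI.congr (hch.mono (by simp) (by simp))
      have e18 : μ'.nat 18 K.length = v := by rw [hch.1 18 (by simp)]; exact hoK.1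
      have e17 : μ'.nat 17 v = pe v := by rw [hch.1 17 (by simp)]; exact hpe v
      simp only [List.length_cons] at h38
      simp only [ensures_seq, ensures_setNat, NatExp.eval, Memory.nat_setNat, h38,
        Nat.add_sub_cancel]
      simp only [Nat.reduceEqDiff, false_and, if_false, and_self, if_true, e18]
      generalize hμ1 : Memory.setNat _ 35 0 (v : ℕ) = μ1
      have hch1 : ChangesOnly [35, 38] [] μ' μ1 := by
        rw [← hμ1]
        exact ((ChangesOnly.refl _ _ _).setNat (by simp) _ _).setNat (by simp) _ _
      have e35 : μ1.nat 35 0 = v := by simp [← hμ1, Memory.nat_setNat]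
      have e38 : μ1.nat 38 0 = K.length := by simp [← hμ1, Memory.nat_setNat]
      have e21 : μ1.nat 21 = μ'.nat 21 := hch1.1 21 (by simp)
      have e22 : μ1.nat 22 = μ'.nat 22 := hch1.1 22 (by simp)
      have e17' : μ1.nat 17 v = pe v := by rw [hch1.1 17 (by simp), e17]
      have hchA := hch.trans (hch1.mono (by simp) (by simp))
      have hI1 := hI.congr (hchA.mono (by simp) (by simp))
      simp only [ensures_ite, ensures_skip, ensures_seq, ensures_setNat, Test.Holds, NatExp.eval,
        Memory.nat_setNat, e35, e17']
      simp only [Nat.reduceEqDiff, false_and, if_false, e17']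
      refine ⟨fun hv => ?_, fun hv => ?_⟩
      · obtain ⟨hv22, hv17⟩ := hv
        obtain ⟨a, ha⟩ : ∃ a, pe v = a + 1 := ⟨pe v - 1, by omega⟩
        have haN := hparc v a ha
        have h8 := hI1.tables.edge a haN
        have h6 := hI1.tables.tail a haN
        simp only [ha, Nat.add_sub_cancel, h8, h6]
        -- The parent is still to be processed, so marking it does not disturb what holds for the
        -- processed vertices.
        have htl : arcTail ends v₀ a ∈ K := by
          rcases hK.1.reached with ⟨h0, -⟩ | ⟨b, hb, hb', -, hbK, -⟩
          · omega
          · obtain rfl : a = b := by omega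
            exact hbK
        rw [e22] at hv22
        obtain ⟨u, hu, hvu⟩ := h1 v hv22
        simp only [true_and, e21, e22, e38, Fin.val_inj]
        refine ⟨_, ⟨(hchA.setNat (by simp) _ _).setNat (by simp) _ _, K, hK.2, hoK.2, rfl, rfl,
          fun x hx => ?_, fun x hx => ?_, fun j hj hj1 => ?_, fun j hj hj1 => ?_,
          fun y hy b hb hy22 => ?_⟩, ?_⟩
        · by_cases hxa : x = arcTail ends v₀ a
          · exact ⟨u, hu, .head ⟨a, ha, hxa.symm⟩ hvu⟩
          · rw [if_neg hxa] at hx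
            exact h1 x hx
        · split_ifs
          · exact one_ne_zero
          · exact h2 x hx
        · split_ifs
          · exact one_ne_zero
          · exact h3 j hj hj1
        · by_cases hja : j = a / 2
          · exact Or.inr ⟨v, u, hu, hvu, a, ha, hja.symm⟩
          · rw [if_neg hja] at hj1
            exact h4 j hj hj1
        · by_cases hyv : y = v
          · rw [hyv] at hb
            obtain rfl : a = b := by omega
            simp
          · have hya : y ≠ arcTail ends v₀ a := by
              rintro rfl
              exact hy htl
            rw [if_neg hya] at hy22
            obtain ⟨h6, h7⟩ := h5 y (by simp [hyv, hy]) b hb hy22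
            refine ⟨?_, ?_⟩ <;> split_ifs <;> simp_all
        · rw [List.length_cons]
          omega
      · refine ⟨_, ⟨hchA, K, hK.2, hoK.2, e38, rfl, ?_⟩, ?_⟩
        · rw [e21, e22]
          refine ⟨h1, h2, h3, h4, fun y hy b hb hy22 => ?_⟩
          by_cases hyv : y = v
          · subst hyv
            rw [e22] at hv
            exact absurd ⟨hy22, by omega⟩ hv
          · exact h5 y (by simp [hyv, hy]) b hb hy22
        · rw [List.length_cons]
          omega
  · have := hun v hv
    omega
  · rintro t μ' ⟨φ, ⟨hch, K, hK, hoK, h38, rfl, h1, h2, h3, h4, h5⟩, hb, hle⟩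
    simp only [Test.Holds, NatExp.eval, not_not, h38] at hb
    obtain rfl := List.length_eq_zero_iff.1 hb
    have hlen := hT.nodup.length_le_card
    rw [Fintype.card_fin] at hlen
    refine ⟨by omega, hch, fun j hj => ⟨h4 j hj, ?_⟩⟩
    rintro (h | ⟨x, u, hu, hxu, a, ha, rfl⟩)
    · exact h3 j hj h
    · refine (h5 x (by simp) a ha ?_).2
      have hu' := h2 u hu
      clear ha
      -- At the end all vertices are processed, so marks spread from `u` along the whole chain of
      -- ancestors.
      induction hxu using Relation.ReflTransGen.head_induction_on with
      | refl => exact hu'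
      | head hxy _ ih =>
        obtain ⟨b, hb, rfl⟩ := hxy
        exact (h5 _ (by simp) b hb ih).1

end RoundProgram

/-! ### One complete run of the refined Steiner algorithm -/

section RoundProgram

variable {n m : ℕ} {I : Instance (Fin n)} {ends : Fin m → Fin n × Fin n} {v₀ : Fin n} {μ : Memory}

/-- The set of the edges whose entry in an array is nonzero. -/
def markedEdges (ends : Fin m → Fin n × Fin n) (f : ℕ → ℕ) : Finset (Sym2 (Fin n)) :=
  (Finset.univ.filter fun j : Fin m => f j ≠ 0).image (edgeAt ends)

theorem mem_markedEdges {f : ℕ → ℕ} {e : Sym2 (Fin n)} :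
    e ∈ markedEdges ends f ↔ ∃ j : Fin m, f j ≠ 0 ∧ edgeAt ends j = e := by
  simp [markedEdges]

theorem totalWeight_markedEdges (h : Function.Injective (edgeAt ends)) (w : Sym2 (Fin n) → ℝ)
    (f : ℕ → ℕ) : totalWeight w (markedEdges ends f) =
      ∑ j : Fin m, if f j = 0 then 0 else w (edgeAt ends j) := by
  rw [totalWeight, markedEdges, Finset.sum_image fun _ _ _ _ h' => h h', Finset.sum_filter]
  refine Finset.sum_congr rfl fun j _ => ?_
  by_cases hj : f j = 0 <;> simp [hj]

/-- Compute the total weight of the marked edges. -/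
def sumMarked : Cmd :=
  .seq (.setReal 10 (.const 0) (.const 0))
    (forEdges (.ite (.natEq (.get 21 (natVar 30)) (.const 0)) .skip
      (.setReal 10 (.const 0) (.add (realVar 10) (.get 0 (natVar 30))))))

theorem ensures_sumMarked (hI : InstanceTables I ends v₀ μ)
    (hinj : Function.Injective (edgeAt ends)) :
    Ensures sumMarked μ fun t μ' => t ≤ m * 4 + 3 ∧ ChangesOnly [30] [10] μ μ' ∧
      μ'.real 10 0 = totalWeight I.weight (markedEdges ends (μ.nat 21)) := by
  rw [sumMarked, ensures_seq, ensures_setReal]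
  simp only [NatExp.eval, RealExp.eval, Nat.cast_zero]
  generalize hμ1 : Memory.setReal _ 10 0 0 = μ1
  have hch1 : ChangesOnly [30] [10] μ μ1 := by
    rw [← hμ1]
    exact (ChangesOnly.refl _ _ _).setReal (by simp) _ _
  have hI1 := hI.congr (hch1.mono (by simp) (by simp))
  refine (ensures_forEdges hI1 (A := [30]) (R := [10]) 2 (fun k μ' => μ'.real 10 0 =
    ∑ j ∈ Finset.range k, if μ.nat 21 j = 0 then 0 else μ.real 0 j) (by simp) (by simp) (by simp)
    (by simp) ?_ ?_).mono ?_
  · simp [← hμ1, Memory.real_setNat, Memory.real_setReal]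
  · intro k μ' hch hI' h30 hInv
    simp only [ensures_ite, ensures_skip, ensures_setReal, Test.Holds, NatExp.eval, RealExp.eval,
      h30, (hch1.trans hch).1 21 (by simp), (hch1.trans hch).2 0 (by simp), hInv,
      Finset.sum_range_succ]
    refine ⟨fun h => ⟨by norm_num, ChangesOnly.refl _ _ _, trivial, ?_⟩,
      fun h => ⟨le_rfl, (ChangesOnly.refl _ _ _).setReal (by simp) _ _, h30, ?_⟩⟩
    · simp [Memory.real_setNat, h, hInv]
    · simp [Memory.real_setNat, Memory.real_setReal, h]
  · rintro t μ' ⟨ht, hch, h⟩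
    refine ⟨by omega, hch1.trans hch, ?_⟩
    rw [h, totalWeight_markedEdges hinj, Finset.sum_range]
    exact Finset.sum_congr rfl fun j _ => by rw [hI.weight]

/-- Keep the better one of the best solution so far and the current solution. -/
def keepBest : Cmd :=
  .ite (.and (.not (.natEq (natVar 39) (.const 0))) (.realLe (realVar 11) (realVar 10))) .skip
    (.seq (forEdges (.setNat 5 (natVar 30) (.get 21 (natVar 30))))
    (.seq (.setReal 11 (.const 0) (realVar 10)) (.setNat 39 (.const 0) (.const 1))))

theorem ensures_keepBest (hI : InstanceTables I ends v₀ μ) :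
    Ensures keepBest μ fun t μ' => t ≤ m * 3 + 5 ∧ ChangesOnly [5, 30, 39] [11] μ μ' ∧
      μ'.nat 39 0 ≠ 0 ∧
      (μ.nat 39 0 ≠ 0 ∧ μ.real 11 0 ≤ μ.real 10 0 ∧ outputEdges ends μ' = outputEdges ends μ ∧
          μ'.real 11 0 = μ.real 11 0 ∨
        (μ.nat 39 0 ≠ 0 → μ.real 10 0 ≤ μ.real 11 0) ∧
          outputEdges ends μ' = markedEdges ends (μ.nat 21) ∧ μ'.real 11 0 = μ.real 10 0) := by
  rw [keepBest, ensures_ite, ensures_skip]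
  simp only [Test.Holds, NatExp.eval, RealExp.eval]
  -- Entry 39 tells whether a solution has been stored; before that, the stored best weight is
  -- meaningless and must not be compared.
  refine ⟨fun h => ⟨by omega, ChangesOnly.refl _ _ _, h.1, Or.inl ⟨h.1, h.2, trivial, trivial⟩⟩,
    fun h => ?_⟩
  rw [ensures_seq]
  refine (ensures_forEdges hI (A := [5, 30]) (R := []) 1 (fun k μ' => ∀ j < k,
    μ'.nat 5 j = μ.nat 21 j) (by simp) (by simp) (by simp) (by simp) (by simp) ?_).mono ?_
  · intro k μ' hch hI' h30 hInv
    simp only [ensures_setNat, NatExp.eval, h30, hch.1 21 (by simp)]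
    refine ⟨le_rfl, (ChangesOnly.refl _ _ _).setNat (by simp) _ _,
      by simp [Memory.nat_setNat, h30], fun j hj => ?_⟩
    by_cases hjk : j = k
    · simp [Memory.nat_setNat, hjk]
    · simpa [Memory.nat_setNat, hjk] using hInv j (by omega)
  · rintro t μ' ⟨ht, hch, h5⟩
    simp only [ensures_seq, ensures_setReal, ensures_setNat, NatExp.eval, RealExp.eval]
    refine ⟨by omega, ((hch.mono (by simp) (by simp)).setReal (by simp) _ _).setNat (by simp) _ _,
      by simp [Memory.nat_setNat], Or.inr ⟨fun h39 => ?_, ?_, ?_⟩⟩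
    · by_contra hle
      exact h ⟨h39, (not_le.1 hle).le⟩
    · ext e
      simp only [outputEdges, markedEdges, Finset.mem_image, Finset.mem_filter, Finset.mem_univ,
        true_and, Memory.nat_setNat, Memory.nat_setReal, Nat.reduceEqDiff, false_and, if_false]
      refine exists_congr fun j => ?_
      rw [h5 j j.2]
    · simp [Memory.real_setNat, Memory.real_setReal, hch.2 10]

/-- The program marks edge numbers, not arcs. Both directions of an edge share the number `a / 2`,
so a forest edge is recognized in either direction. -/
theorem arcEdge_mem_forestEdges_iff (hinj : Function.Injective (edgeAt ends)) {pe : Fin n → ℕ}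
    (hpe : ∀ v a, pe v = a + 1 → a < 2 * m) {a : ℕ} (ha : a < 2 * m) :
    s(arcTail ends v₀ a, arcHead ends v₀ a) ∈ forestEdges (arcTail ends v₀) (arcHead ends v₀) pe ↔
      ∃ v b, pe v = b + 1 ∧ b / 2 = a / 2 := by
  rw [arcEdge_eq ends v₀ rfl (by omega)]
  refine exists_congr fun v => exists_congr fun b => and_congr_right fun hb => ?_
  have := hpe v b hb
  rw [arcEdge_eq ends v₀ rfl (by omega), hinj.eq_iff, Fin.ext_iff]
  exact eq_comm

/-- One run of the refined Steiner algorithm. -/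
def refinedSteiner : Cmd :=
  .seq scaleWeights (.seq terminalSources (.seq (.setReal 5 (.const 0) (.const 1))
  (.seq search (.seq saveSearch (.seq clearMarks (.seq markForest
  (.seq (.setNat 20 (natVar 37) (.const 1)) (.seq (.setReal 5 (.const 0) (.const 0))
  (.seq treeCosts (.seq search (.seq markBridges markAncestors)))))))))))

/-- The two calls of `search` are Dijkstra's algorithm from all terminals and Prim's algorithm from
one of them, distinguished by the stored factor and costs. Their results form a `TwoSearches`, and
the final marks describe the union of paths in `exists_minSpanningTree`. -/
theorem ensures_refinedSteiner (hI : InstanceTables I ends v₀ μ) (hE : IsEdgeList I.graph ends)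
    {α : ℝ} (hα : μ.real 9 0 = α) (h1α : 1 ≤ α) (hn : 0 < n) :
    Ensures refinedSteiner μ fun t μ' => t ≤ 13 * m + 29 * n + 19 + 2 * searchTime n (2 * m) ∧
      ChangesOnly [13, 14, 15, 16, 17, 18, 20, 21, 22, 23, 30, 31, 32, 33, 34, 35, 36, 37, 38]
        [2, 3, 4, 5, 6, 7, 8] μ μ' ∧
      I.IsRefinedOutput α (markedEdges ends (μ'.nat 21)) := by
  have hA := isArcList_arcs hE v₀
  rw [refinedSteiner, ensures_seq]
  refine (ensures_scaleWeights hI hα).mono ?_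
  rintro t1 μ1 ⟨ht1, hch1, hw1⟩
  have hI1 := hI.congr (hch1.mono (by simp) (by simp))
  rw [ensures_seq]
  refine (ensures_terminalSources hI1).mono ?_
  rintro t2 μ2 ⟨ht2, hch2, hs2⟩
  have hI2 := hI1.congr (hch2.mono (by simp) (by simp))
  rw [ensures_seq, ensures_setReal, ensures_seq]
  simp only [NatExp.eval, RealExp.eval, Nat.cast_one]
  generalize hμ3 : Memory.setReal _ 5 0 1 = μ3
  have hch3 : ChangesOnly [] [5] μ2 μ3 := by
    rw [← hμ3]
    exact (ChangesOnly.refl _ _ _).setReal (by simp) _ _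
  have hI3 := hI2.congr (hch3.mono (by simp) (by simp))
  have hin3 : SearchInput (I.forestProblem (I.scaledWeight α) (2 * m) (arcTail ends v₀)
      (arcHead ends v₀)) μ3 := by
    refine ⟨hI3.tables, by simp [← hμ3, Memory.real_setReal], fun h hh => ?_, fun v => ?_⟩
    · have hm : h / 2 < m := by
        simp only [Instance.forestProblem_arcs] at hh
        omega
      rw [Instance.forestProblem_cost, arcEdge_eq ends v₀ rfl hm, hch3.2 6 (by simp),
        hch2.2 6 (by simp)]
      exact (hw1 ⟨h / 2, hm⟩).1
    · rw [hch3.1 20 (by simp)]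
      exact hs2 v
  refine (ensures_search hin3 hn).mono ?_
  rintro t4 μ4 ⟨ht4, hch4, L, hres⟩
  have hI4 := hI3.congr (hch4.mono (by simp) (by simp))
  rw [ensures_seq]
  refine (ensures_saveSearch hI4).mono ?_
  rintro t5 μ5 ⟨ht5, hch5, h38, ⟨s, hs, h37⟩, hv5⟩
  have hI5 := hI4.congr (hch5.mono (by simp) (by simp))
  rw [ensures_seq]
  refine (ensures_clearMarks hI5).mono ?_
  rintro t6 μ6 ⟨ht6, hch6, hz6⟩
  have hI6 := hI5.congr (hch6.mono (by simp) (by simp))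
  have hparc := hres.trace.parent_lt hres.unreached
  have e17 : ∀ v : Fin n, μ6.nat 17 v = μ4.nat 15 v := by
    intro v
    rw [hch6.1 17 (by simp), (hv5 v).1]
  rw [ensures_seq]
  refine (ensures_markForest hI6 (fun v a ha => hparc v a (by rw [← e17, ha]))
    fun j hj => (hz6 j hj).2).mono ?_
  rintro t7 μ7 ⟨ht7, hch7, h23⟩
  have hI7 := hI6.congr (hch7.mono (by simp) (by simp))
  have hch57 : ChangesOnly [21, 23, 30] [] μ5 μ7 :=
    hch6.trans (hch7.mono (by simp) (by simp))
  rw [ensures_seq, ensures_setNat, ensures_seq, ensures_setReal]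
  simp only [NatExp.eval, RealExp.eval, Nat.cast_zero, hch57.1 37 (by simp), h37]
  generalize hμ9 : Memory.setReal _ 5 0 0 = μ9
  have hch9 : ChangesOnly [20] [5] μ7 μ9 := by
    rw [← hμ9]
    exact ((ChangesOnly.refl _ _ _).setNat (by simp) _ _).setReal (by simp) _ _
  have hI9 := hI7.congr (hch9.mono (by simp) (by simp))
  have h20 : ∀ v : Fin n, μ9.nat 20 v ≠ 0 ↔ v = s := by
    intro v
    have : μ7.nat 20 v = 0 := by rw [hch57.1 20 (by simp)]; exact (hv5 v).2.2.2.1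
    simp [← hμ9, Memory.nat_setReal, Memory.nat_setNat, this, Fin.ext_iff]
  rw [ensures_seq]
  refine (ensures_treeCosts hI9).mono ?_
  rintro t10 μ10 ⟨ht10, hch10, hc10⟩
  have hI10 := hI9.congr (hch10.mono (by simp) (by simp))
  set pe : Fin n → ℕ := fun v => μ4.nat 15 v
  set d : Fin n → ℝ := fun v => μ4.real 3 v
  -- The mark in array 23 decides membership in the forest, so the stored costs agree with those of
  -- `treeProblem`.
  have hforest : ∀ a < 2 * m, (μ7.nat 23 (a / 2) ≠ 0 ↔ s(arcTail ends v₀ a, arcHead ends v₀ a) ∈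
      forestEdges (arcTail ends v₀) (arcHead ends v₀) pe) := by
    intro a ha
    rw [arcEdge_mem_forestEdges_iff hE.1 hparc ha, h23 _ (by omega)]
    simp only [e17]
  have hin10 : SearchInput (treeProblem (I.scaledWeight α) (2 * m) (arcTail ends v₀)
      (arcHead ends v₀) d pe s) μ10 := by
    refine ⟨hI10.tables, ?_, fun h hh => ?_, fun v => ?_⟩
    · rw [hch10.2 5 (by simp)]
      simp [← hμ9, Memory.real_setReal]
    · simp only [treeProblem_arcs] at hh
      have hm : h / 2 < m := by omega
      have h23' : μ9.nat 23 (h / 2) = μ7.nat 23 (h / 2) := by rw [hch9.1 23 (by simp)]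
      have h4 : ∀ v : Fin n, μ9.real 4 v = d v := by
        intro v
        rw [hch9.2 4 (by simp), hch57.2 4 (by simp), (hv5 v).2.2.1]
      have h7 : μ9.real 7 (h / 2) = I.scaledWeight α (edgeAt ends ⟨h / 2, hm⟩) := by
        rw [hch9.2 7 (by simp), hch57.2 7 (by simp), hch5.2 7 (by simp), hch4.2 7 (by simp),
          hch3.2 7 (by simp), hch2.2 7 (by simp)]
        exact (hw1 ⟨h / 2, hm⟩).2
      have hc := hc10 ⟨h / 2, hm⟩
      simp only [h23', h4, h7] at hc
      rw [treeProblem_cost, hc]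
      by_cases hz : μ7.nat 23 (h / 2) = 0
      · rw [if_pos hz, if_neg fun hmem => (hforest h hh).2 hmem hz, arcEdge_eq ends v₀ rfl hm,
          arcTail, arcHead, dif_pos hm, dif_pos hm]
        split_ifs <;> ring
      · rw [if_neg hz, if_pos ((hforest h hh).1 hz)]
    · rw [hch10.1 20 (by simp)]
      exact h20 v
  rw [ensures_seq]
  refine (ensures_search hin10 hn).mono ?_
  rintro t11 μ11 ⟨ht11, hch11, L', hres'⟩
  have hI11 := hI10.congr (hch11.mono (by simp) (by simp))
  have hch711 : ChangesOnly [13, 14, 15, 16, 20, 30, 31, 32, 33, 34, 35, 36] [2, 3, 5, 6, 8] μ7 μ11 :=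
    ((hch9.mono (by simp) (by simp)).trans (hch10.mono (by simp) (by simp))).trans
      (hch11.mono (by simp) (by simp))
  have hparc' := hres'.trace.parent_lt hres'.unreached
  rw [ensures_seq]
  refine (ensures_markBridges hI11 hparc' (fun j hj => ?_) fun v => ?_).mono ?_
  · rw [hch711.1 21 (by simp), hch7.1 21 (by simp)]
    exact (hz6 j hj).1
  · rw [hch711.1 22 (by simp), hch57.1 22 (by simp)]
    exact (hv5 v).2.2.2.2
  rintro t12 μ12 ⟨ht12, hch12, h21, h22⟩
  have hI12 := hI11.congr (hch12.mono (by simp) (by simp))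
  have hch512 : ChangesOnly [13, 14, 15, 16, 20, 21, 22, 23, 30, 31, 32, 33, 34, 35, 36]
      [2, 3, 5, 6, 8] μ5 μ12 :=
    ((hch57.mono (by simp) (by simp)).trans (hch711.mono (by simp) (by simp))).trans
      (hch12.mono (by simp) (by simp))
  refine (ensures_markAncestors hI12 hres.trace hres.unreached (fun v => ?_) ?_ ?_).mono ?_
  · rw [hch512.1 17 (by simp)]
    exact (hv5 v).1
  · rw [hch512.1 18 (by simp)]
    refine hres.order.congr fun i hi => ?_
    have hlen := hres.trace.nodup.length_le_card
    rw [Fintype.card_fin] at hlen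
    exact (hv5 ⟨i, by omega⟩).2.1
  · rw [hch512.1 38 (by simp), h38]
    exact hres.count
  rintro t13 μ13 ⟨ht13, hch13, hmark⟩
  refine ⟨?_, ?_, ?_⟩
  · simp only [Instance.forestProblem_arcs, treeProblem_arcs] at ht4 ht11
    omega
  · refine ChangesOnly.trans ?_ ((hch512.mono (by simp) (by simp)).trans
      (hch13.mono (by simp) (by simp)))
    exact (((hch1.mono (by simp) (by simp)).trans (hch2.mono (by simp) (by simp))).trans
      (hch3.mono (by simp) (by simp))).trans ((hch4.mono (by simp) (by simp)).trans
      (hch5.mono (by simp) (by simp)))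
  · have hT : TwoSearches I (I.scaledWeight α) (2 * m) (arcTail ends v₀) (arcHead ends v₀) d pe L s
        (fun v => μ11.real 3 v) (fun v => μ11.nat 15 v) L' :=
      { weight_nonneg := I.scaledWeight_nonneg h1α
        arcList := hA
        trace := hres.trace
        closed := hres.closed
        unreached := hres.unreached
        source_mem := hs
        trace' := hres'.trace
        closed' := hres'.closed }
    obtain ⟨M, hM, p, hp, hmem⟩ := hT.exists_minSpanningTree
    refine ⟨M, hM, p, hp, Finset.ext fun e => ?_⟩
    have hbridge : ∀ (v : Fin n) (a : ℕ), μ11.nat 15 v = a + 1 → (μ11.nat 23 (a / 2) = 0 ↔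
        s(arcTail ends v₀ a, arcHead ends v₀ a) ∉
          forestEdges (arcTail ends v₀) (arcHead ends v₀) pe) := by
      intro v a ha
      rw [hch711.1 23 (by simp), ← hforest a (hparc' v a ha), not_not]
    have hin : ∀ (v : Fin n) (a : ℕ), μ11.nat 15 v = a + 1 → v ∈ L' := by
      intro v a ha
      by_contra hv
      have := hres'.unreached v hv
      omega
    rw [hmem, mem_markedEdges]
    constructor
    · rintro ⟨j, hj, rfl⟩
      rw [hmark j j.2, h21 j j.2] at hj
      rcases hj with ⟨v, a, h1, h2, h3⟩ | ⟨x, u, hu, hxu, b, hb, hbj⟩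
      · exact ⟨v, hin v a h1, a, h1, (hbridge v a h1).1 h2,
          Or.inl (arcEdge_eq ends v₀ h3 j.2).symm⟩
      · obtain ⟨v, a, h1, h2, h3⟩ := (h22 u).1 hu
        refine ⟨v, hin v a h1, a, h1, (hbridge v a h1).1 h2, Or.inr ⟨x, ?_, b, hb,
          (arcEdge_eq ends v₀ hbj j.2).symm⟩⟩
        rcases h3 with rfl | rfl
        · exact Or.inl hxu
        · exact Or.inr hxu
    · rintro ⟨v, hv, a, h1, h2, h3⟩
      have ha := hparc' v a h1
      simp only [treeProblem_arcs] at ha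
      rcases h3 with rfl | ⟨x, hx, b, hb, rfl⟩
      · refine ⟨⟨a / 2, by omega⟩, ?_, (arcEdge_eq ends v₀ rfl _).symm⟩
        rw [hmark _ (by omega), h21 _ (by omega)]
        exact Or.inl ⟨v, a, h1, (hbridge v a h1).2 h2, rfl⟩
      · have hbm := hparc x b hb
        simp only [Instance.forestProblem_arcs] at hbm
        refine ⟨⟨b / 2, by omega⟩, ?_, (arcEdge_eq ends v₀ rfl _).symm⟩
        rw [hmark _ (by omega)]
        right
        rcases hx with hx | hx
        · exact ⟨x, _, (h22 _).2 ⟨v, a, h1, (hbridge v a h1).2 h2, Or.inl rfl⟩, hx, b, hb, rfl⟩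
        · exact ⟨x, _, (h22 _).2 ⟨v, a, h1, (hbridge v a h1).2 h2, Or.inr rfl⟩, hx, b, hb, rfl⟩

end RoundProgram

/-! ### Building the tables from the input -/

section Preprocessing

variable {n m : ℕ} {I : Instance (Fin n)} {ends : Fin m → Fin n × Fin n} {v₀ : Fin n} {μ : Memory}

theorem IsLinked.congr {next next' : ℕ → ℕ} {x : ℕ} {l : List ℕ} (h : IsLinked next x l)
    (hn : ∀ a ∈ l, next' a = next a) : IsLinked next' x l := by
  induction l generalizing x with
  | nil => exact h
  | cons a l ih =>
    refine ⟨h.1, ?_⟩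
    rw [hn a List.mem_cons_self]
    exact ih h.2 fun b hb => hn b (List.mem_cons_of_mem _ hb)

/-- The first `q` arcs are stored. -/
structure ArcsStored (ends : Fin m → Fin n × Fin n) (v₀ : Fin n) (q : ℕ) (μ : Memory) : Prop where
  arc : ∀ h < q, μ.nat 6 h = arcTail ends v₀ h ∧ μ.nat 7 h = arcHead ends v₀ h ∧ μ.nat 8 h = h / 2
  lists : ∀ v : Fin n, ∃ l, IsLinked (μ.nat 10) (μ.nat 9 v) l ∧ l.Nodup ∧
    ∀ h, h ∈ l ↔ h < q ∧ arcTail ends v₀ h = v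
  count : μ.nat 36 0 = q

/-- Store the direction of the current edge from its end in the array `a` to its end in `b`. -/
def storeArc (a b : ℕ) : Cmd :=
  .seq (.setNat 6 (natVar 36) (.get a (natVar 30)))
  (.seq (.setNat 7 (natVar 36) (.get b (natVar 30)))
  (.seq (.setNat 8 (natVar 36) (natVar 30))
  (.seq (.setNat 10 (natVar 36) (.get 9 (.get a (natVar 30))))
  (.seq (.setNat 9 (.get a (natVar 30)) (.succ (natVar 36)))
  (.setNat 36 (.const 0) (.succ (natVar 36)))))))

/-- The new arc `q` is put in front of the list of its tail. Its link is a fresh entry, so the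
existing lists stay intact. -/
theorem ensures_storeArc {q a b : ℕ} (hS : ArcsStored ends v₀ q μ) (ha3 : a < 3) (hb3 : b < 3)
    (ha : μ.nat a (μ.nat 30 0) = arcTail ends v₀ q) (hb : μ.nat b (μ.nat 30 0) = arcHead ends v₀ q)
    (h30 : μ.nat 30 0 = q / 2) :
    Ensures (storeArc a b) μ fun t μ' => t ≤ 6 ∧ ChangesOnly [6, 7, 8, 9, 10, 36] [] μ μ' ∧
      ArcsStored ends v₀ (q + 1) μ' := by
  rw [h30] at ha hb
  have na : ∀ c, 3 ≤ c → a ≠ c := fun c hc h => by omega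
  have nb : ∀ c, 3 ≤ c → b ≠ c := fun c hc h => by omega
  have hc := hS.count
  simp only [storeArc, ensures_seq, ensures_setNat, NatExp.eval, Memory.nat_setNat, h30, hc]
  simp only [Nat.reduceEqDiff, false_and, if_false, na 6 (by omega), na 7 (by omega),
    na 8 (by omega), na 10 (by omega), nb 6 (by omega), ha, hb]
  generalize hμ1 : Memory.setNat _ 36 0 (q + 1) = μ1
  have e6 : ∀ j, μ1.nat 6 j = if j = q then (arcTail ends v₀ q : ℕ) else μ.nat 6 j := by
    simp [← hμ1, Memory.nat_setNat]
  have e7 : ∀ j, μ1.nat 7 j = if j = q then (arcHead ends v₀ q : ℕ) else μ.nat 7 j := by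
    simp [← hμ1, Memory.nat_setNat]
  have e8 : ∀ j, μ1.nat 8 j = if j = q then q / 2 else μ.nat 8 j := by
    simp [← hμ1, Memory.nat_setNat]
  have e10 : ∀ j, μ1.nat 10 j = if j = q then μ.nat 9 (arcTail ends v₀ q) else μ.nat 10 j := by
    simp [← hμ1, Memory.nat_setNat]
  have e9 : ∀ v : Fin n, μ1.nat 9 v = if v = arcTail ends v₀ q then q + 1 else μ.nat 9 v := by
    simp [← hμ1, Memory.nat_setNat, Fin.ext_iff]
  refine ⟨by norm_num, ?_, fun h hh => ?_, fun v => ?_, by simp [← hμ1, Memory.nat_setNat]⟩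
  · rw [← hμ1]
    exact ((((((ChangesOnly.refl _ _ _).setNat (by simp) _ _).setNat (by simp) _ _).setNat
      (by simp) _ _).setNat (by simp) _ _).setNat (by simp) _ _).setNat (by simp) _ _
  · rw [e6, e7, e8]
    by_cases hq : h = q
    · simp [hq]
    · simpa [hq] using hS.arc h (by omega)
  · obtain ⟨l, h1, h2, h3⟩ := hS.lists v
    have h1' : IsLinked (μ1.nat 10) (μ.nat 9 v) l := by
      refine h1.congr fun x hx => ?_
      have := ((h3 x).1 hx).1
      rw [e10, if_neg (by omega)]
    rw [e9]
    by_cases hv : v = arcTail ends v₀ q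
    · refine ⟨q :: l, ⟨by rw [if_pos hv], ?_⟩, List.nodup_cons.2 ⟨fun hq => ?_, h2⟩, fun h => ?_⟩
      · rw [e10, if_pos rfl, ← hv]
        exact h1'
      · have := ((h3 q).1 hq).1
        omega
      · rw [List.mem_cons, h3]
        constructor
        · rintro (rfl | h)
          · exact ⟨by omega, hv.symm⟩
          · exact ⟨by omega, h.2⟩
        · rintro ⟨h4, h5⟩
          by_cases hq : h = q
          · exact Or.inl hq
          · exact Or.inr ⟨by omega, h5⟩
    · refine ⟨l, by rwa [if_neg hv], h2, fun h => ?_⟩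
      rw [h3]
      refine ⟨fun h => ⟨by omega, h.2⟩, fun h4 => ⟨?_, h4.2⟩⟩
      have : h ≠ q := by
        rintro rfl
        exact hv h4.2.symm
      omega

/-- Store all arcs. -/
def storeArcs : Cmd := forEdges (.seq (storeArc 1 2) (storeArc 2 1))

theorem ensures_storeArcs (hm : μ.nat 0 1 = m) (h1 : ∀ j : Fin m, μ.nat 1 j = (ends j).1)
    (h2 : ∀ j : Fin m, μ.nat 2 j = (ends j).2) (h9 : ∀ v : Fin n, μ.nat 9 v = 0)
    (h36 : μ.nat 36 0 = 0) :
    Ensures storeArcs μ fun t μ' => t ≤ m * 14 + 2 ∧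
      ChangesOnly [6, 7, 8, 9, 10, 30, 36] [] μ μ' ∧ ArcsStored ends v₀ (2 * m) μ' := by
  refine (Ensures.forLoop (fun k μ' => ChangesOnly [6, 7, 8, 9, 10, 30, 36] [] μ μ' ∧
    ArcsStored ends v₀ (2 * k) μ') m 12 ?_ ?_ ?_).mono fun t μ' h => h
  · rintro k μ' ⟨hch, -⟩
    simp only [NatExp.eval, hch.1 0 (by simp)]
    exact hm
  · refine ⟨(ChangesOnly.refl _ _ _).setNat (by simp) _ _, by simp, fun v => ⟨[], ?_, by simp⟩, ?_⟩
    · simp [IsLinked, Memory.nat_setNat, h9]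
    · simp [Memory.nat_setNat, h36]
  · rintro k μ' hk ⟨hch, hS⟩ h30
    have q0 : 2 * k / 2 = k := by omega
    have q1 : (2 * k + 1) / 2 = k := by omega
    have r0 : 2 * k % 2 = 0 := by omega
    have r1 : ¬ (2 * k + 1) % 2 = 0 := by omega
    have f1 := h1 ⟨k, hk⟩
    have f2 := h2 ⟨k, hk⟩
    rw [← hch.1 1 (by simp)] at f1
    rw [← hch.1 2 (by simp)] at f2
    rw [ensures_seq]
    refine (ensures_storeArc hS (a := 1) (b := 2) (by omega) (by omega) ?_ ?_ (by omega)).mono ?_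
    · simp only [h30, arcTail, q0, hk, dif_pos, r0, if_true]
      exact f1
    · simp only [h30, arcHead, q0, hk, dif_pos, r0, if_true]
      exact f2
    rintro t1 μ1 ⟨ht1, hch1, hS1⟩
    have h30' : μ1.nat 30 0 = k := by rw [hch1.1 30 (by simp), h30]
    refine (ensures_storeArc hS1 (a := 2) (b := 1) (by omega) (by omega) ?_ ?_ (by omega)).mono ?_
    · simp only [h30', arcTail, q1, hk, dif_pos, r1, if_false, hch1.1 2 (by simp)]
      exact f2
    · simp only [h30', arcHead, q1, hk, dif_pos, r1, if_false, hch1.1 1 (by simp)]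
      exact f1
    rintro t2 μ2 ⟨ht2, hch2, hS2⟩
    refine ⟨by omega, by rw [hch2.1 30 (by simp), h30'], ((hch.trans (hch1.mono (by simp)
      (by simp))).trans (hch2.mono (by simp) (by simp))).setNat (by simp) _ _, hS2.arc,
      hS2.lists, ?_⟩
    rw [Memory.nat_setNat, if_neg (by simp), hS2.count]
    ring

/-- Compute the tables of leaves, left children and parents of the tournament tree. -/
def storeTree : Cmd :=
  .seq (.setNat 35 (.const 0) (natVar 0)) (.seq (.setNat 36 (.const 0) (.const 0))
    (forVertices
      (.seq (.setNat 19 (natVar 30) (natVar 35))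
      (.seq (.setNat 35 (.const 0) (.succ (natVar 35)))
      (.seq (.setNat 11 (natVar 30) (natVar 36))
      (.seq (.setNat 12 (natVar 36) (natVar 30))
      (.seq (.setNat 36 (.const 0) (.succ (natVar 36)))
      (.seq (.setNat 12 (natVar 36) (natVar 30))
      (.setNat 36 (.const 0) (.succ (natVar 36)))))))))))

theorem ensures_storeTree (hn : μ.nat 0 0 = n) :
    Ensures storeTree μ fun t μ' => t ≤ n * 9 + 4 ∧
      ChangesOnly [11, 12, 19, 30, 35, 36] [] μ μ' ∧ HeapTables n μ' ∧
      ∀ v < n, μ'.nat 19 v = n + v := by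
  simp only [storeTree, ensures_seq, ensures_setNat, NatExp.eval]
  -- The machine can only count on natural numbers, so entries 35 and 36 supply `n + k` and `2 * k`
  -- by incrementing along with the loop.
  refine (Ensures.forLoop (fun k μ' => ChangesOnly [11, 12, 19, 30, 35, 36] [] μ μ' ∧
    μ'.nat 35 0 = n + k ∧ μ'.nat 36 0 = 2 * k ∧ (∀ v < k, μ'.nat 19 v = n + v) ∧
    (∀ i < k, μ'.nat 11 i = 2 * i) ∧ ∀ i < 2 * k, μ'.nat 12 i = i / 2) n 7 ?_ ?_ ?_).mono ?_
  · rintro k μ' ⟨hch, -⟩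
    simp only [NatExp.eval, hch.1 0 (by simp)]
    exact hn
  · refine ⟨(((ChangesOnly.refl _ _ _).setNat (by simp) _ _).setNat (by simp) _ _).setNat
      (by simp) _ _, ?_, ?_, by simp, by simp, by simp⟩
    · simp [Memory.nat_setNat, hn]
    · simp [Memory.nat_setNat]
  · rintro k μ' hk ⟨hch, h35, h36, h19, h11, h12⟩ h30
    simp only [ensures_seq, ensures_setNat, NatExp.eval, Memory.nat_setNat]
    simp only [Nat.reduceEqDiff, false_and, if_false, true_and, if_true, h30, h35, h36]
    refine ⟨by norm_num, (((((((hch.setNat (by simp) _ _).setNat (by simp) _ _).setNat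
      (by simp) _ _).setNat (by simp) _ _).setNat (by simp) _ _).setNat (by simp) _ _).setNat
      (by simp) _ _).setNat (by simp) _ _, by omega, by omega, fun v hv => ?_, fun i hi => ?_,
      fun i hi => ?_⟩
    · by_cases hvk : v = k
      · rw [if_pos hvk, hvk]
      · rw [if_neg hvk]
        exact h19 v (by omega)
    · by_cases hik : i = k
      · rw [if_pos hik, hik]
      · rw [if_neg hik]
        exact h11 i (by omega)
    · split_ifs
      · omega
      · omega
      · exact h12 i (by omega)
  · rintro t μ' ⟨ht, hch, -, -, h19, h11, h12⟩
    exact ⟨by omega, hch, ⟨fun i _ hi => h11 i hi, fun i _ hi => h12 i hi⟩, h19⟩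

/-- Compute the tables of the instance. -/
def storeTables : Cmd := .seq storeArcs storeTree

theorem ensures_storeTables (I : Instance (Fin n)) (ends : Fin m → Fin n × Fin n) (v₀ : Fin n)
    (ε : ℝ) :
    Ensures storeTables (inputMemory I ends ε) fun t μ => t ≤ m * 14 + n * 9 + 6 ∧
      InstanceTables I ends v₀ μ ∧ μ.real 1 0 = ε ∧ μ.nat 39 0 = 0 ∧ μ.nat 40 0 = 0 := by
  rw [storeTables, ensures_seq]
  refine (ensures_storeArcs (v₀ := v₀) (ends := ends) ?_ ?_ ?_ ?_ ?_).mono ?_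
  · simp [inputMemory]
  · simp [inputMemory]
  · simp [inputMemory]
  · simp [inputMemory]
  · simp [inputMemory]
  rintro t1 μ1 ⟨ht1, hch1, hS⟩
  refine (ensures_storeTree (n := n) ?_).mono ?_
  · rw [hch1.1 0 (by simp)]
    simp [inputMemory]
  rintro t2 μ2 ⟨ht2, hch2, hheap, hleaf⟩
  have hch : ChangesOnly [6, 7, 8, 9, 10, 11, 12, 19, 30, 35, 36] [] (inputMemory I ends ε) μ2 :=
    (hch1.mono (by simp) (by simp)).trans (hch2.mono (by simp) (by simp))
  refine ⟨by omega, ⟨⟨?_, fun h hh => ?_, fun h hh => ?_, fun h hh => ?_, fun v => ?_, hheap,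
    hleaf⟩, ?_, ?_, ?_, ?_, ?_, ?_⟩, ?_, ?_, ?_⟩
  · rw [hch.1 0 (by simp)]
    simp [inputMemory]
  · rw [hch2.1 6 (by simp)]
    exact (hS.arc h hh).1
  · rw [hch2.1 7 (by simp)]
    exact (hS.arc h hh).2.1
  · rw [hch2.1 8 (by simp)]
    exact (hS.arc h hh).2.2
  · rw [hch2.1 9 (by simp), hch2.1 10 (by simp)]
    exact hS.lists v
  · rw [hch.1 0 (by simp)]
    simp [inputMemory]
  · rw [hch.1 1 (by simp)]
    simp [inputMemory]
  · rw [hch.1 2 (by simp)]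
    simp [inputMemory]
  · rw [hch.1 3 (by simp)]
    simp [inputMemory]
  · rw [hch.1 4 (by simp)]
    simp [inputMemory]
  · rw [hch.2 0 (by simp)]
    simp [inputMemory]
  · rw [hch.2 1 (by simp)]
    simp [inputMemory]
  · rw [hch.1 39 (by simp)]
    simp [inputMemory]
  · rw [hch.1 40 (by simp)]
    simp [inputMemory]

end Preprocessing

/-! ### The search for α and its running time -/

section AlphaSearch

variable {n m : ℕ} {I : Instance (Fin n)} {ends : Fin m → Fin n × Fin n} {v₀ : Fin n} {μ : Memory}
  {ε : ℝ}

/-- The machine has no logarithm; this turns the end of the search into a comparison of the current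
power with `ε`, which the program tests after each round. -/
theorem lastIndex_le_iff (hε : 0 < ε) (i : ℕ) : lastIndex ε ≤ i ↔ 1 ≤ (1 + ε) ^ i * ε := by
  rw [lastIndex, Nat.ceil_le, Real.logb_le_iff_le_rpow (by linarith) (by positivity),
    Real.rpow_natCast, inv_le_iff_one_le_mul₀ hε]

/-- The best one of the first `i` solutions is stored. -/
def IsBestOf (I : Instance (Fin n)) (ends : Fin m → Fin n × Fin n) (ε : ℝ) (i : ℕ) (μ : Memory) :
    Prop :=
  (μ.nat 39 0 = 0 ↔ i = 0) ∧ ∃ Y : ℕ → Finset (Sym2 (Fin n)),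
    (∀ j < i, I.IsRefinedOutput ((1 + ε) ^ j) (Y j)) ∧
    (0 < i → ∃ j < i, outputEdges ends μ = Y j ∧ μ.real 11 0 = totalWeight I.weight (Y j) ∧
      ∀ j' < i, totalWeight I.weight (Y j) ≤ totalWeight I.weight (Y j'))

theorem IsBestOf.congr {i : ℕ} {μ' : Memory} {A R : List ℕ} (h : IsBestOf I ends ε i μ)
    (hμ : ChangesOnly A R μ μ') (h5 : 5 ∉ A) (h39 : 39 ∉ A) (h11 : 11 ∉ R) :
    IsBestOf I ends ε i μ' := by
  unfold IsBestOf outputEdges at h ⊢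
  rwa [hμ.1 5 h5, hμ.1 39 h39, hμ.2 11 h11]

/-- The time of one iteration. -/
def roundTime (n m : ℕ) : ℕ := 20 * m + 29 * n + 31 + 2 * searchTime n (2 * m)

/-- Compute one more solution and keep the better one. -/
def improveSolution : Cmd := .seq refinedSteiner (.seq sumMarked keepBest)

/-- The new solution extends the sequence at index `i`, and `keepBest` retains the minimum. The
three subprograms take at most 20 m + 29 n + 27 steps beyond the two searches; the spare 4 pays for
the tests and the assignment around them in the loop. -/
theorem ensures_improveSolution (hI : InstanceTables I ends v₀ μ) (hE : IsEdgeList I.graph ends)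
    (hε : 0 < ε) {i : ℕ} (h9 : μ.real 9 0 = (1 + ε) ^ i) (hb : IsBestOf I ends ε i μ)
    (hn : 0 < n) :
    Ensures improveSolution μ fun t μ' => t + 4 ≤ roundTime n m ∧ RoundChanges μ μ' ∧
      IsBestOf I ends ε (i + 1) μ' := by
  rw [improveSolution, ensures_seq]
  refine (ensures_refinedSteiner hI hE h9 (one_le_pow₀ (by linarith)) hn).mono ?_
  rintro t1 μ1 ⟨ht1, hch1, hX⟩
  have hI1 := hI.congr (hch1.mono (by simp) (by simp))
  rw [ensures_seq]
  refine (ensures_sumMarked hI1 hE.1).mono ?_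
  rintro t2 μ2 ⟨ht2, hch2, hw⟩
  have hI2 := hI1.congr (hch2.mono (by simp) (by simp))
  refine (ensures_keepBest hI2).mono ?_
  rintro t3 μ3 ⟨ht3, hch3, h39, hor⟩
  refine ⟨?_, ((hch1.mono (by simp) (by simp)).trans (hch2.mono (by simp) (by simp))).trans
    (hch3.mono (by simp) (by simp)), by simp [h39], ?_⟩
  · rw [roundTime]
    omega
  obtain ⟨hb0, Y, hY, hbest⟩ := hb
  rw [hch2.1 21 (by simp), hch2.1 39 (by simp), hch1.1 39 (by simp), hch2.2 11 (by simp),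
    hch1.2 11 (by simp), hw] at hor
  have hout : outputEdges ends μ2 = outputEdges ends μ := by
    unfold outputEdges
    rw [hch2.1 5 (by simp), hch1.1 5 (by simp)]
  rw [hout] at hor
  set X := markedEdges ends (μ1.nat 21)
  have hne : ∀ j < i, Function.update Y i X j = Y j := fun j hj =>
    Function.update_of_ne (by omega) _ _
  have hi : Function.update Y i X i = X := Function.update_self ..
  refine ⟨Function.update Y i X, fun j hj => ?_, fun _ => ?_⟩
  · rcases Nat.lt_succ_iff_lt_or_eq.1 hj with hj | rfl
    · rw [hne j hj]
      exact hY j hj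
    · rw [hi]
      exact hX
  · rcases hor with ⟨h0, hle, ho, h11⟩ | ⟨hle, ho, h11⟩
    · obtain ⟨j, hj, h1, h2, h3⟩ := hbest (Nat.pos_of_ne_zero fun h => h0 (hb0.2 h))
      refine ⟨j, by omega, ?_, ?_, fun j' hj' => ?_⟩
      · rw [ho, h1, hne j hj]
      · rw [h11, h2, hne j hj]
      · rw [hne j hj]
        rcases Nat.lt_succ_iff_lt_or_eq.1 hj' with hj' | rfl
        · rw [hne j' hj']
          exact h3 j' hj'
        · rw [hi, ← h2]
          exact hle
    · refine ⟨i, by omega, by rw [ho, hi], by rw [h11, hi], fun j' hj' => ?_⟩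
      rw [hi]
      rcases Nat.lt_succ_iff_lt_or_eq.1 hj' with hj' | rfl
      · rw [hne j' hj']
        obtain ⟨j, hj, h1, h2, h3⟩ := hbest (by omega)
        refine (hle fun h => ?_).trans (h2.le.trans (h3 j' hj'))
        have := hb0.1 h
        omega
      · rw [hi]

/-- The search for the best `α`. -/
def searchAlpha : Cmd :=
  .seq (.setReal 9 (.const 0) (.const 1))
    (.loop (.natEq (natVar 40) (.const 0)) (.seq improveSolution
      (.ite (.realLe (.const 1) (.mul (realVar 9) (realVar 1)))
        (.setNat 40 (.const 0) (.const 1))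
        (.setReal 9 (.const 0) (.mul (realVar 9) (.add (.const 1) (realVar 1)))))))

theorem ensures_searchAlpha (hI : InstanceTables I ends v₀ μ) (hE : IsEdgeList I.graph ends)
    (hε : 0 < ε) (h1 : μ.real 1 0 = ε) (h39 : μ.nat 39 0 = 0) (h40 : μ.nat 40 0 = 0)
    (hn : 0 < n) :
    Ensures searchAlpha μ fun t μ' => t ≤ (lastIndex ε + 1) * roundTime n m + 2 ∧
      I.IsSearchOutput ε (outputEdges ends μ') := by
  rw [searchAlpha, ensures_seq, ensures_setReal]
  simp only [NatExp.eval, RealExp.eval, Nat.cast_one]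
  generalize hμ1 : Memory.setReal _ 9 0 1 = μ1
  have hnat : μ1.nat = μ.nat := by rw [← hμ1]; rfl
  -- While entry 40 is zero, `i` solutions have been computed; once it is set, all `lastIndex ε + 1`
  -- have been, and no time bound is needed because the loop stops.
  refine (Ensures.loop (fun μ' φ => InstanceTables I ends v₀ μ' ∧ μ'.real 1 0 = ε ∧
    ((μ'.nat 40 0 = 0 ∧ ∃ i ≤ lastIndex ε, μ'.real 9 0 = (1 + ε) ^ i ∧ IsBestOf I ends ε i μ' ∧
      φ = (lastIndex ε + 1 - i) * roundTime n m) ∨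
    (μ'.nat 40 0 ≠ 0 ∧ IsBestOf I ends ε (lastIndex ε + 1) μ'))) ?_
    (φ := (lastIndex ε + 1) * roundTime n m) ?_).mono ?_
  · rintro μ' φ ⟨hI', h1', h | h⟩ hb
    · obtain ⟨-, i, hi, h9, hbest, rfl⟩ := h
      rw [ensures_seq]
      refine (ensures_improveSolution hI' hE hε h9 hbest hn).mono ?_
      rintro t μ'' ⟨ht, hch, hbest'⟩
      have hI'' := hI'.congr hch
      have h1'' : μ''.real 1 0 = ε := by rw [hch.2 1 (by simp), h1']
      have h9'' : μ''.real 9 0 = (1 + ε) ^ i := by rw [hch.2 9 (by simp), h9]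
      have h40'' : μ''.nat 40 0 = 0 := by
        rw [hch.1 40 (by simp)]
        exact hb
      obtain ⟨k, hk⟩ : ∃ k, lastIndex ε = i + k := ⟨lastIndex ε - i, by omega⟩
      have hk1 : lastIndex ε + 1 - i = k + 1 := by omega
      simp only [ensures_ite, ensures_setNat, ensures_setReal, Test.Holds, NatExp.eval,
        RealExp.eval, Nat.cast_one, h1'', h9'', ← lastIndex_le_iff hε]
      refine ⟨fun hle => ⟨0, ⟨?_, h1'', Or.inr ⟨?_, ?_⟩⟩, ?_⟩,
        fun hle => ⟨_, ⟨?_, ?_, Or.inl ⟨h40'', i + 1, by omega, ?_, ?_, rfl⟩⟩, ?_⟩⟩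
      · exact hI''.of_other ((ChangesOnly.refl [40] [] _).setNat (by simp) _ _)
          (by simp) (by simp)
      · simp [Memory.nat_setNat]
      · obtain rfl : i = lastIndex ε := by omega
        exact hbest'.congr ((ChangesOnly.refl [40] [] _).setNat (by simp) _ _) (by simp) (by simp)
          (by simp)
      · rw [hk1, add_mul]
        omega
      · exact hI''.of_other ((ChangesOnly.refl [] [9] _).setReal (by simp) _ _)
          (by simp) (by simp)
      · simp [Memory.real_setReal, h1'']
      · simp [Memory.real_setReal, pow_succ]
      · exact hbest'.congr ((ChangesOnly.refl [] [9] _).setReal (by simp) _ _) (by simp) (by simp)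
          (by simp)
      · have hk2 : lastIndex ε + 1 - (i + 1) = k := by omega
        rw [hk1, hk2, add_mul]
        omega
    · exact absurd hb h.1
  · refine ⟨?_, ?_, Or.inl ⟨by rw [hnat, h40], 0, by omega, ?_, ?_, by simp⟩⟩
    · rw [← hμ1]
      exact hI.of_other ((ChangesOnly.refl [] [9] _).setReal (by simp) _ _) (by simp) (by simp)
    · simp [← hμ1, Memory.real_setReal, h1]
    · simp [← hμ1, Memory.real_setReal]
    · exact ⟨by simp [hnat, h39], fun _ => ∅, by simp, by simp⟩
  · rintro t μ' ⟨φ, ⟨-, -, h | h⟩, hb, hle⟩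
    · exact absurd h.1 hb
    · obtain ⟨-, -, Y, hY, hbest⟩ := h
      obtain ⟨j, hj, h1, -, h3⟩ := hbest (by omega)
      refine ⟨by omega, Y, fun i hi => hY i (by omega), j, by omega, h1, fun i hi => h3 i (by omega)⟩

/-- The whole program. -/
def steinerProgram : Cmd := .seq storeTables searchAlpha

theorem ensures_steinerProgram (I : Instance (Fin n)) {ends : Fin m → Fin n × Fin n}
    (hE : IsEdgeList I.graph ends) (hε : 0 < ε) :
    Ensures steinerProgram (inputMemory I ends ε) fun t μ =>
      t ≤ m * 14 + n * 9 + 8 + (lastIndex ε + 1) * roundTime n m ∧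
      I.IsSearchOutput ε (outputEdges ends μ) := by
  obtain ⟨v₀, -⟩ := I.terminals_nonempty
  rw [steinerProgram, ensures_seq]
  refine (ensures_storeTables I ends v₀ ε).mono ?_
  rintro t1 μ1 ⟨ht1, hI, h1, h39, h40⟩
  refine (ensures_searchAlpha hI hE hε h1 h39 h40 v₀.pos).mono ?_
  rintro t2 μ2 ⟨ht2, hout⟩
  exact ⟨by omega, hout⟩

/-- A terminal exists, so n ≥ 1 and the argument is at least 3 > e. This lets the logarithm absorb
additive constants. -/
theorem one_le_log_add_two {n m : ℕ} (hn : 0 < n) : 1 ≤ Real.log ((n : ℝ) + m + 2) := by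
  have h1 : (1 : ℝ) ≤ n := by exact_mod_cast hn
  have h2 : (0 : ℝ) ≤ m := m.cast_nonneg
  rw [Real.le_log_iff_exp_le (by linarith)]
  have := Real.exp_one_lt_d9
  linarith

/-- Since log 2 > 1/2, the binary logarithm of 2n is at most 1 + 2ℓ, where ℓ = log(n + m + 2). Then
7(1 + 2ℓ) + 1 = 8 + 14ℓ ≤ 22ℓ. -/
theorem siftTime_le {n m : ℕ} (hn : 0 < n) :
    (siftTime n : ℝ) ≤ 22 * Real.log ((n : ℝ) + m + 2) := by
  have hl := one_le_log_add_two (m := m) hn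
  have h1 : (1 : ℝ) ≤ n := by exact_mod_cast hn
  have h2 : (0 : ℝ) ≤ m := m.cast_nonneg
  have h3 : (Nat.log 2 (2 * n) : ℝ) ≤ 1 + 2 * Real.log ((n : ℝ) + m + 2) := by
    have h4 : 2 ^ Nat.log 2 (2 * n) ≤ 2 * n := Nat.pow_log_le_self 2 (by omega)
    have h5 : Real.log (2 ^ Nat.log 2 (2 * n) : ℝ) ≤ Real.log (2 * n) :=
      Real.log_le_log (by positivity) (by exact_mod_cast h4)
    rw [Real.log_pow, Real.log_mul (by norm_num) (by linarith)] at h5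
    have h6 : Real.log n ≤ Real.log ((n : ℝ) + m + 2) :=
      Real.log_le_log (by linarith) (by linarith)
    have h7 := Real.log_two_gt_d9
    by_contra hlt
    rw [not_le] at hlt
    nlinarith
  rw [siftTime]
  push_cast
  linarith

/-- The coefficient of n is the larger one. Its logarithmic part is 4 · 22 = 88; the rest is 29 + 24
+ 26, and the additive constant 43 is at most 43 n, giving 210 in all. -/
theorem roundTime_le {n m : ℕ} (hn : 0 < n) :
    (roundTime n m : ℝ) ≤ 210 * (((n : ℝ) + m) * Real.log ((n : ℝ) + m + 2)) := by
  have hl := one_le_log_add_two (m := m) hn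
  have h1 : (1 : ℝ) ≤ n := by exact_mod_cast hn
  have h2 : (0 : ℝ) ≤ m := m.cast_nonneg
  have h3 := siftTime_le (m := m) hn
  set ℓ := Real.log ((n : ℝ) + m + 2)
  have h4 : (n : ℝ) ≤ n * ℓ := le_mul_of_one_le_right (by linarith) hl
  have h5 : (m : ℝ) ≤ m * ℓ := le_mul_of_one_le_right h2 hl
  have h6 : (n : ℝ) * siftTime n ≤ n * (22 * ℓ) := mul_le_mul_of_nonneg_left h3 (by linarith)
  have h7 : (m : ℝ) * siftTime n ≤ m * (22 * ℓ) := mul_le_mul_of_nonneg_left h3 h2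
  rw [roundTime, searchTime]
  push_cast
  nlinarith

end AlphaSearch

end SteinerPred

theorem mainTheorem6 :
    -- running time: one program, for all `ε`, carries out the search in near-linear time
    (∃ (P : SteinerPred.Cmd) (d : ℕ), ∀ ε : ℝ, 0 < ε → ∃ C : ℝ,
      ∀ (n m : ℕ) (I : SteinerPred.Instance (Fin n)) (ends : Fin m → Fin n × Fin n),
        SteinerPred.IsEdgeList I.graph ends →
        ∃ (μ : SteinerPred.Memory) (t : ℕ),
          SteinerPred.Exec P (SteinerPred.inputMemory I ends ε) μ t ∧
          (t : ℝ) ≤ C * ((n : ℝ) + m) * Real.log ((n : ℝ) + m + 2) ^ d ∧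
          I.IsSearchOutput ε (SteinerPred.outputEdges ends μ)) ∧
    -- quality: every output of the search, however ties are broken
    (∀ (V : Type*) [Fintype V] [DecidableEq V] (I : SteinerPred.Instance V) (ε : ℝ), 0 < ε →
      ∀ X : Finset (Sym2 V), I.IsSearchOutput ε X →
        I.IsSteinerTree X ∧
        ∀ X' : Finset (Sym2 V), I.IsSteinerTree X' →
        ∀ M : Finset (Sym2 I.terminals),
          SteinerPred.IsMinSpanningTree (I.closureCost I.weight) M →
        ∀ S : Finset (Sym2 I.terminals),
          SteinerPred.IsTopEdges (I.closureCost I.weight) M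
            (min (I.terminals.card - 1) (I.pred \ X').card) S →
        ∀ α : ℝ, 1 ≤ α →
          SteinerPred.totalWeight I.weight X ≤ (1 + ε) * I.refinedBound X' S α) := by
  -- The exponent of the logarithm is 1. The summand 20 covers the preprocessing, as 14 m + 9 n + 8
  -- ≤ 20 (n + m) for n ≥ 1; the rest pays for `lastIndex ε + 1` rounds.
  refine ⟨⟨SteinerPred.steinerProgram, 1, fun ε hε =>
    ⟨20 + 210 * (SteinerPred.lastIndex ε + 1), fun n m I ends hE => ?_⟩⟩, ?_⟩
  · obtain ⟨μ, t, hexec, ht, hout⟩ := SteinerPred.ensures_steinerProgram I hE hε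
    refine ⟨μ, t, hexec, ?_, hout⟩
    obtain ⟨v₀, -⟩ := I.terminals_nonempty
    have hl := SteinerPred.one_le_log_add_two (m := m) v₀.pos
    have hr := SteinerPred.roundTime_le (m := m) v₀.pos
    have h1 : (1 : ℝ) ≤ n := by exact_mod_cast v₀.pos
    have h2 : (0 : ℝ) ≤ m := m.cast_nonneg
    have h3 : (0 : ℝ) ≤ SteinerPred.lastIndex ε + 1 := by positivity
    have ht' : (t : ℝ) ≤ m * 14 + n * 9 + 8 +
        (SteinerPred.lastIndex ε + 1) * SteinerPred.roundTime n m := by exact_mod_cast ht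
    have h4 := le_mul_of_one_le_right (by linarith : (0 : ℝ) ≤ (n : ℝ) + m) hl
    have h5 := mul_le_mul_of_nonneg_left hr h3
    rw [pow_one]
    linarith
  · intro V _ _ I ε hε X hX
    exact ⟨hX.isSteinerTree hε, fun X' hX' M hM S hS α hα => hX.quality hε hX' hM.1 hS hα⟩
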